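/- Let $n\ge 1$, $m>0$, $\epsilon(\xi)=\sqrt{m^2+|\xi|^2}$. For $\sigma\in\mathbb R$ let $H^\sigma=H^\sigma(\mathbb R^n)$ be the space of real tempered distributions $v$ with $\|v\|_{H^\sigma}=\|\epsilon^\sigma\widehat v\|_{L^2}<\infty$ (unitary Fourier transform). Let $W:\mathbb R\times\mathbb R^{n+1}\to\mathbb R$ be an entire real-analytic function (its Taylor series at $0$ converges to it everywhere) and let $s>n/2$. Write $\square=\partial_t^2-\Delta$, $\nabla u=(\partial_tu,\partial_1u,\dots,\partial_nu)$, $[u]_t=(u(t,\cdot),\partial_tu(t,\cdot))$ and, for $d=(d_0,d_1)\in H^{s+1}\times H^s$, $\|d\|_{s+1}=\|d_0\|_{H^{s+1}}+\|d_1\|_{H^s}$. **Fock space expression.** Let $\mathcal E_0$ be the space of $\psi\in C^0(\mathbb R,H^{s+1})\cap C^1(\mathbb R,H^s)$ with $\square\psi+m^2\psi=0$, with the norm $(\|\psi(t)\|_{H^{s+1}}^2+\|\partial_t\psi(t)\|_{H^s}^2)^{1/2}$, which does not depend on $t$. For $r>0$ let $\mathbb F_r$ be the space of functionals $F(\psi)=\sum_{p\ge0}F_p(\psi,\dots,\psi)$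 on the ball of radius $r$ of $\mathcal E_0$, with $F_p$ symmetric, continuous and $p$-linear and $N_r(F)=\sum_p\|F_p\|r^p<\infty$. For $\tau\in\mathbb R$ put $$(\mathbb D_\tau F)(\psi)=\frac{\delta F}{\delta\chi}(\psi)=\lim_{h\to0}\frac{F(\psi+h\chi)-F(\psi)}h ,$$ where $\chi\in\mathcal E_0$ is the solution with $[\chi]_\tau=(0,-W(\psi,\nabla\psi)|_{t=\tau})$. For a solution $\varphi\in C^0(\mathbb R,H^{-s})\cap C^1(\mathbb R,H^{-s-1})$ of $\square\varphi+m^2\varphi=0$ let $f_\varphi(\psi)=\int_{t=0}(\psi\,\partial_t\varphi-\partial_t\psi\,\varphi)\,dx$. For $t\ge0$ let $$T\exp\Bigl(-\int_0^t\mathbb D_\tau d\tau\Bigr)f_\varphi=\sum_{k\ge0}(-1)^k\int_{0<\tau_1<\dots<\tau_k<t}\mathbb D_{\tau_k}\cdots\mathbb D_{\tau_1}f_\varphi\,d\tau .$$ For $d\in H^{s+1}\times H^s$ let $\psi_{t,d}\in\mathcal E_0$ be the solution with $[\psi_{t,d}]_t=d$, let $\mathbb U_{t,d}F=\delta F/\delta\psi_{t,d}$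 and $\langle d|_tF=\bigl(\exp(\mathbb U_{t,d})F\bigr)(0)$. The Fock space expression at $(t,d)$ is $$\langle d|_t\;T\exp\Bigl(-\int_0^t\mathbb D_\tau d\tau\Bigr)f_\varphi.\tag{1}$$ **Theorem.** There is an entire vector field $X(z)\frac{d}{dz}$ on $\mathbb C$, $X(z)=\sum_{k\ge0}a_kz^k$ with all $a_k\ge0$, depending only on $W$ and $s$ (and on $n$, $m$), with the following property. Let $-\infty\le\underline t<0<\overline t\le\infty$ and let $u\in C^0((\underline t,\overline t),H^{s+1})\cap C^1((\underline t,\overline t),H^s)$ be a weak solution of $\square u+m^2u+W(u,\nabla u)=0$ such that the flow $e^{tX}(\|[u]_t\|_{s+1})$ exists for all $t\in[0,\overline t)$ and $$\sup_{0\le t<\overline t}e^{tX}\bigl(\|[u]_t\|_{s+1}\bigr)<\infty .$$ Then for every weak solution $\varphi\in C^0(\mathbb R,H^{-s})\cap C^1(\mathbb R,H^{-s-1})$ of $\square\varphi+m^2\varphi=0$ there are functionals $(\mathcal F_t)_{0\le t<\overline t}$ such that, for every $t\in[0,\overline t)$: 1. for every $d\in H^{s+1}\times H^s$ for which $e^{tX}(\|d\|_{s+1})$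 exists (in particular for $d=[u]_t$), $\mathcal F_t$ is defined in a neighbourhood of $d$ and continuous at $d$, and $\mathcal F_t(d)=\sum_{p\ge1}\mathcal F_{t,p}(d,\dots,d)$, an absolutely convergent series with continuous $p$-linear forms $\mathcal F_{t,p}$ on $H^{s+1}\times H^s$ that do not depend on $d$; 2. for the same $d$ the expression (1) makes sense and its value is $\mathcal F_t(d)$, which is also the value of $T\exp(-\int_0^t\mathbb D_\tau d\tau)f_\varphi$ at $\psi_{t,d}$: all $\mathbb D_{\tau_k}\cdots\mathbb D_{\tau_1}f_\varphi$ are defined and lie in $\bigcap_{r>0}\mathbb F_r$, the integrals converge, and for some $\rho>\|d\|_{s+1}$ the norms $N_\rho$ of the terms of the time ordered exponential have a finite sum; 3. $\displaystyle\mathcal F_t[u]_t=I_0^\varphi[u]_0:=\int_{\mathbb R^n}\bigl(u\,\partial_t\varphi-\partial_tu\,\varphi\bigr)\big|_{t=0}\,dx$ (duality product of $H^{\pm(s+1)}$ and of $H^{\pm s}$). -/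

import Mathlib

open scoped SchwartzMap ENNReal LineDeriv Laplacian FourierTransform ContDiff
open MeasureTheory

noncomputable section

namespace KleinGordon

/-! ### Sobolev spaces -/

/-- Physical space `ℝⁿ`. -/
abbrev Space (n : ℕ) : Type := EuclideanSpace ℝ (Fin n)

/-- The symbol `ε(ξ)^s`, `ε(ξ) = √(m² + |ξ|²)`. Mathlib's Fourier transform uses the phase
`exp (-2πi x·ξ)`, so that the frequency `ξ` of the usual convention is `2πξ` here; both transforms
are unitary on `L²` and give the same Sobolev norm. -/
def epsPow (n : ℕ) (m s : ℝ) (ξ : Space n) : ℂ :=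
  (((m ^ 2 + (2 * Real.pi * ‖ξ‖) ^ 2) ^ (s / 2) : ℝ) : ℂ)

variable {n : ℕ} {m : ℝ}

theorem epsPow_temperate [hm : Fact (0 < m)] (s : ℝ) :
    (epsPow n m s).HasTemperateGrowth := by
  have hm0 : 0 < m := hm.out
  have h1 : (fun ξ : Space n => (2 * Real.pi / m) • ξ).HasTemperateGrowth :=
    ((2 * Real.pi / m) • ContinuousLinearMap.id ℝ (Space n)).hasTemperateGrowth
  have h2 := (Function.hasTemperateGrowth_one_add_norm_sq_rpow (Space n) (s / 2)).comp h1
  have h3 : (fun ξ : Space n => (m ^ 2) ^ (s / 2) *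
      (1 + ‖(2 * Real.pi / m) • ξ‖ ^ 2) ^ (s / 2)).HasTemperateGrowth :=
    (Function.HasTemperateGrowth.const _).mul h2
  have h4 := Function.Complex.hasTemperateGrowth_ofReal.comp h3
  refine (congrArg Function.HasTemperateGrowth ?_).mpr h4
  funext ξ
  simp only [epsPow, Function.comp]
  rw [← Real.mul_rpow (by positivity) (by positivity), norm_smul, Real.norm_eq_abs,
    abs_of_pos (by positivity : 0 < 2 * Real.pi / m)]
  congr 2
  field_simp

theorem epsPow_mul [hm : Fact (0 < m)] (s r : ℝ) :
    epsPow n m s * epsPow n m r = epsPow n m (s + r) := by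
  have hm0 : 0 < m := hm.out
  funext ξ
  simp only [epsPow, Pi.mul_apply]
  rw [← Complex.ofReal_mul, ← Real.rpow_add (by positivity), add_div]

theorem epsPow_zero : epsPow n m 0 = fun _ => 1 := by
  funext ξ
  simp [epsPow]

/-- A tempered distribution is real if it takes real values on real test functions. -/
def IsRealDistribution (T : 𝓢'(Space n, ℂ)) : Prop :=
  ∀ ψ : 𝓢(Space n, ℂ), (∀ x, (ψ x).im = 0) → (T ψ).im = 0

/-- The tempered distribution `ε^s T̂`. -/
def weighted (m s : ℝ) (T : 𝓢'(Space n, ℂ)) : 𝓢'(Space n, ℂ) :=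
  TemperedDistribution.smulLeftCLM ℂ (epsPow n m s) (𝓕 T)

theorem weighted_add (s : ℝ) (S T : 𝓢'(Space n, ℂ)) :
    weighted m s (S + T) = weighted m s S + weighted m s T := by
  simp [weighted, FourierTransform.fourier_add]

theorem weighted_smul (s : ℝ) (c : ℝ) (T : 𝓢'(Space n, ℂ)) :
    weighted m s (c • T) = c • weighted m s T := by
  have h : c • T = (c : ℂ) • T := by ext ψ; simp
  have h' : c • weighted m s T = (c : ℂ) • weighted m s T := by ext ψ; simp
  rw [h, h']
  simp [weighted, FourierTransform.fourier_smul]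

/-- `H^s(ℝⁿ)` as a real subspace of the tempered distributions: the real `T` with
`ε^s T̂ ∈ L²`. -/
def sobolevSubmodule (n : ℕ) (m s : ℝ) : Submodule ℝ 𝓢'(Space n, ℂ) where
  carrier := {T | IsRealDistribution T ∧
    ∃ g : Lp ℂ 2 (volume : Measure (Space n)), weighted m s T = (g : 𝓢'(Space n, ℂ))}
  add_mem' := by
    rintro S T ⟨hS, g, hg⟩ ⟨hT, g', hg'⟩
    refine ⟨fun ψ hψ => by simp [hS ψ hψ, hT ψ hψ], g + g', ?_⟩
    rw [weighted_add, hg, hg', ← Lp.toTemperedDistributionCLM_apply,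
      ← Lp.toTemperedDistributionCLM_apply, ← Lp.toTemperedDistributionCLM_apply, map_add]
  zero_mem' := by
    refine ⟨fun ψ _ => by simp, 0, ?_⟩
    have h : weighted m s (0 : 𝓢'(Space n, ℂ)) = 0 := by
      have h := weighted_add (n := n) (m := m) s 0 0
      rw [add_zero] at h
      exact left_eq_add.mp h
    rw [h, ← Lp.toTemperedDistributionCLM_apply, map_zero]
  smul_mem' := by
    rintro c T ⟨hT, g, hg⟩
    refine ⟨fun ψ hψ => by simp [hT ψ hψ], (c : ℂ) • g, ?_⟩
    rw [weighted_smul, hg, ← Lp.toTemperedDistributionCLM_apply,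
      ← Lp.toTemperedDistributionCLM_apply, map_smul]
    ext ψ
    simp

/-- The space `H^s(ℝⁿ)` of real distributions. -/
def Sobolev (n : ℕ) (m s : ℝ) : Type := sobolevSubmodule n m s

instance (s : ℝ) : AddCommGroup (Sobolev n m s) :=
  inferInstanceAs (AddCommGroup (sobolevSubmodule n m s))

instance (s : ℝ) : Module ℝ (Sobolev n m s) :=
  inferInstanceAs (Module ℝ (sobolevSubmodule n m s))

/-- The tempered distribution underlying an element of `H^s`. -/
def Sobolev.dist {s : ℝ} : Sobolev n m s →ₗ[ℝ] 𝓢'(Space n, ℂ) :=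
  (sobolevSubmodule n m s).subtype

theorem Sobolev.dist_injective {s : ℝ} :
    Function.Injective (Sobolev.dist (n := n) (m := m) (s := s)) :=
  Subtype.val_injective

theorem toDist_injective : Function.Injective
    (Lp.toTemperedDistribution : Lp ℂ 2 (volume : Measure (Space n)) → 𝓢'(Space n, ℂ)) := by
  have h := LinearMap.ker_eq_bot.1 (Lp.ker_toTemperedDistributionCLM_eq_bot
    (F := ℂ) (μ := (volume : Measure (Space n))) (p := 2))
  exact h

/-- The `L²` function `ε^s T̂`, for `T ∈ H^s`. -/
def Sobolev.toL2Fun {s : ℝ} (T : Sobolev n m s) : Lp ℂ 2 (volume : Measure (Space n)) :=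
  T.2.2.choose

theorem Sobolev.toL2Fun_spec {s : ℝ} (T : Sobolev n m s) :
    weighted m s T.dist = (T.toL2Fun : 𝓢'(Space n, ℂ)) :=
  T.2.2.choose_spec

/-- `T ↦ ε^s T̂` as a linear map from `H^s` to `L²`. -/
def Sobolev.toL2 {s : ℝ} : Sobolev n m s →ₗ[ℝ] Lp ℂ 2 (volume : Measure (Space n)) where
  toFun := Sobolev.toL2Fun
  map_add' S T := by
    apply toDist_injective
    rw [← Sobolev.toL2Fun_spec, map_add, weighted_add, Sobolev.toL2Fun_spec,
      Sobolev.toL2Fun_spec, ← Lp.toTemperedDistributionCLM_apply,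
      ← Lp.toTemperedDistributionCLM_apply, ← Lp.toTemperedDistributionCLM_apply, map_add]
  map_smul' c T := by
    apply toDist_injective
    rw [← Sobolev.toL2Fun_spec, map_smul, weighted_smul, Sobolev.toL2Fun_spec,
      ← Lp.toTemperedDistributionCLM_apply, ← Lp.toTemperedDistributionCLM_apply,
      RingHom.id_apply]
    exact (ContinuousLinearMap.map_smul_of_tower
      (Lp.toTemperedDistributionCLM ℂ (volume : Measure (Space n)) 2) c _).symm

theorem Sobolev.toL2_spec {s : ℝ} (T : Sobolev n m s) :
    weighted m s T.dist = (T.toL2 : 𝓢'(Space n, ℂ)) :=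
  T.toL2Fun_spec

theorem weighted_weighted [Fact (0 < m)] (s r : ℝ) (T : 𝓢'(Space n, ℂ)) :
    TemperedDistribution.smulLeftCLM ℂ (epsPow n m r) (weighted m s T) =
      weighted m (s + r) T := by
  rw [weighted, TemperedDistribution.smulLeftCLM_smulLeftCLM_apply (epsPow_temperate s)
    (epsPow_temperate r), epsPow_mul, weighted]

theorem weighted_zero (T : 𝓢'(Space n, ℂ)) : weighted m 0 T = 𝓕 T := by
  rw [weighted, epsPow_zero, TemperedDistribution.smulLeftCLM_const, one_smul]

theorem Sobolev.toL2_injective [Fact (0 < m)] {s : ℝ} :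
    Function.Injective (Sobolev.toL2 (n := n) (m := m) (s := s)) := by
  rw [injective_iff_map_eq_zero]
  intro T hT
  apply Sobolev.dist_injective
  have h := T.toL2_spec
  rw [hT, ← Lp.toTemperedDistributionCLM_apply, map_zero] at h
  have h2 : 𝓕 T.dist = 0 := by
    rw [← weighted_zero (m := m), ← add_neg_cancel s, ← weighted_weighted, h, map_zero]
  have h3 : 𝓕⁻ (𝓕 T.dist) = T.dist := FourierTransform.fourierInv_fourier_eq T.dist
  rw [map_zero, ← h3, h2]
  exact map_zero (FourierTransform.fourierInvCLM ℂ 𝓢'(Space n, ℂ))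

/-- The norm `‖T‖_{H^s} = ‖ε^s T̂‖_{L²}`. -/
instance (s : ℝ) [Fact (0 < m)] : NormedAddCommGroup (Sobolev n m s) :=
  NormedAddCommGroup.induced _ _ Sobolev.toL2 Sobolev.toL2_injective

instance (s : ℝ) [Fact (0 < m)] : NormedSpace ℝ (Sobolev n m s) :=
  NormedSpace.induced ℝ _ _ Sobolev.toL2

theorem Sobolev.norm_def [Fact (0 < m)] {s : ℝ} (T : Sobolev n m s) : ‖T‖ = ‖T.toL2‖ := rfl

theorem Sobolev.continuous_toL2 [Fact (0 < m)] {s : ℝ} :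
    Continuous (Sobolev.toL2 (n := n) (m := m) (s := s)) :=
  continuous_induced_dom

theorem Sobolev.continuous_dist [Fact (0 < m)] {s : ℝ} :
    Continuous (Sobolev.dist (n := n) (m := m) (s := s)) := by
  have h : ∀ T : Sobolev n m s, T.dist = FourierTransform.fourierInvCLM ℂ 𝓢'(Space n, ℂ)
      (TemperedDistribution.smulLeftCLM ℂ (epsPow n m (-s))
        (Lp.toTemperedDistributionCLM ℂ (volume : Measure (Space n)) 2 T.toL2)) := by
    intro T
    rw [Lp.toTemperedDistributionCLM_apply, ← T.toL2_spec, weighted_weighted, add_neg_cancel,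
      weighted_zero]
    have h3 : 𝓕⁻ (𝓕 T.dist) = T.dist := FourierTransform.fourierInv_fourier_eq T.dist
    exact h3.symm
  have h2 : (fun T : Sobolev n m s => T.dist) = _ := funext h
  change Continuous (fun T : Sobolev n m s => T.dist)
  rw [h2]
  exact (ContinuousLinearMap.continuous _).comp ((ContinuousLinearMap.continuous _).comp
    ((ContinuousLinearMap.continuous _).comp Sobolev.continuous_toL2))

theorem Sobolev.continuous_apply [Fact (0 < m)] {s : ℝ} (ψ : 𝓢(Space n, ℂ)) :
    Continuous (fun T : Sobolev n m s => T.dist ψ) :=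
  (PointwiseConvergenceCLM.evalCLM (RingHom.id ℂ) ℂ ψ).continuous.comp Sobolev.continuous_dist

/-- `H^σ ⊆ H^τ` for `τ ≤ σ`. -/
theorem sobolevSubmodule_mono [Fact (0 < m)] {σ τ : ℝ} (h : τ ≤ σ) :
    sobolevSubmodule n m σ ≤ sobolevSubmodule n m τ := by
  have hm0 : 0 < m := Fact.out
  rintro T ⟨hT, g, hg⟩
  refine ⟨hT, ?_⟩
  have hb : ∀ ξ : Space n, ‖epsPow n m (τ - σ) ξ‖ ≤ (m ^ 2) ^ ((τ - σ) / 2) := by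
    intro ξ
    rw [epsPow, Complex.norm_real, Real.norm_eq_abs, abs_of_nonneg (by positivity)]
    apply Real.rpow_le_rpow_of_nonpos (by positivity)
    · nlinarith [sq_nonneg (2 * Real.pi * ‖ξ‖)]
    · linarith
  have ht : (epsPow n m (τ - σ)).HasTemperateGrowth := epsPow_temperate _
  have hlp : MemLp (epsPow n m (τ - σ)) ⊤ (volume : Measure (Space n)) :=
    memLp_top_of_bound ht.1.continuous.aestronglyMeasurable _ (Filter.Eventually.of_forall hb)
  refine ⟨(hlp.toLp _) • g, ?_⟩
  rw [Lp.toTemperedDistribution_smul_eq ht hlp, ← hg, weighted_weighted]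
  congr 1
  ring

/-- The inclusion `H^σ → H^τ`, for `τ ≤ σ`. -/
def Sobolev.incl [Fact (0 < m)] {σ τ : ℝ} (h : τ ≤ σ) : Sobolev n m σ →ₗ[ℝ] Sobolev n m τ :=
  Submodule.inclusion (sobolevSubmodule_mono h)

/-- The duality product `∫ a b` of `a ∈ H^s` and `b ∈ H^{-s}`, i.e. the `L²` product of
`ε^s â` and `ε^{-s} b̂`. -/
def Sobolev.pairing {s : ℝ} (a : Sobolev n m s) (b : Sobolev n m (-s)) : ℝ :=
  (inner ℂ a.toL2 b.toL2).re

/-! ### The Klein--Gordon equation -/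

/-- `u` solves `□u + m²u + F = 0` weakly on the open set `I` of times, as a distribution of time
with values in the tempered distributions on `ℝⁿ`: the equation is tested against the products
`χ(t) ψ(x)` with `χ` smooth and compactly supported in `I` and `ψ` in the Schwartz space. -/
def IsWeakSolution (m : ℝ) (I : Set ℝ) (u : ℝ → 𝓢'(Space n, ℂ))
    (F : ℝ → 𝓢(Space n, ℂ) → ℂ) : Prop :=
  ∀ χ : ℝ → ℝ, ContDiff ℝ ∞ χ → HasCompactSupport χ → tsupport χ ⊆ I →
    ∀ ψ : 𝓢(Space n, ℂ),
      ∫ t, (((deriv (deriv χ) t : ℝ) : ℂ) * u t ψ +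
        (χ t : ℂ) * (-(Δ (u t)) ψ + (m : ℂ) ^ 2 * u t ψ + F t ψ)) = 0

/-- `a ∈ C⁰(I, H^σ) ∩ C¹(I, H^τ)`, with time derivative `b`. -/
structure IsCurve [Fact (0 < m)] {σ τ : ℝ} (h : τ ≤ σ) (I : Set ℝ)
    (a : ℝ → Sobolev n m σ) (b : ℝ → Sobolev n m τ) : Prop where
  continuousOn : ContinuousOn a I
  continuousOn_deriv : ContinuousOn b I
  hasDerivAt : ∀ t ∈ I, HasDerivAt (fun r => Sobolev.incl h (a r)) (b t) t

theorem le_add_one' (s : ℝ) : s ≤ s + 1 := by linarith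

/-- A curve is a free solution if it solves `□φ + m²φ = 0` on the whole time axis. -/
def IsFree [Fact (0 < m)] {σ τ : ℝ} (h : τ ≤ σ)
    (a : ℝ → Sobolev n m σ) (b : ℝ → Sobolev n m τ) : Prop :=
  IsCurve h Set.univ a b ∧ IsWeakSolution m Set.univ (fun t => (a t).dist) (fun _ _ => 0)

theorem integrable_weak [Fact (0 < m)] {σ : ℝ} {a : ℝ → Sobolev n m σ} (ha : Continuous a)
    {χ : ℝ → ℝ} (hχ : ContDiff ℝ ∞ χ) (hc : HasCompactSupport χ) (ψ : 𝓢(Space n, ℂ)) :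
    Integrable (fun t => ((deriv (deriv χ) t : ℝ) : ℂ) * (a t).dist ψ +
        (χ t : ℂ) * (-(Δ ((a t).dist)) ψ + (m : ℂ) ^ 2 * (a t).dist ψ + 0)) := by
  have h1 : Continuous (fun t => (a t).dist ψ) := (Sobolev.continuous_apply ψ).comp ha
  have h2 : Continuous (fun t => (a t).dist (Δ ψ)) := (Sobolev.continuous_apply (Δ ψ)).comp ha
  have hd : Continuous (deriv (deriv χ)) := by
    have := (contDiff_infty.1 hχ 2).continuous_iteratedDeriv 2 le_rfl
    simpa [iteratedDeriv_succ, iteratedDeriv_zero] using this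
  simp only [TemperedDistribution.laplacian_apply_apply]
  refine Integrable.add ?_ ?_
  · refine Continuous.integrable_of_hasCompactSupport (by fun_prop) ?_
    exact (hc.deriv.deriv.comp_left (g := Complex.ofReal) rfl).mul_right
  · have := hχ.continuous
    refine Continuous.integrable_of_hasCompactSupport (by fun_prop) ?_
    exact (hc.comp_left (g := Complex.ofReal) rfl).mul_right

theorem IsFree.add [Fact (0 < m)] {σ τ : ℝ} {h : τ ≤ σ} {a a' : ℝ → Sobolev n m σ}
    {b b' : ℝ → Sobolev n m τ} (H : IsFree h a b) (H' : IsFree h a' b') :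
    IsFree h (a + a') (b + b') := by
  refine ⟨⟨H.1.1.add H'.1.1, H.1.2.add H'.1.2, fun t ht => ?_⟩, fun χ hχ hc hI ψ => ?_⟩
  · refine ((H.1.3 t ht).add (H'.1.3 t ht)).congr_of_eventuallyEq
      (Filter.Eventually.of_forall fun r => ?_)
    simp
  · have e1 := H.2 χ hχ hc hI ψ
    have e2 := H'.2 χ hχ hc hI ψ
    have i1 := integrable_weak (continuousOn_univ.1 H.1.1) hχ hc ψ
    have i2 := integrable_weak (continuousOn_univ.1 H'.1.1) hχ hc ψ
    have e3 := congrArg₂ (· + ·) e1 e2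
    beta_reduce at e3
    rw [← integral_add i1 i2, add_zero] at e3
    refine Eq.trans ?_ e3
    congr 1
    funext t
    simp [TemperedDistribution.laplacian_apply_apply]
    ring

theorem IsFree.smul [Fact (0 < m)] {σ τ : ℝ} {h : τ ≤ σ} {a : ℝ → Sobolev n m σ}
    {b : ℝ → Sobolev n m τ} (c : ℝ) (H : IsFree h a b) : IsFree h (c • a) (c • b) := by
  refine ⟨⟨H.1.1.const_smul c, H.1.2.const_smul c, fun t ht => ?_⟩, fun χ hχ hc hI ψ => ?_⟩
  · refine ((H.1.3 t ht).const_smul c).congr_of_eventuallyEq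
      (Filter.Eventually.of_forall fun r => ?_)
    simp
  · have e1 := H.2 χ hχ hc hI ψ
    have e3 := congrArg (fun z => (c : ℂ) * z) e1
    beta_reduce at e3
    rw [← integral_const_mul, mul_zero] at e3
    refine Eq.trans ?_ e3
    congr 1
    funext t
    simp [TemperedDistribution.laplacian_apply_apply]
    ring

theorem IsFree.zero [Fact (0 < m)] {σ τ : ℝ} {h : τ ≤ σ} :
    IsFree (n := n) (m := m) h 0 0 := by
  refine ⟨⟨continuousOn_const, continuousOn_const, fun t _ => ?_⟩, fun χ hχ hc hI ψ => ?_⟩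
  · simpa using hasDerivAt_const t (0 : Sobolev n m τ)
  · simp [TemperedDistribution.laplacian_apply_apply]

/-- The solution space `𝓔₀^{s+1}` of the linear Klein--Gordon equation: the pairs `(φ, ∂ₜφ)` for
`φ ∈ C⁰(ℝ, H^{s+1}) ∩ C¹(ℝ, H^s)` with `□φ + m²φ = 0`. -/
def freeSubmodule (n : ℕ) (m s : ℝ) [Fact (0 < m)] :
    Submodule ℝ ((ℝ → Sobolev n m (s + 1)) × (ℝ → Sobolev n m s)) where
  carrier := {p | IsFree (le_add_one' s) p.1 p.2}
  add_mem' H H' := IsFree.add H H'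
  zero_mem' := IsFree.zero
  smul_mem' c _ H := IsFree.smul c H

/-- The space `𝓔₀^{s+1}` as a type of its own. -/
def FreeSol (n : ℕ) (m s : ℝ) [Fact (0 < m)] : Type := freeSubmodule n m s

variable [Fact (0 < m)] {s : ℝ}

instance : AddCommGroup (FreeSol n m s) :=
  inferInstanceAs (AddCommGroup (freeSubmodule n m s))

instance : Module ℝ (FreeSol n m s) :=
  inferInstanceAs (Module ℝ (freeSubmodule n m s))

/-- The space `H^{s+1} × H^s` of Cauchy data. -/
abbrev Data (n : ℕ) (m s : ℝ) [Fact (0 < m)] : Type := Sobolev n m (s + 1) × Sobolev n m s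

/-- The Cauchy data `[φ]_t = (φ(t), ∂ₜφ(t))` of a free solution. -/
def cauchy (t : ℝ) : FreeSol n m s →ₗ[ℝ] Data n m s where
  toFun φ := (φ.1.1 t, φ.1.2 t)
  map_add' _ _ := rfl
  map_smul' _ _ := rfl

/-- `(‖φ(0)‖²_{H^{s+1}} + ‖∂ₜφ(0)‖²_{H^s})^{1/2}`; the value is the same at all times, and it is a
norm since a free solution is determined by its Cauchy data. -/
instance : SeminormedAddCommGroup (FreeSol n m s) :=
  SeminormedAddCommGroup.induced (FreeSol n m s)
    (WithLp 2 (Sobolev n m (s + 1) × Sobolev n m s))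
    ((WithLp.linearEquiv 2 ℝ (Data n m s)).symm.toLinearMap ∘ₗ cauchy 0)

instance : NormedSpace ℝ (FreeSol n m s) :=
  NormedSpace.induced ℝ (FreeSol n m s)
    (WithLp 2 (Sobolev n m (s + 1) × Sobolev n m s))
    ((WithLp.linearEquiv 2 ℝ (Data n m s)).symm.toLinearMap ∘ₗ cauchy 0)

theorem FreeSol.norm_sq (φ : FreeSol n m s) :
    ‖φ‖ ^ 2 = ‖(cauchy 0 φ).1‖ ^ 2 + ‖(cauchy 0 φ).2‖ ^ 2 := by
  change ‖WithLp.toLp 2 (cauchy 0 φ)‖ ^ 2 = _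
  rw [WithLp.prod_norm_sq_eq_of_L2]
  rfl

/-- The free solution with prescribed Cauchy data at time `t`. -/
def solveAt (t : ℝ) (d : Data n m s) : FreeSol n m s :=
  open Classical in if h : ∃ φ : FreeSol n m s, cauchy t φ = d then h.choose else 0

/-- `v ♯_t G : x ↦ ∫ v(y) G(t - x⁰, y - x) dy`, for `v ∈ H^s`. As `G` vanishes and `∂ₜG = δ₀` at
time `0`, this is the free solution with Cauchy data `(0, -v)` at time `t`. -/
def sharp (t : ℝ) (v : Sobolev n m s) : FreeSol n m s :=
  solveAt t (0, -v)

/-! ### The nonlinearity -/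

/-- The tempered distribution `T` is given by integration against the continuous function `f`. -/
def IsContinuousRep (T : 𝓢'(Space n, ℂ)) (f : Space n → ℝ) : Prop :=
  Continuous f ∧ ∀ ψ : 𝓢(Space n, ℂ),
    Integrable (fun x => ψ x * (f x : ℂ)) ∧ T ψ = ∫ x, ψ x * (f x : ℂ)

/-- The continuous function which represents `T` (zero if there is none). -/
def pointValue (T : 𝓢'(Space n, ℂ)) : Space n → ℝ :=
  open Classical in if h : ∃ f, IsContinuousRep T f then h.choose else 0

/-- The function `x ↦ W(φ₀(x), (φ₁(x), ∂₁φ₀(x), …, ∂ₙφ₀(x)))` for Cauchy data `(φ₀, φ₁)`; for the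
Cauchy data of `u` at time `t` this is `W(u, ∇u)` at time `t`, where `∇u = (∂ₜu, ∂₁u, …, ∂ₙu)`. -/
def localFun (W : ℝ × (Fin (n + 1) → ℝ) → ℝ) (d : Data n m s) (x : Space n) : ℝ :=
  W (pointValue d.1.dist x, Fin.cons (pointValue d.2.dist x)
    (fun j : Fin n => pointValue (∂_{EuclideanSpace.single j (1 : ℝ)} d.1.dist) x))

/-- `v ∈ H^s` is the function `W(φ₀, φ₁, ∂₁φ₀, …, ∂ₙφ₀)`. -/
def IsNonlin (W : ℝ × (Fin (n + 1) → ℝ) → ℝ) (d : Data n m s) (v : Sobolev n m s) : Prop :=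
  IsContinuousRep v.dist (localFun W d)

/-- The nonlinearity `𝓥 : H^{s+1} × H^s → H^s`, `𝓥(φ₀, φ₁) = W(φ₀, φ₁, ∂₁φ₀, …, ∂ₙφ₀)`. -/
def nonlin (W : ℝ × (Fin (n + 1) → ℝ) → ℝ) (d : Data n m s) : Sobolev n m s :=
  open Classical in if h : ∃ v : Sobolev n m s, IsNonlin W d v then h.choose else 0

/-- `u ∈ C⁰(I, H^{s+1}) ∩ C¹(I, H^s)`, with time derivative `u'`, is a weak solution of
`□u + m²u + W(u, ∇u) = 0` on `I × ℝⁿ`. -/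
def IsNonlinearSolution (W : ℝ × (Fin (n + 1) → ℝ) → ℝ) (I : Set ℝ)
    (u : ℝ → Sobolev n m (s + 1)) (u' : ℝ → Sobolev n m s) : Prop :=
  IsCurve (le_add_one' s) I u u' ∧
    IsWeakSolution m I (fun t => (u t).dist)
      (fun t ψ => ∫ x, ψ x * (localFun W (u t, u' t) x : ℂ))

/-- The norm `‖[u]_t‖_{s+1}` of Cauchy data. -/
def dataNorm (d : Data n m s) : ℝ := ‖d.1‖ + ‖d.2‖

/-! ### The Fock space

Its elements are functionals on `𝓔₀^{s+1}`. -/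

/-- `F` is, on the ball of radius `r` about `0`, the sum of the series of the homogeneous
polynomials `φ ↦ f_p(φ, …, φ)` with `f_p` symmetric, `p`-linear and continuous. -/
def HasFockExpansion (F : FreeSol n m s → ℝ) (f : FormalMultilinearSeries ℝ (FreeSol n m s) ℝ)
    (r : ℝ) : Prop :=
  (∀ p (σ : Equiv.Perm (Fin p)) (φ : Fin p → FreeSol n m s), f p (φ ∘ σ) = f p φ) ∧
    ∀ φ : FreeSol n m s, ‖φ‖ < r → HasSum (fun p => f p (fun _ => φ)) (F φ)

/-- `N_r(F) = ∑_p ‖f_p‖ r^p`, for the (unique) expansion `F = ∑_p f_p` of `F` on the ball of radius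
`r > 0`; it is `∞` if there is no expansion. -/
def fockNorm (r : ℝ) (F : FreeSol n m s → ℝ) : ℝ≥0∞ :=
  ⨅ (f : FormalMultilinearSeries ℝ (FreeSol n m s) ℝ) (_ : HasFockExpansion F f r),
    ∑' p, ‖f p‖ₑ * ENNReal.ofReal r ^ p

/-- The Fock space `𝔽_r`. -/
def fock (n : ℕ) (m s : ℝ) [Fact (0 < m)] (r : ℝ) : Set (FreeSol n m s → ℝ) :=
  {F | fockNorm r F < ⊤}

/-- The vacuum `|0⟩`. -/
def vacuum : FreeSol n m s → ℝ := fun _ => 1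

/-- The functional `⟨0|`. -/
def vacuumBra (F : FreeSol n m s → ℝ) : ℝ := F 0

/-- The integral `I_t^φ[ψ] = ∫ (ψ ∂ₜφ - ∂ₜψ φ) dx`, in terms of the Cauchy data `(ψ, ∂ₜψ)` at time
`t` and of the values `φ`, `∂ₜφ` at time `t`. -/
def flux (d : Data n m s) (φ : Sobolev n m (-s)) (φ' : Sobolev n m (-(s + 1))) : ℝ :=
  d.1.pairing φ' - d.2.pairing φ

/-- The creation operator `∫_{x⁰=0} φ^▷ ∂↔ φ`: multiplication by the linear functional
`ψ ↦ ∫_{x⁰=0} (ψ ∂ₜφ - ∂ₜψ φ)`. -/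
def creation (φ : Sobolev n m (-s)) (φ' : Sobolev n m (-(s + 1))) (F : FreeSol n m s → ℝ) :
    FreeSol n m s → ℝ :=
  fun ψ => flux (cauchy 0 ψ) φ φ' * F ψ

/-- The functional derivative `δF/δψ`, at each point in a direction that may depend on it. -/
def annihilation (ψ : FreeSol n m s → FreeSol n m s) (F : FreeSol n m s → ℝ) :
    FreeSol n m s → ℝ :=
  fun φ => lineDeriv ℝ F φ (ψ φ)

/-- The operator `𝔻_τ = ∫_{z⁰=τ} W(φ^▷, ∇φ^▷) φ^◁ dz`, that is
`(𝔻_τ F)(φ) = (δF / δ(𝓥([φ]_τ) ♯_τ G))(φ)`. -/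
def opD (W : ℝ × (Fin (n + 1) → ℝ) → ℝ) (τ : ℝ) (F : FreeSol n m s → ℝ) : FreeSol n m s → ℝ :=
  annihilation (fun φ => sharp τ (nonlin W (cauchy τ φ))) F

/-- The product `𝔻_{τ_k} ⋯ 𝔻_{τ_1} F`. -/
def prodD (W : ℝ × (Fin (n + 1) → ℝ) → ℝ) :
    (k : ℕ) → (Fin k → ℝ) → (FreeSol n m s → ℝ) → FreeSol n m s → ℝ
  | 0, _, F => F
  | k + 1, τ, F => opD W (τ (Fin.last k)) (prodD W k (fun i => τ i.castSucc) F)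

/-- The simplex `0 < τ_1 < ⋯ < τ_k < t`. -/
def orderedTimes (k : ℕ) (t : ℝ) : Set (Fin k → ℝ) :=
  {τ | StrictMono τ ∧ ∀ i, 0 < τ i ∧ τ i < t}

/-- The `k`-th term `(-1)^k ∫_{0<τ_1<⋯<τ_k<t} 𝔻_{τ_k} ⋯ 𝔻_{τ_1} F dτ` of the time ordered
exponential. -/
def texpTerm (W : ℝ × (Fin (n + 1) → ℝ) → ℝ) (t : ℝ) (F : FreeSol n m s → ℝ) (k : ℕ) :
    FreeSol n m s → ℝ :=
  fun φ => (-1) ^ k * ∫ τ in orderedTimes k t, prodD W k τ F φ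

/-- The time ordered exponential `T exp (-∫₀ᵗ 𝔻_τ dτ) F`. -/
def texp (W : ℝ × (Fin (n + 1) → ℝ) → ℝ) (t : ℝ) (F : FreeSol n m s → ℝ) :
    FreeSol n m s → ℝ :=
  fun φ => ∑' k, texpTerm W t F k φ

/-- The series for `T exp (-∫₀ᵗ 𝔻_τ dτ) F` converges normally in `𝔽_ρ`: all the products
`𝔻_{τ_k} ⋯ 𝔻_{τ_1} F` are defined and belong to every Fock space, their integrals over the simplex
converge, and the norms `N_ρ` of these integrals have a finite sum. -/
structure TexpConverges (W : ℝ × (Fin (n + 1) → ℝ) → ℝ) (t ρ : ℝ) (F : FreeSol n m s → ℝ) :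
    Prop where
  nonlin_mem : ∀ d : Data n m s, IsNonlin W d (nonlin W d)
  sharp_exists : ∀ (τ : ℝ) (v : Sobolev n m s), cauchy τ (sharp τ v) = (0, -v)
  prod_mem : ∀ k, ∀ τ ∈ orderedTimes k t, ∀ r > 0, prodD W k τ F ∈ fock n m s r
  integrable : ∀ k φ, IntegrableOn (fun τ => prodD W k τ F φ) (orderedTimes k t)
  term_summable : ∑' k, fockNorm ρ (texpTerm W t F k) < ⊤

/-- The operator `𝕌(t) = ∫_{y⁰=t} u ∂↔ φ^◁`: the derivative in the direction of the free solution
with the same Cauchy data `d` at time `t` as `u`. -/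
def opU (t : ℝ) (d : Data n m s) (F : FreeSol n m s → ℝ) : FreeSol n m s → ℝ :=
  annihilation (fun _ => solveAt t d) F

/-- `⟨[u]_t|F⟩ = ⟨0| exp(𝕌(t)) F⟩` converges to the value `y`. -/
def HasBraValue (t : ℝ) (d : Data n m s) (F : FreeSol n m s → ℝ) (y : ℝ) : Prop :=
  HasSum (fun k : ℕ => ((k.factorial : ℝ)⁻¹) * vacuumBra ((opU t d)^[k] F)) y

/-- The Fock space expression `⟨[u]_t| T exp (-∫_{0<z⁰<t} W(φ^▷, ∇φ^▷) φ^◁ dz) |f_φ⟩`, where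
`|f_φ⟩ = ∫_{x⁰=0} φ^▷ ∂↔ φ |0⟩`, makes sense at the Cauchy data `d = [u]_t` and has the value `y`;
`φ`, `φ'` stand for `φ(0)`, `∂ₜφ(0)`. The time ordered exponential converges in some `𝔽_ρ` on which
`⟨[u]_t|` is defined. -/
def HasFockValue (W : ℝ × (Fin (n + 1) → ℝ) → ℝ) (φ : Sobolev n m (-s))
    (φ' : Sobolev n m (-(s + 1))) (t : ℝ) (d : Data n m s) (y : ℝ) : Prop :=
  (∃ ρ > dataNorm d, TexpConverges W t ρ (creation φ φ' vacuum)) ∧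
    cauchy t (solveAt t d) = d ∧
    texp W t (creation φ φ' vacuum) (solveAt t d) = y ∧
    HasBraValue t d (texp W t (creation φ φ' vacuum)) y

/-! ### Vector fields on the complex plane -/

/-- `e^{tX}(z)` exists and is equal to `w`, for `t ≥ 0`. -/
def FlowsTo (X : ℂ → ℂ) (t : ℝ) (z w : ℂ) : Prop :=
  ∃ γ : ℝ → ℂ, γ 0 = z ∧ γ t = w ∧
    ∀ τ ∈ Set.Icc 0 t, HasDerivWithinAt γ (X (γ τ)) (Set.Icc 0 t) τ

end KleinGordon

end

open KleinGordon

/-! The proof works in the interaction picture. Carrying the Cauchy data of u back to time 0 by the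
free evolution gives the curve Ψ(t) = evo(-t)[u]_t. A weak solution of the nonlinear equation
becomes an integral curve Ψ' = g_t(Ψ) of the time dependent vector field g_t(d) = evo(-t)(0,
-𝓥(evo(t) d)) on H^{s+1} × H^s (`IsCurve.hasDerivAt_evo`). For s > n/2 the space H^s is an algebra,
so 𝓥 is an entire map, and so is g_t (`Sobolev.exists_mul`, `hasSum_nonlin`). In these coordinates
𝔻_τ is the Lie derivative along g_τ (`prodD_eq`).

Let S_k(t) be the integral of 𝔻_{τ_k} ⋯ 𝔻_{τ_1} f over the simplex. The latest time is the outermost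
one, so ∂_t S_{k+1}(t) = 𝔻_t S_k(t), while the chain rule along Ψ contributes 𝔻_t S_k(t) to the
derivative of S_k(t)(Ψ(t)). In the alternating sum over k ≤ K everything cancels except (-1)^K 𝔻_t
S_K(t)(Ψ(t)) (`IsAdmissible.hasDerivAt_texpPartial`). Once this remainder is known to tend to 0, the
full sum is constant along Ψ, and its value at time 0 is f(Ψ(0)), the flux of u through the initial
surface (`IsAdmissible.conservation`).

Convergence is obtained by majorants. The Taylor coefficients of g_t are bounded, uniformly in t, by
those of one entire series A with nonnegative coefficients. On majorants the Lie derivative acts as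
A d/dz (`HasMajorant.lieSeries`), f is majorized by a multiple of z, and the simplex contributes
t^k/k!. Hence the time ordered exponential is majorized by the sum of t^k/k! (A d/dz)^k z, the
Taylor series of the flow of X = A d/dz. As everything is nonnegative, its partial sums stay below
the flow as long as the latter exists. Comparison with a supersolution which starts ε higher gives
such a bound at z + ε as well (`sum_lieIterate_le`). The margin ε pays for the additional derivative
in the remainder (`NonnegCoeff.deriv_mul_le`), and gives continuity near d and convergence of Fock
norms on a ball of radius larger than that of d.

All this needs W(0) = 0. Otherwise there is no solution at all, because a nonzero constant has a
point mass as Fourier transform and cannot be balanced by the other terms of the equation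
(`constant_eq_zero`). -/

noncomputable section

namespace KleinGordon

/-! ### Entire power series with real coefficients -/

/-- The power series `c` converges absolutely everywhere. -/
def IsEntire (c : PowerSeries ℝ) : Prop :=
  ∀ r : ℝ, 0 ≤ r → Summable fun k => |PowerSeries.coeff k c| * r ^ k

/-- The sum of the power series `c` at `z`. -/
def evalSeries (c : PowerSeries ℝ) (z : ℝ) : ℝ := ∑' k, PowerSeries.coeff k c * z ^ k

/-- All coefficients are nonnegative. -/
def NonnegCoeff (c : PowerSeries ℝ) : Prop := ∀ k, 0 ≤ PowerSeries.coeff k c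

theorem IsEntire.summable_norm {c : PowerSeries ℝ} (hc : IsEntire c) (z : ℝ) :
    Summable fun k => ‖PowerSeries.coeff k c * z ^ k‖ := by
  simpa [abs_mul, abs_pow] using hc |z| (abs_nonneg z)

theorem IsEntire.summable {c : PowerSeries ℝ} (hc : IsEntire c) (z : ℝ) :
    Summable fun k => PowerSeries.coeff k c * z ^ k :=
  (hc.summable_norm z).of_norm

theorem coeff_mul_mul_pow (c d : PowerSeries ℝ) (z : ℝ) (k : ℕ) :
    PowerSeries.coeff k (c * d) * z ^ k = ∑ p ∈ Finset.HasAntidiagonal.antidiagonal k,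
      (PowerSeries.coeff p.1 c * z ^ p.1) * (PowerSeries.coeff p.2 d * z ^ p.2) := by
  rw [PowerSeries.coeff_mul, Finset.sum_mul]
  refine Finset.sum_congr rfl fun p hp => ?_
  rw [← Finset.HasAntidiagonal.mem_antidiagonal.1 hp, pow_add]
  ring

theorem IsEntire.mul {c d : PowerSeries ℝ} (hc : IsEntire c) (hd : IsEntire d) :
    IsEntire (c * d) := by
  intro r hr
  have h := summable_norm_sum_mul_antidiagonal_of_summable_norm (hc.summable_norm r)
    (hd.summable_norm r)
  refine h.congr fun k => ?_
  rw [← coeff_mul_mul_pow, norm_mul, Real.norm_eq_abs, norm_pow, Real.norm_of_nonneg hr]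

theorem evalSeries_mul {c d : PowerSeries ℝ} (hc : IsEntire c) (hd : IsEntire d) (z : ℝ) :
    evalSeries (c * d) z = evalSeries c z * evalSeries d z := by
  unfold evalSeries
  rw [tsum_mul_tsum_eq_tsum_sum_antidiagonal_of_summable_norm (hc.summable_norm z)
    (hd.summable_norm z)]
  exact tsum_congr fun k => coeff_mul_mul_pow c d z k

/-- The left side is the term of the binomial expansion that is linear in ε. With ε = 1 it trades a
derivative for an increase of the radius by 1; with general ε it gives the difference quotient bound
of `NonnegCoeff.deriv_mul_le`. -/
theorem succ_mul_pow_mul_le (k : ℕ) {z ε : ℝ} (hz : 0 ≤ z) (hε : 0 ≤ ε) :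
    ((k : ℝ) + 1) * z ^ k * ε ≤ (z + ε) ^ (k + 1) := by
  induction k with
  | zero => simp [hz]
  | succ k ih =>
    have h1 : z * (((k : ℝ) + 1) * z ^ k * ε) ≤ z * (z + ε) ^ (k + 1) :=
      mul_le_mul_of_nonneg_left ih hz
    have h2 : z ^ (k + 1) ≤ (z + ε) ^ (k + 1) := pow_le_pow_left₀ hz (by linarith) _
    have h3 := mul_le_mul_of_nonneg_left h2 hε
    rw [pow_succ (z + ε) (k + 1)]
    push_cast
    rw [pow_succ] at h3 ⊢
    nlinarith

theorem IsEntire.deriv {c : PowerSeries ℝ} (hc : IsEntire c) :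
    IsEntire (PowerSeries.derivative ℝ c) := by
  intro r hr
  have h := (summable_nat_add_iff 1).2 (hc (r + 1) (by linarith))
  refine Summable.of_nonneg_of_le (fun k => by positivity) (fun k => ?_) h
  rw [PowerSeries.coeff_derivative, abs_mul, mul_assoc]
  refine mul_le_mul_of_nonneg_left ?_ (abs_nonneg _)
  have := succ_mul_pow_mul_le k hr zero_le_one
  rw [abs_of_nonneg (by positivity : (0 : ℝ) ≤ (k : ℝ) + 1)]
  linarith

theorem hasDerivAt_evalSeries {c : PowerSeries ℝ} (hc : IsEntire c) (z : ℝ) :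
    HasDerivAt (evalSeries c) (evalSeries (PowerSeries.derivative ℝ c) z) z := by
  have hR : 0 ≤ |z| + 1 := by positivity
  -- Termwise differentiation takes place on the ball of radius `|z| + 1`, where the derived terms
  -- are dominated by the terms of the series at radius `|z| + 2`.
  have hu := (hc (|z| + 1 + 1) (by positivity))
  have key := hasDerivAt_tsum_of_isPreconnected (t := Metric.ball (0 : ℝ) (|z| + 1))
    (g := fun k y => PowerSeries.coeff k c * y ^ k)
    (g' := fun k y => PowerSeries.coeff k c * (k * y ^ (k - 1))) (y₀ := z) (y := z) hu
    Metric.isOpen_ball (convex_ball _ _).isPreconnected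
    (fun k y _ => (hasDerivAt_pow k y).const_mul _) ?_ (by simp) (hc.summable z) (by simp)
  · refine key.congr_deriv ?_
    rw [Summable.tsum_eq_zero_add]
    · simp only [Nat.cast_zero, zero_mul, mul_zero, zero_add, evalSeries]
      refine tsum_congr fun k => ?_
      rw [PowerSeries.coeff_derivative]
      push_cast
      ring
    · rw [← summable_nat_add_iff 1]
      refine (hc.deriv.summable z).congr fun k => ?_
      rw [PowerSeries.coeff_derivative]
      push_cast
      ring
  · intro k y hy
    rw [norm_mul, Real.norm_eq_abs]
    refine mul_le_mul_of_nonneg_left ?_ (abs_nonneg _)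
    rcases k with _ | k
    · simp
    · have h1 : |y| ≤ |z| + 1 := by simpa using (mem_ball_zero_iff.1 hy).le
      have h2 := succ_mul_pow_mul_le k hR zero_le_one
      have h3 : |y| ^ k ≤ (|z| + 1) ^ k := pow_le_pow_left₀ (abs_nonneg _) h1 k
      rw [norm_mul, norm_pow, Real.norm_eq_abs, Real.norm_eq_abs, abs_of_nonneg (by positivity),
        Nat.add_sub_cancel]
      push_cast
      nlinarith [mul_le_mul_of_nonneg_left h3 (by positivity : (0 : ℝ) ≤ (k : ℝ) + 1)]

theorem NonnegCoeff.mul {c d : PowerSeries ℝ} (hc : NonnegCoeff c) (hd : NonnegCoeff d) :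
    NonnegCoeff (c * d) := fun k => by
  rw [PowerSeries.coeff_mul]
  exact Finset.sum_nonneg fun p _ => mul_nonneg (hc _) (hd _)

theorem NonnegCoeff.deriv {c : PowerSeries ℝ} (hc : NonnegCoeff c) :
    NonnegCoeff (PowerSeries.derivative ℝ c) := fun k => by
  rw [PowerSeries.coeff_derivative]
  exact mul_nonneg (hc _) (by positivity)

theorem NonnegCoeff.evalSeries_nonneg {c : PowerSeries ℝ} (hc : NonnegCoeff c) {z : ℝ}
    (hz : 0 ≤ z) : 0 ≤ evalSeries c z :=
  tsum_nonneg fun k => mul_nonneg (hc k) (pow_nonneg hz k)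

theorem NonnegCoeff.evalSeries_mono {c : PowerSeries ℝ} (hc : NonnegCoeff c) (he : IsEntire c)
    {z w : ℝ} (hz : 0 ≤ z) (hzw : z ≤ w) : evalSeries c z ≤ evalSeries c w :=
  (he.summable z).tsum_le_tsum
    (fun k => mul_le_mul_of_nonneg_left (pow_le_pow_left₀ hz hzw k) (hc k)) (he.summable w)

/-- Convexity bounds the derivative by a difference quotient. -/
theorem NonnegCoeff.deriv_mul_le {c : PowerSeries ℝ} (hc : NonnegCoeff c) (he : IsEntire c)
    {z ε : ℝ} (hz : 0 ≤ z) (hε : 0 ≤ ε) :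
    evalSeries (PowerSeries.derivative ℝ c) z * ε ≤ evalSeries c (z + ε) := by
  have hs := he.summable (z + ε)
  have h0 : ∑' k, PowerSeries.coeff (k + 1) c * (z + ε) ^ (k + 1) ≤ evalSeries c (z + ε) := by
    have h := hs.tsum_eq_zero_add
    have h1 := mul_nonneg (hc 0) (pow_nonneg (by linarith : 0 ≤ z + ε) 0)
    unfold evalSeries
    linarith
  refine le_trans ?_ h0
  unfold evalSeries
  rw [← tsum_mul_right]
  refine ((he.deriv.summable z).mul_right ε).tsum_le_tsum (fun k => ?_)
    ((summable_nat_add_iff 1).2 hs)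
  rw [PowerSeries.coeff_derivative, mul_assoc, mul_assoc]
  refine mul_le_mul_of_nonneg_left ?_ (hc _)
  have := succ_mul_pow_mul_le k hz hε
  linarith

/-! ### Iterated Lie derivatives of a majorant -/

/-- The series `(A d/dz)^k z`. -/
def lieIterate (A : PowerSeries ℝ) : ℕ → PowerSeries ℝ
  | 0 => PowerSeries.X
  | k + 1 => A * PowerSeries.derivative ℝ (lieIterate A k)

theorem isEntire_X : IsEntire PowerSeries.X := fun r _ => by
  refine summable_of_ne_finset_zero (s := {1}) fun k hk => ?_
  rw [PowerSeries.coeff_X, if_neg (by simpa using hk)]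
  simp

theorem evalSeries_X (z : ℝ) : evalSeries PowerSeries.X z = z := by
  unfold evalSeries
  rw [tsum_eq_single 1 fun k hk => by rw [PowerSeries.coeff_X, if_neg hk, zero_mul]]
  simp

theorem nonnegCoeff_X : NonnegCoeff PowerSeries.X := fun k => by
  rw [PowerSeries.coeff_X]
  split_ifs <;> norm_num

theorem isEntire_lieIterate {A : PowerSeries ℝ} (hA : IsEntire A) :
    ∀ k, IsEntire (lieIterate A k)
  | 0 => isEntire_X
  | k + 1 => hA.mul (isEntire_lieIterate hA k).deriv

theorem nonnegCoeff_lieIterate {A : PowerSeries ℝ} (hA : NonnegCoeff A) :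
    ∀ k, NonnegCoeff (lieIterate A k)
  | 0 => nonnegCoeff_X
  | k + 1 => hA.mul (nonnegCoeff_lieIterate hA k).deriv

theorem evalSeries_lieIterate_succ {A : PowerSeries ℝ} (hA : IsEntire A) (k : ℕ) (z : ℝ) :
    evalSeries (lieIterate A (k + 1)) z =
      evalSeries A z * evalSeries (PowerSeries.derivative ℝ (lieIterate A k)) z :=
  evalSeries_mul hA (isEntire_lieIterate hA k).deriv z

/-! ### The flow of an entire vector field with nonnegative coefficients -/

theorem norm_pow_sub_pow_le {z w : ℂ} {R : ℝ} (hz : ‖z‖ ≤ R) (hw : ‖w‖ ≤ R) (k : ℕ) :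
    ‖z ^ (k + 1) - w ^ (k + 1)‖ ≤ ((k : ℝ) + 1) * R ^ k * ‖z - w‖ := by
  have hR : 0 ≤ R := (norm_nonneg z).trans hz
  induction k with
  | zero => simp
  | succ k ih =>
    have e : z ^ (k + 1 + 1) - w ^ (k + 1 + 1) =
        z * (z ^ (k + 1) - w ^ (k + 1)) + (z - w) * w ^ (k + 1) := by ring
    rw [e]
    have h1 : ‖z * (z ^ (k + 1) - w ^ (k + 1))‖ ≤ R * (((k : ℝ) + 1) * R ^ k * ‖z - w‖) := by
      rw [norm_mul]
      exact mul_le_mul hz ih (norm_nonneg _) hR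
    have h2 : ‖(z - w) * w ^ (k + 1)‖ ≤ ‖z - w‖ * R ^ (k + 1) := by
      rw [norm_mul, norm_pow]
      exact mul_le_mul_of_nonneg_left (pow_le_pow_left₀ (norm_nonneg _) hw _) (norm_nonneg _)
    refine (norm_add_le _ _).trans ((add_le_add h1 h2).trans (le_of_eq ?_))
    push_cast
    ring

/-- On a disc of radius R a difference of powers of exponent k + 1 costs the factor (k + 1)R^k. As
the coefficients are nonnegative, these factors add up to the value of the derived series at R. -/
theorem lipschitz_of_series {A : PowerSeries ℝ} (hA : IsEntire A) {X : ℂ → ℂ}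
    (hX : ∀ z : ℂ, HasSum (fun k => ((PowerSeries.coeff k A : ℝ) : ℂ) * z ^ k) (X z))
    (hn : NonnegCoeff A) {z w : ℂ} {R : ℝ} (hz : ‖z‖ ≤ R) (hw : ‖w‖ ≤ R) :
    ‖X z - X w‖ ≤ evalSeries (PowerSeries.derivative ℝ A) R * ‖z - w‖ := by
  have h := (hX z).sub (hX w)
  rw [← h.tsum_eq]
  have hb : ∀ k, ‖((PowerSeries.coeff (k + 1) A : ℝ) : ℂ) * z ^ (k + 1) -
      ((PowerSeries.coeff (k + 1) A : ℝ) : ℂ) * w ^ (k + 1)‖ ≤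
      PowerSeries.coeff k (PowerSeries.derivative ℝ A) * R ^ k * ‖z - w‖ := by
    intro k
    rw [← mul_sub, norm_mul, Complex.norm_real, Real.norm_of_nonneg (hn _),
      PowerSeries.coeff_derivative]
    have := mul_le_mul_of_nonneg_left (norm_pow_sub_pow_le hz hw k) (hn (k + 1))
    linarith
  have hs := (hA.deriv.summable R).mul_right ‖z - w‖
  rw [h.summable.tsum_eq_zero_add, evalSeries, ← tsum_mul_right]
  simp only [pow_zero, sub_self, zero_add]
  exact tsum_of_norm_bounded hs.hasSum hb

theorem real_of_series {A : PowerSeries ℝ} (hA : IsEntire A) {X : ℂ → ℂ}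
    (hX : ∀ z : ℂ, HasSum (fun k => ((PowerSeries.coeff k A : ℝ) : ℂ) * z ^ k) (X z)) (x : ℝ) :
    X x = (evalSeries A x : ℂ) := by
  have h := Complex.hasSum_ofReal.2 (hA.summable x).hasSum
  refine (hX x).unique ?_
  simpa [evalSeries] using h

theorem lipschitz_evalSeries {A : PowerSeries ℝ} (hA : IsEntire A) (hn : NonnegCoeff A)
    {x y R : ℝ} (hx : |x| ≤ R) (hy : |y| ≤ R) :
    |evalSeries A x - evalSeries A y| ≤ evalSeries (PowerSeries.derivative ℝ A) R * |x - y| := by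
  have hX : ∀ z : ℂ, Summable (fun k => ((PowerSeries.coeff k A : ℝ) : ℂ) * z ^ k) := fun z => by
    refine Summable.of_norm ((hA ‖z‖ (norm_nonneg z)).congr fun k => ?_)
    simp
  have h := lipschitz_of_series hA (fun z => (hX z).hasSum) hn (z := x) (w := y) (R := R)
    (by simpa using hx) (by simpa using hy)
  rw [real_of_series hA (fun z => (hX z).hasSum), real_of_series hA (fun z => (hX z).hasSum),
    ← Complex.ofReal_sub, ← Complex.ofReal_sub, Complex.norm_real, Complex.norm_real] at h
  exact h

/-- A complex flow line from a point `z ≥ 0` is a real, nonnegative and increasing. -/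
theorem exists_real_flow {A : PowerSeries ℝ} (hA : IsEntire A) (hn : NonnegCoeff A) {X : ℂ → ℂ}
    (hX : ∀ z : ℂ, HasSum (fun k => ((PowerSeries.coeff k A : ℝ) : ℂ) * z ^ k) (X z))
    {t z : ℝ} {w : ℂ} (ht : 0 ≤ t) (hz : 0 ≤ z) (h : FlowsTo X t z w) :
    ∃ γ : ℝ → ℝ, γ 0 = z ∧ γ t = ‖w‖ ∧ MonotoneOn γ (Set.Icc 0 t) ∧
      (∀ τ ∈ Set.Icc 0 t, 0 ≤ γ τ) ∧
      ∀ τ ∈ Set.Icc 0 t, HasDerivWithinAt γ (evalSeries A (γ τ)) (Set.Icc 0 t) τ := by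
  obtain ⟨g, g0, gt, hg⟩ := h
  have hc : ContinuousOn g (Set.Icc 0 t) := fun τ hτ => (hg τ hτ).continuousWithinAt
  obtain ⟨R, hR⟩ := isCompact_Icc.exists_bound_of_continuousOn hc
  have hR0 : 0 ≤ R := (norm_nonneg _).trans (hR 0 ⟨le_rfl, ht⟩)
  set L := evalSeries (PowerSeries.derivative ℝ A) R with hL
  have hL0 : 0 ≤ L := hn.deriv.evalSeries_nonneg hR0
  -- Real coefficients make X commute with conjugation, so the conjugate of the flow line is a flow
  -- line with the same real starting point, and uniqueness forces them to agree.
  have hconj : ∀ z : ℂ, X (starRingEnd ℂ z) = starRingEnd ℂ (X z) := fun z => by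
    refine (hX _).unique ?_
    have := (Complex.hasSum_conj').2 (by simpa using hX z)
    simpa using this
  have hIci : ∀ {f : ℝ → ℂ} {f' : ℂ} {τ : ℝ}, τ ∈ Set.Ico 0 t →
      HasDerivWithinAt f f' (Set.Icc 0 t) τ → HasDerivWithinAt f f' (Set.Ici τ) τ :=
    fun hτ hf => hf.mono_of_mem_nhdsWithin (mem_nhdsWithin.2
      ⟨Set.Iio t, isOpen_Iio, hτ.2, fun x hx => ⟨hτ.1.trans hx.2, le_of_lt hx.1⟩⟩)
  have heq : Set.EqOn g (fun τ => starRingEnd ℂ (g τ)) (Set.Icc 0 t) := by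
    refine ODE_solution_unique_of_mem_Icc_right (v := fun _ => X)
      (s := fun _ => Metric.closedBall 0 R) (K := L.toNNReal) (fun τ _ => ?_) hc
      (fun τ hτ => hIci hτ (hg τ (Set.Ico_subset_Icc_self hτ)))
      (fun τ hτ => by simpa using hR τ (Set.Ico_subset_Icc_self hτ))
      (Complex.continuous_conj.comp_continuousOn hc) (fun τ hτ => ?_)
      (fun τ hτ => by simpa using hR τ (Set.Ico_subset_Icc_self hτ)) ?_
    · refine LipschitzOnWith.of_dist_le_mul fun a ha b hb => ?_
      rw [dist_eq_norm, dist_eq_norm, Real.coe_toNNReal _ hL0]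
      exact lipschitz_of_series hA hX hn (by simpa using ha) (by simpa using hb)
    · rw [hconj]
      exact (hIci hτ (hg τ (Set.Ico_subset_Icc_self hτ))).star
    · rw [g0]
      simp
  have him : ∀ τ ∈ Set.Icc 0 t, ((g τ).re : ℂ) = g τ := fun τ hτ =>
    Complex.conj_eq_iff_re.1 (heq hτ).symm
  have hd : ∀ τ ∈ Set.Icc 0 t, HasDerivWithinAt (fun τ => (g τ).re)
      (evalSeries A (g τ).re) (Set.Icc 0 t) τ := fun τ hτ => by
    have h1 := Complex.reCLM.hasFDerivAt.comp_hasDerivWithinAt τ (hg τ hτ)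
    rw [← him τ hτ, real_of_series hA hX] at h1
    exact h1
  have hcr : ContinuousOn (fun τ => (g τ).re) (Set.Icc 0 t) :=
    fun τ hτ => (hd τ hτ).continuousWithinAt
  have hpos : ∀ τ ∈ Set.Icc 0 t, 0 ≤ (g τ).re := by
    intro τ hτ
    -- Barrier argument: where `-Re g` meets δ e^{(L+1)τ}, its slope -A(Re g) is at most -A(0) + Lδ
    -- e^{(L+1)τ}. Since A(0) ≥ 0, this is strictly less than the slope of the barrier.
    have hδ : ∀ δ > 0, -(g τ).re ≤ δ * Real.exp ((L + 1) * τ) := by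
      intro δ hδ
      refine image_le_of_deriv_right_lt_deriv_boundary' (a := 0) (b := t)
        (f := fun τ => -(g τ).re) (f' := fun τ => -evalSeries A (g τ).re)
        (B := fun τ => δ * Real.exp ((L + 1) * τ))
        (B' := fun τ => δ * (Real.exp ((L + 1) * τ) * ((L + 1) * 1))) hcr.neg (fun x hx => ?_) ?_
        (by fun_prop) (fun x _ => ?_) (fun x hx hxe => ?_) hτ
      · exact ((hd x (Set.Ico_subset_Icc_self hx)).mono_of_mem_nhdsWithin (mem_nhdsWithin.2
          ⟨Set.Iio t, isOpen_Iio, hx.2, fun y hy => ⟨hx.1.trans hy.2, le_of_lt hy.1⟩⟩)).neg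
      · simp only [g0, Complex.ofReal_re, mul_zero, Real.exp_zero, mul_one]
        linarith
      · exact ((((hasDerivAt_id x).const_mul (L + 1)).exp).const_mul δ).hasDerivWithinAt
      · have hx' := Set.Ico_subset_Icc_self hx
        have h1 := lipschitz_evalSeries hA hn (x := (g x).re) (y := 0) (R := R)
          ((Complex.abs_re_le_norm _).trans (hR x hx')) (by simpa using hR0)
        have h2 := hn.evalSeries_nonneg (le_refl (0 : ℝ))
        have he : 0 < δ * Real.exp ((L + 1) * x) := by positivity
        have h3 : |(g x).re| = δ * Real.exp ((L + 1) * x) := by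
          rw [abs_of_neg (by linarith)]; exact hxe
        rw [sub_zero, h3] at h1
        have h4 := (abs_le.1 h1).1
        nlinarith
    by_contra hlt
    push Not at hlt
    -- With this δ the barrier at τ is half of -Re g(τ), which is positive by assumption.
    have h5 := hδ (-(g τ).re / (2 * Real.exp ((L + 1) * τ)))
      (div_pos (by linarith) (by positivity))
    have h6 : -(g τ).re / (2 * Real.exp ((L + 1) * τ)) * Real.exp ((L + 1) * τ) =
        -(g τ).re / 2 := by
      field_simp
    linarith
  refine ⟨fun τ => (g τ).re, by simp [g0], ?_, ?_, hpos, hd⟩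
  · have h1 := him t ⟨ht, le_rfl⟩
    rw [← gt, ← h1, Complex.norm_real, Real.norm_of_nonneg (hpos t ⟨ht, le_rfl⟩)]
  · refine monotoneOn_of_deriv_nonneg (convex_Icc 0 t) hcr (fun x hx => ?_) (fun x hx => ?_)
    · exact ((hd x (interior_subset hx)).mono interior_subset).differentiableWithinAt
    · have h1 := (hd x (interior_subset hx)).hasDerivAt (mem_interior_iff_mem_nhds.1 hx)
      rw [h1.deriv]
      exact hn.evalSeries_nonneg (hpos x (interior_subset hx))

/-- This is the cancellation in the derivative of a truncated exponential series whose coefficients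
satisfy c_k' = c_{k+1}. The truncated exponent `k - 1` is harmless at k = 0 because of the factor k.
-/
theorem sum_telescope (c : ℕ → ℝ) (τ : ℝ) (K : ℕ) :
    ∑ k ∈ Finset.range (K + 1), (-((k : ℝ) * τ ^ (k - 1) / k.factorial * c k) +
      τ ^ k / k.factorial * c (k + 1)) = τ ^ K / K.factorial * c (K + 1) := by
  induction K with
  | zero => simp
  | succ K ih =>
    rw [Finset.sum_range_succ, ih, Nat.factorial_succ]
    push_cast
    field_simp
    ring

/-- Along a flow line which exists up to time `t`, the Taylor sums of the flow at slightly larger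
points are bounded, uniformly in the starting point. -/
theorem sum_lieIterate_le {A : PowerSeries ℝ} (hA : IsEntire A) (hn : NonnegCoeff A) {X : ℂ → ℂ}
    (hX : ∀ z : ℂ, HasSum (fun k => ((PowerSeries.coeff k A : ℝ) : ℂ) * z ^ k) (X z)) (T M : ℝ)
    (hM : 0 ≤ M) :
    ∃ ε > 0, ∀ (t z : ℝ) (w : ℂ), 0 ≤ t → t ≤ T → 0 ≤ z → FlowsTo X t z w → ‖w‖ ≤ M →
      z ≤ M ∧ ∀ K, ∑ k ∈ Finset.range (K + 1),
        t ^ k / k.factorial * evalSeries (lieIterate A k) (z + ε) ≤ M + 1 := by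
  set L := evalSeries (PowerSeries.derivative ℝ A) (M + 1) with hL
  have hL0 : 0 ≤ L := hn.deriv.evalSeries_nonneg (by linarith)
  -- L is a Lipschitz constant of A up to radius M + 1. This ε keeps ε e^{Lτ} ≤ 1 for τ ≤ T, so that
  -- a flow line below M, raised by ε e^{Lτ}, stays in that range.
  refine ⟨Real.exp (-(L * T)), Real.exp_pos _, fun t z w ht htT hz hf hw => ?_⟩
  set ε := Real.exp (-(L * T)) with hε
  have hε0 : 0 < ε := Real.exp_pos _
  obtain ⟨γ, γ0, γt, hmono, hpos, hd⟩ := exists_real_flow hA hn hX ht hz hf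
  have hγM : ∀ τ ∈ Set.Icc 0 t, γ τ ≤ M := fun τ hτ =>
    (hmono hτ ⟨ht, le_rfl⟩ hτ.2).trans (γt.le.trans hw)
  refine ⟨γ0 ▸ hγM 0 ⟨le_rfl, ht⟩, fun K => ?_⟩
  have he1 : ∀ τ ∈ Set.Icc 0 t, ε * Real.exp (L * τ) ≤ 1 := fun τ hτ => by
    rw [hε, ← Real.exp_add, Real.exp_le_one_iff]
    nlinarith [hτ.2]
  -- Γ starts at z + ε and is a supersolution of γ' = A(γ): the growth of the added exponential
  -- outweighs A(Γ) - A(γ).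
  set Γ : ℝ → ℝ := fun τ => γ τ + ε * Real.exp (L * τ) with hΓ
  have hΓ0 : ∀ τ ∈ Set.Icc 0 t, 0 ≤ Γ τ := fun τ hτ =>
    add_nonneg (hpos τ hτ) (by positivity)
  have hΓM : ∀ τ ∈ Set.Icc 0 t, Γ τ ≤ M + 1 := fun τ hτ => add_le_add (hγM τ hτ) (he1 τ hτ)
  have hΓd : ∀ τ ∈ Set.Icc 0 t, HasDerivWithinAt Γ
      (evalSeries A (γ τ) + ε * (Real.exp (L * τ) * (L * 1))) (Set.Icc 0 t) τ := fun τ hτ =>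
    (hd τ hτ).add ((((hasDerivAt_id τ).const_mul L).exp).const_mul ε).hasDerivWithinAt
  have hsup : ∀ τ ∈ Set.Icc 0 t, evalSeries A (Γ τ) ≤
      evalSeries A (γ τ) + ε * (Real.exp (L * τ) * (L * 1)) := fun τ hτ => by
    have h1 := lipschitz_evalSeries hA hn (x := Γ τ) (y := γ τ) (R := M + 1)
      (by rw [abs_of_nonneg (hΓ0 τ hτ)]; exact hΓM τ hτ)
      (by rw [abs_of_nonneg (hpos τ hτ)]; linarith [hγM τ hτ])
    have h2 : Γ τ - γ τ = ε * Real.exp (L * τ) := by simp [hΓ]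
    rw [h2, abs_of_nonneg (by positivity : 0 ≤ ε * Real.exp (L * τ))] at h1
    have h3 := (abs_le.1 h1).2
    linarith
  -- G(σ) is the Taylor polynomial of the flow for the remaining time t - σ, evaluated at Γ(σ).
  -- Along an exact flow line its derivative would telescope to one nonnegative term, and the excess
  -- of Γ' over A(Γ) only adds to it. So G increases from the sum to be bounded, at σ = 0, to Γ(t) ≤
  -- M + 1.
  set G : ℝ → ℝ := fun σ => ∑ k ∈ Finset.range (K + 1),
    (t - σ) ^ k / k.factorial * evalSeries (lieIterate A k) (Γ σ) with hG
  have hGd : ∀ σ ∈ Set.Icc 0 t, HasDerivWithinAt G (∑ k ∈ Finset.range (K + 1),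
      (((k : ℝ) * (t - σ) ^ (k - 1) * (-1)) / k.factorial * evalSeries (lieIterate A k) (Γ σ) +
        (t - σ) ^ k / k.factorial * (evalSeries (PowerSeries.derivative ℝ (lieIterate A k)) (Γ σ) *
          (evalSeries A (γ σ) + ε * (Real.exp (L * σ) * (L * 1)))))) (Set.Icc 0 t) σ := by
    intro σ hσ
    refine HasDerivWithinAt.fun_sum fun k _ => ?_
    refine HasDerivWithinAt.mul ?_ ?_
    · have h1 : HasDerivAt (fun x : ℝ => t - x) (-1) σ := by
        simpa using (hasDerivAt_id σ).const_sub t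
      exact ((h1.fun_pow k).div_const _).hasDerivWithinAt
    · exact (hasDerivAt_evalSeries (isEntire_lieIterate hA k) (Γ σ)).comp_hasDerivWithinAt σ
        (hΓd σ hσ)
  have hmonoG : MonotoneOn G (Set.Icc 0 t) := by
    refine monotoneOn_of_deriv_nonneg (convex_Icc 0 t)
      (fun σ hσ => (hGd σ hσ).continuousWithinAt)
      (fun x hx => ((hGd x (interior_subset hx)).mono interior_subset).differentiableWithinAt)
      fun σ hσ => ?_
    have hσ' := interior_subset hσ
    rw [((hGd σ hσ').hasDerivAt (mem_interior_iff_mem_nhds.1 hσ)).deriv]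
    have hts : 0 ≤ t - σ := by linarith [hσ'.2]
    have h1 := sum_telescope (fun k => evalSeries (lieIterate A k) (Γ σ)) (t - σ) K
    have h2 : 0 ≤ (t - σ) ^ K / K.factorial * evalSeries (lieIterate A (K + 1)) (Γ σ) :=
      mul_nonneg (by positivity) ((nonnegCoeff_lieIterate hn _).evalSeries_nonneg (hΓ0 σ hσ'))
    refine (h2.trans h1.ge).trans (Finset.sum_le_sum fun k _ => ?_)
    have h3 := mul_le_mul_of_nonneg_left (hsup σ hσ')
      ((nonnegCoeff_lieIterate hn k).deriv.evalSeries_nonneg (hΓ0 σ hσ'))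
    rw [evalSeries_lieIterate_succ hA]
    have h4 := mul_le_mul_of_nonneg_left h3
      (by positivity : 0 ≤ (t - σ) ^ k / (k.factorial : ℝ))
    have h5 : -((k : ℝ) * (t - σ) ^ (k - 1) / k.factorial * evalSeries (lieIterate A k) (Γ σ)) =
      ((k : ℝ) * (t - σ) ^ (k - 1) * (-1)) / k.factorial * evalSeries (lieIterate A k) (Γ σ) := by
      ring
    rw [h5]
    have h6 := mul_comm (evalSeries A (Γ σ))
      (evalSeries (PowerSeries.derivative ℝ (lieIterate A k)) (Γ σ))
    rw [h6]
    linarith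
  have hfin := hmonoG ⟨le_rfl, ht⟩ ⟨ht, le_rfl⟩ ht
  have hGt : G t = Γ t := by
    simp only [hG, sub_self]
    rw [Finset.sum_eq_single 0 (fun k _ hk => by simp [hk]) (by simp)]
    simp [lieIterate, evalSeries_X]
  have hG0 : G 0 = ∑ k ∈ Finset.range (K + 1),
      t ^ k / k.factorial * evalSeries (lieIterate A k) (z + ε) := by
    simp [hG, hΓ, γ0]
  rw [hG0, hGt] at hfin
  exact hfin.trans (hΓM t ⟨ht, le_rfl⟩)


/-! ### Entire series of multilinear maps and their majorants -/

section Series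

variable {E G : Type*} [NormedAddCommGroup E] [NormedSpace ℝ E]
  [NormedAddCommGroup G] [NormedSpace ℝ G]

/-- The coefficients of `f` are bounded by those of the power series `κ c(z / b)`. -/
def HasMajorant (f : FormalMultilinearSeries ℝ E G) (b κ : ℝ) (c : PowerSeries ℝ) : Prop :=
  ∀ p, ‖f p‖ * b ^ p ≤ κ * PowerSeries.coeff p c

theorem norm_diag_le (f : FormalMultilinearSeries ℝ E G) (p : ℕ) (φ : E) :
    ‖f p (fun _ => φ)‖ ≤ ‖f p‖ * ‖φ‖ ^ p := by
  simpa using (f p).le_opNorm (fun _ => φ)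

theorem HasMajorant.norm_mul_pow_le {f : FormalMultilinearSeries ℝ E G} {b κ : ℝ}
    {c : PowerSeries ℝ} (h : HasMajorant f b κ c) {z : ℝ} (hz : 0 ≤ z) (p : ℕ) :
    ‖f p‖ * (b * z) ^ p ≤ κ * (PowerSeries.coeff p c * z ^ p) := by
  have := mul_le_mul_of_nonneg_right (h p) (pow_nonneg hz p)
  rw [mul_pow]
  linarith

theorem HasMajorant.norm_term_le {f : FormalMultilinearSeries ℝ E G} {b κ : ℝ}
    {c : PowerSeries ℝ} (h : HasMajorant f b κ c) {φ : E} {z : ℝ} (hz : 0 ≤ z)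
    (hφ : ‖φ‖ ≤ b * z) (p : ℕ) :
    ‖f p (fun _ => φ)‖ ≤ κ * (PowerSeries.coeff p c * z ^ p) :=
  (norm_diag_le f p φ).trans ((mul_le_mul_of_nonneg_left
    (pow_le_pow_left₀ (norm_nonneg _) hφ p) (norm_nonneg _)).trans (h.norm_mul_pow_le hz p))

theorem norm_le_mul_div {b : ℝ} (hb : 0 < b) (φ : E) : ‖φ‖ ≤ b * (‖φ‖ / b) := by
  rw [mul_div_cancel₀ _ hb.ne']

theorem HasMajorant.summable_norm {f : FormalMultilinearSeries ℝ E G} {b κ : ℝ}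
    {c : PowerSeries ℝ} (h : HasMajorant f b κ c) (hb : 0 < b) (hc : IsEntire c) (φ : E) :
    Summable fun p => ‖f p (fun _ => φ)‖ :=
  Summable.of_nonneg_of_le (fun _ => norm_nonneg _)
    (h.norm_term_le (div_nonneg (norm_nonneg φ) hb.le) (norm_le_mul_div hb φ))
    ((hc.summable _).mul_left κ)

theorem HasMajorant.norm_sum_le {f : FormalMultilinearSeries ℝ E G} {b κ : ℝ}
    {c : PowerSeries ℝ} (h : HasMajorant f b κ c) (hc : IsEntire c) {φ : E} {z : ℝ} (hz : 0 ≤ z)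
    (hφ : ‖φ‖ ≤ b * z) : ‖f.sum φ‖ ≤ κ * evalSeries c z := by
  unfold evalSeries
  rw [← tsum_mul_left]
  exact tsum_of_norm_bounded ((hc.summable z).mul_left κ).hasSum (h.norm_term_le hz hφ)

theorem HasMajorant.hasFPowerSeries [CompleteSpace G] {f : FormalMultilinearSeries ℝ E G}
    {b κ : ℝ} {c : PowerSeries ℝ} (h : HasMajorant f b κ c) (hb : 0 < b) (hc : IsEntire c) :
    HasFPowerSeriesOnBall f.sum f 0 ⊤ := by
  have hr : f.radius = ⊤ := by
    refine f.radius_eq_top_of_summable_norm fun r => ?_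
    refine Summable.of_nonneg_of_le (fun _ => by positivity) (fun p => ?_)
      ((hc.summable (r / b)).mul_left κ)
    have := h.norm_mul_pow_le (z := r / b) (by positivity) p
    rwa [mul_div_cancel₀ _ hb.ne'] at this
  have := f.hasFPowerSeriesOnBall (by rw [hr]; exact ENNReal.zero_lt_top)
  rwa [hr] at this

theorem HasMajorant.differentiable [CompleteSpace G] {f : FormalMultilinearSeries ℝ E G}
    {b κ : ℝ} {c : PowerSeries ℝ} (h : HasMajorant f b κ c) (hb : 0 < b) (hc : IsEntire c) :
    Differentiable ℝ f.sum := fun φ =>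
  ((h.hasFPowerSeries hb hc).analyticAt_of_mem (by simp)).differentiableAt

/-! ### Termwise differentiation and continuity of entire series of multilinear maps. -/

theorem hasDerivAt_diag (f : FormalMultilinearSeries ℝ E G) (p : ℕ) (φ v : E) (x : ℝ) :
    HasDerivAt (fun h : ℝ => f p (fun _ => φ + h • v))
      (∑ i, f p (Function.update (fun _ => φ + x • v) i v)) x := by
  have h1 : HasDerivAt (fun h : ℝ => (fun _ : Fin p => φ + h • v)) (fun _ => v) x :=
    hasDerivAt_pi.2 fun _ => by simpa using ((hasDerivAt_id x).smul_const v).const_add φ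
  have h2 := ((f p).hasFDerivAt (x := fun _ : Fin p => φ + x • v)).comp_hasDerivAt x h1
  rwa [ContinuousMultilinearMap.linearDeriv_apply] at h2

theorem norm_update_le (f : FormalMultilinearSeries ℝ E G) (p : ℕ) (φ v : E)
    (i : Fin (p + 1)) :
    ‖f (p + 1) (Function.update (fun _ => φ) i v)‖ ≤ ‖f (p + 1)‖ * (‖v‖ * ‖φ‖ ^ p) := by
  refine ((f (p + 1)).le_opNorm _).trans (le_of_eq ?_)
  congr 1
  rw [Fin.prod_univ_succAbove _ i]
  simp

theorem norm_sum_update_le (f : FormalMultilinearSeries ℝ E G) (p : ℕ) (φ v : E) {R : ℝ}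
    (hφ : ‖φ‖ ≤ R) :
    ‖∑ i, f (p + 1) (Function.update (fun _ => φ) i v)‖ ≤
      ((p : ℝ) + 1) * R ^ p * ‖v‖ * ‖f (p + 1)‖ := by
  refine (norm_sum_le_of_le (f := fun i => f (p + 1) (Function.update (fun _ => φ) i v))
    Finset.univ fun i _ => (norm_update_le f p φ v i).trans (mul_le_mul_of_nonneg_left
    (mul_le_mul_of_nonneg_left (pow_le_pow_left₀ (norm_nonneg _) hφ p) (norm_nonneg _))
    (norm_nonneg _))).trans (le_of_eq ?_)
  rw [Finset.sum_const, Finset.card_univ, Fintype.card_fin, nsmul_eq_mul]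
  push_cast
  ring

/-- On the segment |x| < 1 the derived terms are bounded in terms of R = ‖φ‖ + ‖v‖ + 1, and the
majorant at radius R + 1 makes these bounds summable. The constant term drops out, hence the index p
+ 1. -/
theorem HasMajorant.hasDerivAt [CompleteSpace G] {f : FormalMultilinearSeries ℝ E G} {b κ : ℝ}
    {c : PowerSeries ℝ} (h : HasMajorant f b κ c) (hb : 0 < b) (hc : IsEntire c) (φ v : E) :
    HasDerivAt (fun x : ℝ => f.sum (φ + x • v))
      (∑' p, ∑ i, f (p + 1) (Function.update (fun _ => φ) i v)) 0 := by
  set R : ℝ := ‖φ‖ + ‖v‖ + 1 with hR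
  have hR0 : 0 ≤ R := by positivity
  set u : ℕ → ℝ := fun p => p * R ^ (p - 1) * ‖v‖ * ‖f p‖ with hu
  have hs : Summable u := by
    rw [← summable_nat_add_iff 1]
    refine Summable.of_nonneg_of_le (fun p => by positivity) (fun p => ?_)
      ((((summable_nat_add_iff 1).2 (hc.summable ((R + 1) / b))).mul_left κ).mul_left ‖v‖)
    have h1 := succ_mul_pow_mul_le p hR0 zero_le_one
    have h2 := h.norm_mul_pow_le (z := (R + 1) / b) (by positivity) (p + 1)
    rw [mul_div_cancel₀ _ hb.ne'] at h2
    have h3 : u (p + 1) = (((p : ℝ) + 1) * R ^ p * 1) * ‖f (p + 1)‖ * ‖v‖ := by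
      simp only [hu, Nat.add_sub_cancel]
      push_cast
      ring
    rw [h3, mul_comm ‖v‖]
    refine mul_le_mul_of_nonneg_right ?_ (norm_nonneg _)
    refine le_trans ?_ h2
    rw [mul_comm]
    exact mul_le_mul_of_nonneg_left h1 (norm_nonneg _)
  have key := hasDerivAt_tsum_of_isPreconnected (t := Metric.ball (0 : ℝ) 1)
    (g := fun p (x : ℝ) => f p (fun _ => φ + x • v))
    (g' := fun p x => ∑ i, f p (Function.update (fun _ => φ + x • v) i v)) (y₀ := 0) (y := 0)
    hs Metric.isOpen_ball (convex_ball _ _).isPreconnected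
    (fun p x _ => hasDerivAt_diag f p φ v x) ?_ (by simp) ?_ (by simp)
  · refine key.congr_deriv ?_
    simp only [zero_smul, add_zero]
    rw [Summable.tsum_eq_zero_add]
    · simp
    · refine Summable.of_norm_bounded hs fun p => ?_
      rcases p with _ | p
      · simp [hu]
      · have := norm_sum_update_le f p φ v (R := R) (by linarith [norm_nonneg v])
        simpa [hu] using this
  · intro p x hx
    rcases p with _ | p
    · simp [hu]
    · have hx1 : |x| ≤ 1 := by simpa using (mem_ball_zero_iff.1 hx).le
      have h1 : ‖φ + x • v‖ ≤ R := by
        refine (norm_add_le _ _).trans ?_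
        rw [norm_smul, Real.norm_eq_abs]
        nlinarith [norm_nonneg v]
      have := norm_sum_update_le f p (φ + x • v) v h1
      simpa [hu] using this
  · simpa using (h.summable_norm hb hc φ).of_norm

/-- The joint continuity of a family of series in the parameter and the arguments. -/
def JointlyContinuous {T : Type*} [TopologicalSpace T] (f : T → FormalMultilinearSeries ℝ E G) :
    Prop :=
  ∀ p, Continuous fun x : T × (Fin p → E) => f x.1 p x.2

theorem JointlyContinuous.continuous_eval {T : Type*} [TopologicalSpace T]
    {f : T → FormalMultilinearSeries ℝ E G} (hf : JointlyContinuous f) (p : ℕ) (v : Fin p → E) :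
    Continuous fun τ => f τ p v :=
  (hf p).comp (continuous_id.prodMk continuous_const)

/-- The Weierstrass test applies on K times the ball of radius ‖φ‖ + 1, since one majorant serves
all parameters in K; continuity is then local in the argument. -/
theorem JointlyContinuous.continuousOn_sum [CompleteSpace G] {T : Type*} [TopologicalSpace T]
    {f : T → FormalMultilinearSeries ℝ E G} (hf : JointlyContinuous f) {b κ : ℝ} (hb : 0 < b)
    {c : PowerSeries ℝ} (hc : IsEntire c) {K : Set T} (h : ∀ τ ∈ K, HasMajorant (f τ) b κ c) :
    ContinuousOn (fun x : T × E => (f x.1).sum x.2) (K ×ˢ Set.univ) := by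
  rintro ⟨τ, φ⟩ ⟨hτ, -⟩
  have h1 : ContinuousOn (fun x : T × E => (f x.1).sum x.2)
      (K ×ˢ Metric.ball (0 : E) (‖φ‖ + 1)) := by
    refine continuousOn_tsum (u := fun p => κ * (PowerSeries.coeff p c * ((‖φ‖ + 1) / b) ^ p))
      (fun p => ?_) ((hc.summable _).mul_left κ) ?_
    · refine Continuous.continuousOn ?_
      exact (hf p).comp (continuous_fst.prodMk (continuous_pi fun _ => continuous_snd))
    · rintro p ⟨τ', φ'⟩ ⟨hτ', hφ'⟩
      refine (h τ' hτ').norm_term_le (by positivity) ?_ p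
      rw [mul_div_cancel₀ _ hb.ne']
      exact (mem_ball_zero_iff.1 hφ').le
  refine (h1 (τ, φ) ⟨hτ, by simp⟩).mono_of_mem_nhdsWithin ?_
  refine mem_nhdsWithin.2 ⟨Set.univ ×ˢ Metric.ball (0 : E) (‖φ‖ + 1),
    isOpen_univ.prod Metric.isOpen_ball, by simp, ?_⟩
  rintro x ⟨⟨-, h2⟩, ⟨h3, -⟩⟩
  exact ⟨h3, h2⟩

/-- Insertion of the value of `h` at the last arguments into the `i`-th slot of `f`. -/
def insertMap {p q : ℕ} (f : ContinuousMultilinearMap ℝ (fun _ : Fin (p + 1) => E) G)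
    (i : Fin (p + 1)) (h : ContinuousMultilinearMap ℝ (fun _ : Fin q => E) E) :
    ContinuousMultilinearMap ℝ (fun _ : Fin (q + p) => E) G :=
  (ContinuousMultilinearMap.uncurrySum
    ((f.curryMid i).compContinuousMultilinearMap h)).domDomCongr finSumFinEquiv

theorem insertMap_apply {p q : ℕ} (f : ContinuousMultilinearMap ℝ (fun _ : Fin (p + 1) => E) G)
    (i : Fin (p + 1)) (h : ContinuousMultilinearMap ℝ (fun _ : Fin q => E) E)
    (v : Fin (q + p) → E) :
    insertMap f i h v =
      f (i.insertNth (h fun j => v (Fin.castAdd p j)) fun j => v (Fin.natAdd q j)) := by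
  simp only [insertMap, ContinuousMultilinearMap.domDomCongr_apply,
    ContinuousMultilinearMap.uncurrySum_apply,
    ContinuousLinearMap.compContinuousMultilinearMap_coe, Function.comp_apply,
    ContinuousMultilinearMap.curryMid_apply]
  congr 1

theorem norm_insertMap_le {p q : ℕ} (f : ContinuousMultilinearMap ℝ (fun _ : Fin (p + 1) => E) G)
    (i : Fin (p + 1)) (h : ContinuousMultilinearMap ℝ (fun _ : Fin q => E) E) :
    ‖insertMap f i h‖ ≤ ‖f‖ * ‖h‖ := by
  rw [insertMap, ContinuousMultilinearMap.norm_domDomCongr]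
  refine ((ContinuousMultilinearMap.currySumEquiv ℝ (Fin q) (Fin p) E G).symm.norm_map
    ((f.curryMid i).compContinuousMultilinearMap h)).le.trans ?_
  refine (ContinuousLinearMap.norm_compContinuousMultilinearMap_le _ _).trans ?_
  rw [ContinuousMultilinearMap.norm_curryMid]

theorem insertNth_const {p : ℕ} (i : Fin (p + 1)) (x φ : E) :
    (i.insertNth x (fun _ : Fin p => φ) : Fin (p + 1) → E) =
      Function.update (fun _ => φ) i x := by
  funext j
  refine Fin.succAboveCases i ?_ (fun k => ?_) j
  · simp
  · simp

/-- The series of the derivative of `f` along the vector field with series `g`. -/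
def lieSeries (f : FormalMultilinearSeries ℝ E G) (g : FormalMultilinearSeries ℝ E E) :
    FormalMultilinearSeries ℝ E G := fun n =>
  ∑ x : Finset.HasAntidiagonal.antidiagonal n, ∑ i : Fin (x.1.2 + 1),
    (insertMap (f (x.1.2 + 1)) i (g x.1.1)).domDomCongr
      (finCongr (Finset.HasAntidiagonal.mem_antidiagonal.1 x.2))

theorem lieSeries_apply (f : FormalMultilinearSeries ℝ E G) (g : FormalMultilinearSeries ℝ E E)
    (n : ℕ) (v : Fin n → E) :
    lieSeries f g n v = ∑ x : Finset.HasAntidiagonal.antidiagonal n, ∑ i : Fin (x.1.2 + 1),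
      f (x.1.2 + 1) (i.insertNth
        (g x.1.1 fun j => v (finCongr (Finset.HasAntidiagonal.mem_antidiagonal.1 x.2)
          (Fin.castAdd x.1.2 j)))
        fun j => v (finCongr (Finset.HasAntidiagonal.mem_antidiagonal.1 x.2)
          (Fin.natAdd x.1.1 j))) := by
  simp only [lieSeries, _root_.sum_apply, ContinuousMultilinearMap.domDomCongr_apply,
    insertMap_apply]

/-- In degree n a term of g of degree q goes into one of the p + 1 slots of the term of f of degree
p + 1, with q + p = n. The number of slots is the factor in the coefficients of the derivative of c,
and the sum over q + p = n is that of a product of power series. -/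
theorem HasMajorant.lieSeries {f : FormalMultilinearSeries ℝ E G}
    {g : FormalMultilinearSeries ℝ E E} {b κ : ℝ} (hb : 0 < b) {c A : PowerSeries ℝ}
    (hf : HasMajorant f b κ c) (hg : HasMajorant g b b A) :
    HasMajorant (lieSeries f g) b κ (A * PowerSeries.derivative ℝ c) := by
  intro n
  rw [PowerSeries.coeff_mul, Finset.mul_sum, ← Finset.sum_coe_sort]
  have h1 : ‖KleinGordon.lieSeries f g n‖ ≤
      ∑ x : Finset.HasAntidiagonal.antidiagonal n, ∑ _i : Fin (x.1.2 + 1),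
        ‖f (x.1.2 + 1)‖ * ‖g x.1.1‖ := by
    refine norm_sum_le_of_le _ fun x _ => norm_sum_le_of_le _ fun i _ => ?_
    rw [ContinuousMultilinearMap.norm_domDomCongr]
    exact norm_insertMap_le _ _ _
  refine (mul_le_mul_of_nonneg_right h1 (pow_nonneg hb.le n)).trans ?_
  rw [Finset.sum_mul]
  refine Finset.sum_le_sum fun x _ => ?_
  rw [Finset.sum_const, Finset.card_univ, Fintype.card_fin, nsmul_eq_mul,
    PowerSeries.coeff_derivative]
  have hx := Finset.HasAntidiagonal.mem_antidiagonal.1 x.2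
  have h2 := hf (x.1.2 + 1)
  have h3 := hg x.1.1
  -- The slot that g fills costs one power of b, which the constant b in the majorant of g makes up
  -- for.
  have hbn : b ^ n * b = b ^ (x.1.2 + 1) * b ^ x.1.1 := by
    have : ∀ q p n : ℕ, q + p = n → b ^ n * b = b ^ (p + 1) * b ^ q := by
      rintro q p n rfl
      ring
    exact this _ _ _ hx
  have h4 := mul_le_mul h2 h3 (by positivity)
    ((by positivity : 0 ≤ ‖f (x.1.2 + 1)‖ * b ^ (x.1.2 + 1)).trans h2)
  have h5 : ‖f (x.1.2 + 1)‖ * ‖g x.1.1‖ * b ^ n ≤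
      κ * PowerSeries.coeff (x.1.2 + 1) c * PowerSeries.coeff x.1.1 A := by
    refine le_of_mul_le_mul_right ?_ hb
    calc _ = ‖f (x.1.2 + 1)‖ * ‖g x.1.1‖ * (b ^ n * b) := by ring
      _ = ‖f (x.1.2 + 1)‖ * b ^ (x.1.2 + 1) * (‖g x.1.1‖ * b ^ x.1.1) := by rw [hbn]; ring
      _ ≤ _ := h4.trans (le_of_eq (by ring))
  have h6 := mul_le_mul_of_nonneg_left h5 (by positivity : (0 : ℝ) ≤ (x.1.2 : ℝ) + 1)
  push_cast
  linarith

theorem JointlyContinuous.lieSeries {T : Type*} [TopologicalSpace T]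
    {f : T → FormalMultilinearSeries ℝ E G} {g : T → FormalMultilinearSeries ℝ E E}
    (hf : JointlyContinuous f) (hg : JointlyContinuous g) :
    JointlyContinuous fun τ => lieSeries (f τ) (g τ) := by
  intro n
  simp only [lieSeries_apply]
  refine continuous_finsetSum _ fun x _ => continuous_finsetSum _ fun i _ => ?_
  have h1 : Continuous fun y : T × (Fin n → E) => g y.1 x.1.1 fun j => y.2
      (finCongr (Finset.HasAntidiagonal.mem_antidiagonal.1 x.2) (Fin.castAdd x.1.2 j)) :=
    (hg x.1.1).comp (continuous_fst.prodMk (continuous_pi fun j =>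
      (continuous_apply _).comp continuous_snd))
  have h2 : Continuous fun y : T × (Fin n → E) => fun j => y.2
      (finCongr (Finset.HasAntidiagonal.mem_antidiagonal.1 x.2) (Fin.natAdd x.1.1 j)) :=
    continuous_pi fun j => (continuous_apply _).comp continuous_snd
  exact (hf (x.1.2 + 1)).comp (continuous_fst.prodMk (h1.finInsertNth i h2))

theorem tsum_antidiagonal_apply [CompleteSpace G] [CompleteSpace E] {D : ℕ → E →L[ℝ] G}
    {y : ℕ → E} (hD : Summable fun p => ‖D p‖) (hy : Summable fun q => ‖y q‖) :
    ∑' n : ℕ, ∑ x : Finset.HasAntidiagonal.antidiagonal n, D x.1.2 (y x.1.1) =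
      ∑' p, D p (∑' q, y q) := by
  have hprod : Summable fun x : ℕ × ℕ => D x.2 (y x.1) := by
    refine Summable.of_norm_bounded (hy.mul_of_nonneg hD (fun _ => norm_nonneg _)
      fun _ => norm_nonneg _) fun x => ?_
    rw [mul_comm]
    exact (D x.2).le_opNorm _
  have hswap : Summable fun x : ℕ × ℕ => D x.1 (y x.2) := hprod.prod_symm
  have h1 : ∑' x : ℕ × ℕ, D x.2 (y x.1) = ∑' p, D p (∑' q, y q) := by
    rw [← (Equiv.prodComm ℕ ℕ).tsum_eq fun x : ℕ × ℕ => D x.2 (y x.1)]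
    exact hswap.tsum_prod.trans (tsum_congr fun p => ((D p).map_tsum hy.of_norm).symm)
  rw [← h1, ← (Finset.HasAntidiagonal.sigmaAntidiagonalEquivProd (A := ℕ)).tsum_eq
    fun x : ℕ × ℕ => D x.2 (y x.1)]
  have hsig : Summable fun z : Σ n : ℕ, Finset.HasAntidiagonal.antidiagonal n =>
      D z.2.1.2 (y z.2.1.1) :=
    (Finset.HasAntidiagonal.sigmaAntidiagonalEquivProd (A := ℕ)).summable_iff.2 hprod
  exact (hsig.tsum_sigma.trans (tsum_congr fun n => tsum_fintype _)).symm

theorem HasMajorant.hasSum_lieSeries [CompleteSpace G] [CompleteSpace E]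
    {f : FormalMultilinearSeries ℝ E G}
    {g : FormalMultilinearSeries ℝ E E} {b κ : ℝ} (hb : 0 < b) {c A : PowerSeries ℝ}
    (hc : IsEntire c) (hA : IsEntire A) (hf : HasMajorant f b κ c) (hg : HasMajorant g b b A)
    (φ : E) :
    (KleinGordon.lieSeries f g).sum φ =
      ∑' p, ∑ i, f (p + 1) (Function.update (fun _ => φ) i (g.sum φ)) := by
  set D : ℕ → E →L[ℝ] G := fun p => ∑ i, (f (p + 1)).toContinuousLinearMap (fun _ => φ) i with hD
  have hDa : ∀ p v, D p v = ∑ i, f (p + 1) (Function.update (fun _ => φ) i v) := fun p v => by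
    simp [hD, ContinuousMultilinearMap.toContinuousLinearMap]
  have hDn : ∀ p, ‖D p‖ ≤ ((p : ℝ) + 1) * ‖φ‖ ^ p * ‖f (p + 1)‖ := fun p => by
    refine ContinuousLinearMap.opNorm_le_bound _ (by positivity) fun v => ?_
    rw [hDa]
    refine (norm_sum_update_le f p φ v le_rfl).trans (le_of_eq (by ring))
  have hDs : Summable fun p => ‖D p‖ := by
    refine Summable.of_nonneg_of_le (fun _ => norm_nonneg _) (fun p => (hDn p).trans ?_)
      (((summable_nat_add_iff 1).2 (hc.summable ((‖φ‖ + 1) / b))).mul_left κ)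
    have h1 := succ_mul_pow_mul_le p (norm_nonneg φ) zero_le_one
    have h2 := hf.norm_mul_pow_le (z := (‖φ‖ + 1) / b) (by positivity) (p + 1)
    rw [mul_div_cancel₀ _ hb.ne'] at h2
    refine le_trans ?_ h2
    rw [mul_comm]
    refine mul_le_mul_of_nonneg_left ?_ (norm_nonneg _)
    linarith
  have hgs := hg.summable_norm hb hA φ
  simp only [← hDa]
  refine Eq.trans (tsum_congr fun n => ?_) (tsum_antidiagonal_apply hDs hgs)
  rw [lieSeries_apply]
  refine Finset.sum_congr rfl fun x _ => ?_
  rw [hDa]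
  simp only [insertNth_const]

/-- This links functionals with formal series: differentiating in a direction that varies with the
point amounts to inserting the series of g into the slots of f. The result is again an entire series
with a majorant, so that the operation can be iterated. -/
theorem HasMajorant.lineDeriv_eq [CompleteSpace G] [CompleteSpace E]
    {f : FormalMultilinearSeries ℝ E G}
    {g : FormalMultilinearSeries ℝ E E} {b κ : ℝ} (hb : 0 < b) {c A : PowerSeries ℝ}
    (hc : IsEntire c) (hA : IsEntire A) (hf : HasMajorant f b κ c) (hg : HasMajorant g b b A)
    (φ : E) : lineDeriv ℝ f.sum φ (g.sum φ) = (KleinGordon.lieSeries f g).sum φ := by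
  rw [hf.hasSum_lieSeries hb hc hA hg, ← (hf.hasDerivAt hb hc φ (g.sum φ)).deriv]
  rfl

end Series


/-! ### Integration over ordered times -/

theorem measurableSet_orderedTimes (k : ℕ) (t : ℝ) : MeasurableSet (orderedTimes k t) := by
  have h : orderedTimes k t = (⋂ i : Fin k, ⋂ j : Fin k, {τ | i < j → τ i < τ j}) ∩
      ⋂ i : Fin k, {τ | 0 < τ i ∧ τ i < t} := by
    ext τ
    simp [orderedTimes, StrictMono]
  rw [h]
  refine MeasurableSet.inter (MeasurableSet.iInter fun i => MeasurableSet.iInter fun j => ?_)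
    (MeasurableSet.iInter fun i => ?_)
  · by_cases hij : i < j
    · simpa [hij] using measurableSet_lt (measurable_pi_apply i) (measurable_pi_apply j)
    · simp [hij]
  · exact (measurableSet_lt measurable_const (measurable_pi_apply i)).inter
      (measurableSet_lt (measurable_pi_apply i) measurable_const)

theorem orderedTimes_subset (k : ℕ) (t : ℝ) :
    orderedTimes k t ⊆ Set.Icc (fun _ => 0) fun _ => t :=
  fun _ hτ => ⟨fun i => (hτ.2 i).1.le, fun i => (hτ.2 i).2.le⟩

theorem integrableOn_orderedTimes {F : Type*} [NormedAddCommGroup F] {k : ℕ}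
    {h : (Fin k → ℝ) → F} (hh : Continuous h) (t : ℝ) : IntegrableOn h (orderedTimes k t) :=
  (hh.continuousOn.integrableOn_compact isCompact_Icc).mono_set (orderedTimes_subset k t)

theorem snoc_mem_orderedTimes {k : ℕ} {t s : ℝ} {τ : Fin k → ℝ} :
    (Fin.snoc τ s : Fin (k + 1) → ℝ) ∈ orderedTimes (k + 1) t ↔
      s ∈ Set.Ioo 0 t ∧ τ ∈ orderedTimes k s := by
  constructor
  · rintro ⟨h1, h2⟩
    have hl := h2 (Fin.last k)
    rw [Fin.snoc_last] at hl
    refine ⟨hl, fun i j hij => ?_, fun i => ⟨?_, ?_⟩⟩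
    · simpa using h1 (Fin.castSucc_lt_castSucc_iff.2 hij)
    · simpa using (h2 i.castSucc).1
    · simpa using h1 (Fin.castSucc_lt_last i)
  · rintro ⟨hs, h1, h2⟩
    refine ⟨fun i j => ?_, fun i => ?_⟩
    · refine Fin.lastCases (fun h => ?_) (fun i' => ?_) i
      · exact absurd (Fin.le_last j) (not_le.2 h)
      · refine Fin.lastCases (fun _ => ?_) (fun j' h => ?_) j
        · simpa using (h2 i').2
        · simpa using h1 (Fin.castSucc_lt_castSucc_iff.1 h)
    · refine Fin.lastCases ?_ (fun i' => ?_) i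
      · simpa using hs
      · simpa using ⟨(h2 i').1, (h2 i').2.trans hs.2⟩

/-- The largest time is the last coordinate. Fubini with this time outermost leaves the simplex
below it, which yields a recursion whose derivative in t is explicit. -/
theorem integral_orderedTimes_succ {k : ℕ} {h : (Fin (k + 1) → ℝ) → ℝ} (hh : Continuous h)
    {t : ℝ} (ht : 0 ≤ t) :
    ∫ τ in orderedTimes (k + 1) t, h τ =
      ∫ s in (0 : ℝ)..t, ∫ τ in orderedTimes k s, h (Fin.snoc τ s) := by
  set e := MeasurableEquiv.piFinSuccAbove (fun _ : Fin (k + 1) => ℝ) (Fin.last k) with he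
  have hmp := (volume_preserving_piFinSuccAbove (fun _ : Fin (k + 1) => ℝ) (Fin.last k)).symm e
  have hes : ∀ x : ℝ × (Fin k → ℝ), e.symm x = Fin.snoc x.2 x.1 := fun x => by
    simp [he, MeasurableEquiv.piFinSuccAbove, Fin.insertNthEquiv, Fin.insertNth_last']
  have hint := (integrableOn_orderedTimes hh t)
  rw [← integrable_indicator_iff (measurableSet_orderedTimes _ _)] at hint
  rw [← integral_indicator (measurableSet_orderedTimes _ _),
    ← hmp.integral_comp e.symm.measurableEmbedding, Measure.volume_eq_prod, integral_prod,
    intervalIntegral.integral_of_le ht, integral_Ioc_eq_integral_Ioo, ← integral_indicator measurableSet_Ioo]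
  · refine integral_congr_ae (Filter.Eventually.of_forall fun s => ?_)
    have hm : ∀ τ, e.symm (s, τ) ∈ orderedTimes (k + 1) t ↔
        s ∈ Set.Ioo 0 t ∧ τ ∈ orderedTimes k s := fun τ => by
      rw [hes]
      exact snoc_mem_orderedTimes
    by_cases hs : s ∈ Set.Ioo 0 t
    · simp only [Set.indicator_of_mem hs, ← integral_indicator (measurableSet_orderedTimes k s)]
      refine integral_congr_ae (Filter.Eventually.of_forall fun τ => ?_)
      by_cases hτ : τ ∈ orderedTimes k s
      · beta_reduce
        rw [Set.indicator_of_mem hτ, Set.indicator_of_mem ((hm τ).2 ⟨hs, hτ⟩), hes]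
      · simp only [Set.indicator_of_notMem hτ,
          Set.indicator_of_notMem fun h => hτ ((hm τ).1 h).2]
    · simp only [Set.indicator_of_notMem hs]
      refine (integral_congr_ae (Filter.Eventually.of_forall fun τ => ?_)).trans (integral_zero _ _)
      exact Set.indicator_of_notMem (fun h => hs ((hm τ).1 h).1) _
  · rw [← Measure.volume_eq_prod]
    exact (hmp.integrable_comp_emb e.symm.measurableEmbedding).2 hint

section TimeOrdered

variable {E : Type*} [NormedAddCommGroup E] [NormedSpace ℝ E]

/-- The multilinear map `v ↦ ∫₀ᵗ f_s(v) ds`, for a family `f` which is only pointwise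
integrable. -/
def integralMap {p : ℕ} (f : ℝ → ContinuousMultilinearMap ℝ (fun _ : Fin p => E) ℝ) (t : ℝ) :
    ContinuousMultilinearMap ℝ (fun _ : Fin p => E) ℝ :=
  open Classical in
  if h : ∃ g : ContinuousMultilinearMap ℝ (fun _ : Fin p => E) ℝ,
    ∀ v, g v = ∫ s in (0 : ℝ)..t, f s v then h.choose else 0

/-- The factor |s|^k/k! integrates to |t|^{k+1}/(k+1)!, which is how the volume of the simplex
enters the bounds. Unordered intervals and absolute values cover both signs of t. -/
theorem norm_integral_pow_le {h : ℝ → ℝ} {K t : ℝ} (k : ℕ)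
    (hh : ∀ s ∈ Set.uIoc 0 t, |h s| ≤ |s| ^ k / k.factorial * K) :
    |∫ s in (0 : ℝ)..t, h s| ≤ |t| ^ (k + 1) / (k + 1).factorial * K := by
  have h1 := intervalIntegral.norm_integral_le_integral_norm_uIoc (f := h) (a := 0) (b := t)
    (μ := volume)
  have h2 : ∫ s in Set.uIoc 0 t, |s| ^ k = |t| ^ (k + 1) / ((k : ℝ) + 1) := by
    simpa using integral_pow_abs_sub_uIoc (a := 0) (b := t) (n := k)
  have h3 : ∫ s in Set.uIoc 0 t, ‖h s‖ ≤ ∫ s in Set.uIoc 0 t, |s| ^ k * (K / k.factorial) := by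
    refine integral_mono_of_nonneg (Filter.Eventually.of_forall fun _ => norm_nonneg _) ?_ ?_
    · have : Continuous fun s : ℝ => |s| ^ k * (K / k.factorial) := by fun_prop
      exact (this.integrableOn_uIcc).mono_set Set.uIoc_subset_uIcc
    · refine (ae_restrict_mem measurableSet_uIoc).mono fun s hs => ?_
      exact (hh s hs).trans (le_of_eq (by ring))
  rw [integral_mul_const, h2] at h3
  refine h1.trans (h3.trans (le_of_eq ?_))
  rw [Nat.factorial_succ]
  push_cast
  field_simp

/-- The free evolution is only strongly continuous, so the integral is taken for each argument
separately. The bound on the norms makes the result a continuous multilinear map, and the default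
value in `integralMap` does not occur. -/
theorem integralMap_apply {p : ℕ} {f : ℝ → ContinuousMultilinearMap ℝ (fun _ : Fin p => E) ℝ}
    (hc : ∀ v, Continuous fun s => f s v) {t C : ℝ} (k : ℕ)
    (hf : ∀ s ∈ Set.uIoc 0 t, ‖f s‖ ≤ |s| ^ k / k.factorial * C) (v : Fin p → E) :
    integralMap f t v = ∫ s in (0 : ℝ)..t, f s v := by
  have hi : ∀ v, IntervalIntegrable (fun s => f s v) volume 0 t := fun v =>
    (hc v).intervalIntegrable _ _
  have h : ∃ g : ContinuousMultilinearMap ℝ (fun _ : Fin p => E) ℝ,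
      ∀ v, g v = ∫ s in (0 : ℝ)..t, f s v := by
    refine ⟨MultilinearMap.mkContinuous
      { toFun := fun v => ∫ s in (0 : ℝ)..t, f s v
        map_update_add' := fun v i x y => ?_
        map_update_smul' := fun v i c x => ?_ } (|t| ^ (k + 1) / (k + 1).factorial * C)
      fun v => ?_, fun v => rfl⟩
    · simp only [ContinuousMultilinearMap.map_update_add]
      exact intervalIntegral.integral_add (hi _) (hi _)
    · simp only [ContinuousMultilinearMap.map_update_smul, smul_eq_mul]
      exact intervalIntegral.integral_const_mul _ _
    · rw [mul_assoc]
      refine norm_integral_pow_le k fun s hs => ?_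
      rw [← mul_assoc]
      exact ((f s).le_opNorm v).trans (mul_le_mul_of_nonneg_right (hf s hs)
        (Finset.prod_nonneg fun _ _ => norm_nonneg _))
  rw [integralMap, dif_pos h]
  exact h.choose_spec v

theorem norm_integralMap_le {p : ℕ} {f : ℝ → ContinuousMultilinearMap ℝ (fun _ : Fin p => E) ℝ}
    (hc : ∀ v, Continuous fun s => f s v) {t C : ℝ} (hC : 0 ≤ C) (k : ℕ)
    (hf : ∀ s ∈ Set.uIoc 0 t, ‖f s‖ ≤ |s| ^ k / k.factorial * C) :
    ‖integralMap f t‖ ≤ |t| ^ (k + 1) / (k + 1).factorial * C := by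
  refine ContinuousMultilinearMap.opNorm_le_bound (by positivity) fun v => ?_
  rw [integralMap_apply hc k hf, mul_assoc]
  refine norm_integral_pow_le k fun s hs => ?_
  rw [← mul_assoc]
  exact ((f s).le_opNorm v).trans (mul_le_mul_of_nonneg_right (hf s hs)
    (Finset.prod_nonneg fun _ _ => norm_nonneg _))

/-- The series of the products of the derivatives along the vector fields at the times `τ_i`. -/
def prodSeries (g : ℝ → FormalMultilinearSeries ℝ E E) (f : FormalMultilinearSeries ℝ E ℝ) :
    (k : ℕ) → (Fin k → ℝ) → FormalMultilinearSeries ℝ E ℝ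
  | 0, _ => f
  | k + 1, τ => lieSeries (prodSeries g f k fun i => τ i.castSucc) (g (τ (Fin.last k)))

/-- The series of the terms of the time ordered exponential, without their signs. -/
def texpSeries (g : ℝ → FormalMultilinearSeries ℝ E E) (f : FormalMultilinearSeries ℝ E ℝ) :
    ℕ → ℝ → FormalMultilinearSeries ℝ E ℝ
  | 0, _ => f
  | k + 1, t => fun p => integralMap (fun s => lieSeries (texpSeries g f k s) (g s) p) t

/-- A time dependent vector field with series `g` and a functional with series `f` satisfy the
bounds under which the time ordered exponential is defined. -/
structure IsAdmissible (g : ℝ → FormalMultilinearSeries ℝ E E)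
    (f : FormalMultilinearSeries ℝ E ℝ) (b κ : ℝ) (A : PowerSeries ℝ) : Prop where
  pos : 0 < b
  nonneg : 0 ≤ κ
  entire : IsEntire A
  nonnegCoeff : NonnegCoeff A
  continuous : JointlyContinuous g
  field : ∀ τ, HasMajorant (g τ) b b A
  init : HasMajorant f b κ PowerSeries.X

variable {g : ℝ → FormalMultilinearSeries ℝ E E} {f : FormalMultilinearSeries ℝ E ℝ} {b κ : ℝ}
  {A : PowerSeries ℝ}

theorem IsAdmissible.prodSeries_majorant (H : IsAdmissible g f b κ A) :
    ∀ k τ, HasMajorant (prodSeries g f k τ) b κ (lieIterate A k)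
  | 0, _ => H.init
  | k + 1, _ => (H.prodSeries_majorant k _).lieSeries H.pos (H.field _)

theorem IsAdmissible.prodSeries_continuous (H : IsAdmissible g f b κ A) :
    ∀ k, JointlyContinuous (prodSeries g f k)
  | 0 => fun p => (f p).cont.comp continuous_snd
  | k + 1 => by
    have h1 : JointlyContinuous fun τ : Fin (k + 1) → ℝ =>
        prodSeries g f k fun i => τ i.castSucc := fun p =>
      (H.prodSeries_continuous k p).comp
        (Continuous.prodMk (continuous_pi fun i => (continuous_apply _).comp continuous_fst)
          continuous_snd)
    have h2 : JointlyContinuous fun τ : Fin (k + 1) → ℝ => g (τ (Fin.last k)) := fun p =>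
      (H.continuous p).comp
        (Continuous.prodMk ((continuous_apply _).comp continuous_fst) continuous_snd)
    exact h1.lieSeries h2

theorem HasMajorant.norm_le {f : FormalMultilinearSeries ℝ E ℝ} {c : PowerSeries ℝ}
    (h : HasMajorant f b κ c) (hb : 0 < b) (p : ℕ) :
    ‖f p‖ ≤ κ * PowerSeries.coeff p c / b ^ p := by
  rw [le_div_iff₀ (pow_pos hb p)]
  exact h p

/-- Continuity and bound go through the induction together, because both are needed at stage k to
know that the integral defining stage k + 1 exists as a continuous multilinear map. -/
theorem IsAdmissible.texpSeries_aux (H : IsAdmissible g f b κ A) (k : ℕ) :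
    JointlyContinuous (texpSeries g f k) ∧
      ∀ t, HasMajorant (texpSeries g f k t) b (|t| ^ k / k.factorial * κ) (lieIterate A k) := by
  induction k with
  | zero => exact ⟨fun p => (f p).cont.comp continuous_snd, fun t => by
      simpa [lieIterate, texpSeries] using H.init⟩
  | succ k ih =>
    have hc := ih.1.lieSeries H.continuous
    have hm := fun s => (ih.2 s).lieSeries H.pos (H.field s)
    have hcv : ∀ p v, Continuous fun s => lieSeries (texpSeries g f k s) (g s) p v :=
      hc.continuous_eval
    have hn : ∀ p s, ‖lieSeries (texpSeries g f k s) (g s) p‖ ≤ |s| ^ k / k.factorial *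
        (κ * PowerSeries.coeff p (lieIterate A (k + 1)) / b ^ p) := fun p s =>
      ((hm s).norm_le H.pos p).trans (le_of_eq (by rw [lieIterate]; ring))
    have ha : ∀ t p v, texpSeries g f (k + 1) t p v =
        ∫ s in (0 : ℝ)..t, lieSeries (texpSeries g f k s) (g s) p v := fun t p v =>
      integralMap_apply (hcv p) k (fun s _ => hn p s) v
    refine ⟨fun p => ?_, fun t p => ?_⟩
    · simp only [ha]
      set F : ℝ × (Fin p → E) → ℝ :=
        fun y => lieSeries (texpSeries g f k y.1) (g y.1) p y.2 with hF
      have hFc : Continuous F := hc p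
      have hFc' : Continuous (Function.uncurry fun (x : ℝ × (Fin p → E)) (s : ℝ) =>
          F (s, x.2)) := by
        have : Continuous fun y : (ℝ × (Fin p → E)) × ℝ => F (y.2, y.1.2) := by fun_prop
        exact this
      exact intervalIntegral.continuous_parametric_intervalIntegral_of_continuous hFc'
        continuous_fst
    · have h1 := norm_integralMap_le (hcv p) (t := t) (div_nonneg (mul_nonneg H.nonneg
        (nonnegCoeff_lieIterate H.nonnegCoeff (k + 1) p)) (pow_nonneg H.pos.le p)) k
        (fun s _ => hn p s)
      rw [← mul_div_assoc, le_div_iff₀ (pow_pos H.pos p), ← mul_assoc] at h1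
      exact h1

theorem IsAdmissible.texpSeries_succ_apply (H : IsAdmissible g f b κ A) (k : ℕ) (t : ℝ) (p : ℕ)
    (v : Fin p → E) : texpSeries g f (k + 1) t p v =
      ∫ s in (0 : ℝ)..t, lieSeries (texpSeries g f k s) (g s) p v := by
  have ih := H.texpSeries_aux k
  exact integralMap_apply ((ih.1.lieSeries H.continuous).continuous_eval p) k
    (C := κ * PowerSeries.coeff p (lieIterate A (k + 1)) / b ^ p) (fun s _ =>
    (((ih.2 s).lieSeries H.pos (H.field s)).norm_le H.pos p).trans
      (le_of_eq (by rw [lieIterate]; ring))) v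

/-- `lieSeries` is a finite sum of evaluations of its first argument, so it commutes with the
integral over the inner times. The recursion in the outermost time therefore reproduces the integral
over the simplex. -/
theorem IsAdmissible.texpSeries_eq_integral (H : IsAdmissible g f b κ A) (k : ℕ) :
    ∀ {t : ℝ}, 0 ≤ t → ∀ (p : ℕ) (v : Fin p → E),
      texpSeries g f k t p v = ∫ τ in orderedTimes k t, prodSeries g f k τ p v := by
  induction k with
  | zero =>
    intro t _ p v
    have h : orderedTimes 0 t = Set.univ := by
      ext τ
      simp [orderedTimes, Subsingleton.strictMono]
    simp [h, texpSeries, prodSeries, Measure.volume_pi_eq_dirac (fun i : Fin 0 => i.elim0)]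
  | succ k ih =>
    intro t ht p v
    have hcp : Continuous fun τ => prodSeries g f (k + 1) τ p v :=
      (H.prodSeries_continuous (k + 1)).continuous_eval p v
    rw [H.texpSeries_succ_apply, integral_orderedTimes_succ hcp ht]
    refine intervalIntegral.integral_congr fun s hs => ?_
    rw [Set.uIcc_of_le ht] at hs
    simp only [prodSeries, Fin.snoc_castSucc, Fin.snoc_last,
      lieSeries_apply, ih hs.1]
    have hi : ∀ q (w : Fin q → E), IntegrableOn (fun τ => prodSeries g f k τ q w)
        (orderedTimes k s) := fun q w => integrableOn_orderedTimes
      ((H.prodSeries_continuous k).continuous_eval q w) s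
    rw [integral_finsetSum _ fun x _ => integrable_finsetSum _ fun i _ => hi _ _]
    refine Finset.sum_congr rfl fun x _ => ?_
    rw [integral_finsetSum _ fun i _ => hi _ _]

end TimeOrdered


/-! ### Sums of the time ordered exponential -/

section TimeOrderedSum

variable {E : Type*} [NormedAddCommGroup E] [NormedSpace ℝ E] [CompleteSpace E]
  {g : ℝ → FormalMultilinearSeries ℝ E E} {f : FormalMultilinearSeries ℝ E ℝ} {b κ : ℝ}
  {A : PowerSeries ℝ}

theorem IsAdmissible.texpSeries_continuous (H : IsAdmissible g f b κ A) (k : ℕ) :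
    JointlyContinuous (texpSeries g f k) :=
  (H.texpSeries_aux k).1

theorem IsAdmissible.texpSeries_majorant (H : IsAdmissible g f b κ A) (k : ℕ) (t : ℝ) :
    HasMajorant (texpSeries g f k t) b (|t| ^ k / k.factorial * κ) (lieIterate A k) :=
  (H.texpSeries_aux k).2 t

theorem IsAdmissible.lieSeries_majorant (H : IsAdmissible g f b κ A) (k : ℕ) (t : ℝ) :
    HasMajorant (lieSeries (texpSeries g f k t) (g t)) b (|t| ^ k / k.factorial * κ)
      (lieIterate A (k + 1)) :=
  (H.texpSeries_majorant k t).lieSeries H.pos (H.field t)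

theorem HasMajorant.mono_left {f : FormalMultilinearSeries ℝ E ℝ} {κ' : ℝ} {c : PowerSeries ℝ}
    (h : HasMajorant f b κ c) (hc : NonnegCoeff c) (hκ : κ ≤ κ') : HasMajorant f b κ' c :=
  fun p => (h p).trans (mul_le_mul_of_nonneg_right hκ (hc p))

/-- The majorant of the products does not depend on the times and the simplex has finite volume, so
the sum over degrees and the integral can be exchanged. -/
theorem IsAdmissible.texpSeries_sum_eq_integral (H : IsAdmissible g f b κ A) (k : ℕ) {t : ℝ}
    (ht : 0 ≤ t) (φ : E) :
    (texpSeries g f k t).sum φ = ∫ τ in orderedTimes k t, (prodSeries g f k τ).sum φ := by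
  have hi : ∀ p, IntegrableOn (fun τ => prodSeries g f k τ p fun _ => φ) (orderedTimes k t) :=
    fun p => integrableOn_orderedTimes ((H.prodSeries_continuous k).continuous_eval p _) t
  have hfin : volume (orderedTimes k t) < ⊤ :=
    (measure_mono (orderedTimes_subset k t)).trans_lt isCompact_Icc.measure_lt_top
  have hs : Summable fun p => ∫ τ in orderedTimes k t, ‖prodSeries g f k τ p fun _ => φ‖ := by
    refine Summable.of_nonneg_of_le (fun p => integral_nonneg fun _ => norm_nonneg _) (fun p => ?_)
      ((((isEntire_lieIterate H.entire k).summable (‖φ‖ / b)).mul_left κ).mul_left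
        (volume.real (orderedTimes k t)))
    have h1 := norm_setIntegral_le_of_norm_le_const (μ := volume)
      (f := fun τ => ‖prodSeries g f k τ p fun _ => φ‖) hfin
      (fun τ _ => by
        rw [norm_norm]
        exact (H.prodSeries_majorant k τ).norm_term_le (div_nonneg (norm_nonneg φ) H.pos.le)
          (norm_le_mul_div H.pos φ) p)
    rw [mul_comm]
    exact (Real.le_norm_self _).trans h1
  have h := hasSum_integral_of_summable_integral_norm hi hs
  simp only [← H.texpSeries_eq_integral k ht] at h
  exact h.tsum_eq

/-- The bounds grow with |t|, so a common majorant is available only on bounded time intervals; one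
around each point suffices. -/
theorem IsAdmissible.continuous_lieSeries_sum (H : IsAdmissible g f b κ A) (k : ℕ) :
    Continuous fun x : ℝ × E => (lieSeries (texpSeries g f k x.1) (g x.1)).sum x.2 := by
  rw [← continuousOn_univ]
  intro x _
  have h := ((H.texpSeries_continuous k).lieSeries H.continuous).continuousOn_sum H.pos
    (isEntire_lieIterate H.entire (k + 1)) (K := Set.Ioo (-(|x.1| + 1)) (|x.1| + 1))
    (κ := (|x.1| + 1) ^ k / k.factorial * κ) fun τ hτ =>
      (H.lieSeries_majorant k τ).mono_left (nonnegCoeff_lieIterate H.nonnegCoeff _)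
        (mul_le_mul_of_nonneg_right (div_le_div_of_nonneg_right
          (pow_le_pow_left₀ (abs_nonneg _) (abs_lt.2 hτ).le _) (by positivity)) H.nonneg)
  have hx : x ∈ Set.Ioo (-(|x.1| + 1)) (|x.1| + 1) ×ˢ (Set.univ : Set E) :=
    ⟨abs_lt.1 (lt_add_one _), trivial⟩
  exact (h.continuousAt ((isOpen_Ioo.prod isOpen_univ).mem_nhds hx)).continuousWithinAt

theorem IsAdmissible.texpSeries_succ_sum (H : IsAdmissible g f b κ A) (k : ℕ) (t : ℝ) (φ : E) :
    (texpSeries g f (k + 1) t).sum φ =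
      ∫ s in (0 : ℝ)..t, (lieSeries (texpSeries g f k s) (g s)).sum φ := by
  have hc : ∀ p, Continuous fun s => lieSeries (texpSeries g f k s) (g s) p fun _ => φ := fun p =>
    ((H.texpSeries_continuous k).lieSeries H.continuous).continuous_eval p _
  have hz : 0 ≤ ‖φ‖ / b := div_nonneg (norm_nonneg φ) H.pos.le
  have hS := ((isEntire_lieIterate H.entire (k + 1)).summable (‖φ‖ / b)).mul_left
    (|t| ^ k / k.factorial * κ)
  have h := intervalIntegral.hasSum_integral_of_dominated_convergence (μ := volume) (a := 0)
    (b := t) (F := fun p s => lieSeries (texpSeries g f k s) (g s) p fun _ => φ)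
    (f := fun s => (lieSeries (texpSeries g f k s) (g s)).sum φ)
    (fun p _ => |t| ^ k / k.factorial * κ *
      (PowerSeries.coeff p (lieIterate A (k + 1)) * (‖φ‖ / b) ^ p))
    (fun p => (hc p).aestronglyMeasurable)
    (fun p => Filter.Eventually.of_forall fun s hs => ?_)
    (Filter.Eventually.of_forall fun s _ => hS)
    (by simp) (Filter.Eventually.of_forall fun s _ => ?_)
  · simp only [← H.texpSeries_succ_apply] at h
    exact h.tsum_eq
  · have hs' : |s| ≤ |t| := by
      rcases Set.mem_uIoc.1 hs with h | h
      · exact abs_le_abs_of_nonneg h.1.le h.2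
      · exact abs_le_abs_of_nonpos h.2 h.1.le
    exact ((H.lieSeries_majorant k s).mono_left (nonnegCoeff_lieIterate H.nonnegCoeff _)
      (mul_le_mul_of_nonneg_right (div_le_div_of_nonneg_right
        (pow_le_pow_left₀ (abs_nonneg _) hs' _) (by positivity)) H.nonneg)).norm_term_le hz
      (norm_le_mul_div H.pos φ) p
  · exact ((H.lieSeries_majorant k s).summable_norm H.pos
      (isEntire_lieIterate H.entire _) φ).of_norm.hasSum

theorem IsAdmissible.prodSeries_lineDeriv (H : IsAdmissible g f b κ A) (k : ℕ)
    (τ : Fin (k + 1) → ℝ) (φ : E) :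
    lineDeriv ℝ (prodSeries g f k fun i => τ i.castSucc).sum φ ((g (τ (Fin.last k))).sum φ) =
      (prodSeries g f (k + 1) τ).sum φ :=
  (H.prodSeries_majorant k _).lineDeriv_eq H.pos (isEntire_lieIterate H.entire k) H.entire
    (H.field _) φ

/-! ### The conservation law along an integral curve -/

/-- The interval of integration shrinks to t as r tends to t, so the dependence of the integrand on
Ψ(r) contributes nothing to first order and mere continuity of Ψ is enough. -/
theorem hasDerivAt_integral_comp {h : ℝ × E → ℝ} (hh : Continuous h) {Ψ : ℝ → E} {t : ℝ}
    (hΨ : ContinuousAt Ψ t) :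
    HasDerivAt (fun r => ∫ s in t..r, h (s, Ψ r)) (h (t, Ψ t)) t := by
  rw [hasDerivAt_iff_isLittleO, Asymptotics.isLittleO_iff]
  intro c hc
  have h1 : ContinuousAt (fun x : ℝ × ℝ => h (x.1, Ψ x.2)) (t, t) :=
    hh.continuousAt.comp (continuousAt_fst.prodMk
      (ContinuousAt.comp (f := Prod.snd) (x := (t, t)) hΨ continuousAt_snd))
  obtain ⟨δ, hδ, hb⟩ := Metric.continuousAt_iff.1 h1 c hc
  filter_upwards [Metric.ball_mem_nhds t hδ] with r hr
  rw [intervalIntegral.integral_same, sub_zero, smul_eq_mul]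
  have e : (∫ s in t..r, h (s, Ψ r)) - (r - t) * h (t, Ψ t) =
      ∫ s in t..r, (h (s, Ψ r) - h (t, Ψ t)) := by
    rw [intervalIntegral.integral_sub, intervalIntegral.integral_const, smul_eq_mul]
    · exact Continuous.intervalIntegrable (by fun_prop) _ _
    · exact continuous_const.intervalIntegrable _ _
  rw [e, Real.norm_eq_abs (r - t)]
  refine intervalIntegral.norm_integral_le_of_norm_le_const fun s hs => ?_
  have hs' : |s - t| ≤ |r - t| := by
    rcases Set.mem_uIoc.1 hs with h | h
    · rw [abs_of_pos (by linarith), abs_of_pos (by linarith)]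
      linarith
    · rw [abs_of_nonpos (by linarith), abs_of_neg (by linarith)]
      linarith
  have hr' : |r - t| < δ := by simpa [Real.dist_eq] using hr
  have := hb (x := (s, r)) (by
    rw [Prod.dist_eq, max_lt_iff, Real.dist_eq, Real.dist_eq]
    exact ⟨hs'.trans_lt hr', hr'⟩)
  rw [Real.dist_eq] at this
  exact this.le

theorem IsAdmissible.hasDerivAt_comp (H : IsAdmissible g f b κ A) (k : ℕ) (s : ℝ) {Ψ : ℝ → E}
    {t : ℝ} (hΨ : HasDerivAt Ψ ((g t).sum (Ψ t)) t) :
    HasDerivAt (fun r => (texpSeries g f k s).sum (Ψ r))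
      ((lieSeries (texpSeries g f k s) (g t)).sum (Ψ t)) t := by
  have hm := H.texpSeries_majorant k s
  have hd := (hm.differentiable H.pos (isEntire_lieIterate H.entire k) (Ψ t)).hasFDerivAt
  refine (hd.comp_hasDerivAt t hΨ).congr_deriv ?_
  rw [← hm.lineDeriv_eq H.pos (isEntire_lieIterate H.entire k) H.entire (H.field t)]
  exact (hd.hasLineDerivAt _).lineDeriv.symm

/-- The partial sums of the time ordered exponential along a curve. -/
def texpPartial (g : ℝ → FormalMultilinearSeries ℝ E E) (f : FormalMultilinearSeries ℝ E ℝ)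
    (Ψ : ℝ → E) (K : ℕ) (t : ℝ) : ℝ :=
  ∑ k ∈ Finset.range (K + 1), (-1) ^ k * (texpSeries g f k t).sum (Ψ t)

/-- Telescoping: the time derivative of the term of order K + 1 is the Lie derivative of the term of
order K, and its sign is opposite to that of the quantity left over at stage K. Only the Lie
derivative of the newest term survives. -/
theorem IsAdmissible.hasDerivAt_texpPartial (H : IsAdmissible g f b κ A) {Ψ : ℝ → E}
    {t : ℝ} (hΨ : HasDerivAt Ψ ((g t).sum (Ψ t)) t) (K : ℕ) :
    HasDerivAt (texpPartial g f Ψ K)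
      ((-1) ^ K * (lieSeries (texpSeries g f K t) (g t)).sum (Ψ t)) t := by
  induction K with
  | zero =>
    have h := H.hasDerivAt_comp 0 0 hΨ
    have e : texpPartial g f Ψ 0 = fun r => f.sum (Ψ r) := by
      funext r
      simp [texpPartial, texpSeries]
    rw [e]
    simpa [texpSeries] using h
  | succ K ih =>
    have h1 : HasDerivAt (fun r => (texpSeries g f (K + 1) r).sum (Ψ r))
        ((lieSeries (texpSeries g f K t) (g t)).sum (Ψ t) +
          (lieSeries (texpSeries g f (K + 1) t) (g t)).sum (Ψ t)) t := by
      have hc := H.continuous_lieSeries_sum K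
      -- The term at time r is its value at the fixed time t plus the integral over [t, r]. The
      -- first part is differentiated by the chain rule along Ψ, the second through its upper limit.
      have h2 := (hasDerivAt_integral_comp hc hΨ.continuousAt).add (H.hasDerivAt_comp (K + 1) t hΨ)
      refine h2.congr_of_eventuallyEq (Filter.Eventually.of_forall fun r => ?_)
      simp only [Pi.add_apply, H.texpSeries_succ_sum]
      rw [add_comm, intervalIntegral.integral_add_adjacent_intervals] <;>
        exact Continuous.intervalIntegrable
          (hc.comp (continuous_id.prodMk continuous_const)) _ _
    have h3 := ih.add (h1.const_mul ((-1) ^ (K + 1)))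
    refine (h3.congr_of_eventuallyEq (Filter.Eventually.of_forall fun r => ?_)).congr_deriv ?_
    · simp [texpPartial, Finset.sum_range_succ _ (K + 1)]
    · ring

theorem IsAdmissible.summable_texpSeries_sum (H : IsAdmissible g f b κ A) {t ζ B : ℝ}
    (ht : 0 ≤ t) (hζ : 0 ≤ ζ)
    (hB : ∀ K, ∑ k ∈ Finset.range (K + 1),
      t ^ k / k.factorial * evalSeries (lieIterate A k) ζ ≤ B) :
    Summable fun k => t ^ k / k.factorial * evalSeries (lieIterate A k) ζ := by
  have hn : ∀ k, 0 ≤ t ^ k / k.factorial * evalSeries (lieIterate A k) ζ := fun k =>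
    mul_nonneg (by positivity) ((nonnegCoeff_lieIterate H.nonnegCoeff k).evalSeries_nonneg hζ)
  refine summable_of_sum_range_le (c := B) hn fun K => ?_
  refine le_trans ?_ (hB K)
  exact Finset.sum_le_sum_of_subset_of_nonneg (Finset.range_mono (Nat.le_succ K))
    fun k _ _ => hn k

/-- The partial sums differ from f(Ψ(0)) by the time integral of the remainder in the telescoped
derivative. Up to a constant factor the remainder is bounded by a term of a convergent series with
sum at most B, hence it tends to 0 at each time and is uniformly bounded, and dominated convergence
applies. -/
theorem IsAdmissible.conservation (H : IsAdmissible g f b κ A) {Ψ : ℝ → E} {z : ℝ → ℝ}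
    {T M B ε : ℝ} (hT : 0 ≤ T) (hε : 0 < ε)
    (hΨ : ∀ t ∈ Set.Icc 0 T, HasDerivAt Ψ ((g t).sum (Ψ t)) t)
    (hz : ∀ t ∈ Set.Icc 0 T, ‖Ψ t‖ ≤ b * z t ∧ 0 ≤ z t ∧ z t ≤ M)
    (hB : ∀ t ∈ Set.Icc 0 T, ∀ K, ∑ k ∈ Finset.range (K + 1),
      t ^ k / k.factorial * evalSeries (lieIterate A k) (z t + ε) ≤ B) :
    ∑' k, (-1) ^ k * (texpSeries g f k T).sum (Ψ T) = f.sum (Ψ 0) := by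
  set R : ℕ → ℝ → ℝ := fun K t => (lieSeries (texpSeries g f K t) (g t)).sum (Ψ t) with hR
  have hΨc : ContinuousOn Ψ (Set.Icc 0 T) := fun t ht => (hΨ t ht).continuousAt.continuousWithinAt
  have hRc : ∀ K, ContinuousOn (fun t => (-1 : ℝ) ^ K * R K t) (Set.uIcc 0 T) := fun K => by
    rw [Set.uIcc_of_le hT]
    exact ((H.continuous_lieSeries_sum K).comp_continuousOn
      (continuousOn_id.prodMk hΨc)).const_mul _
  have hC : ∀ k, NonnegCoeff (lieIterate A k) := nonnegCoeff_lieIterate H.nonnegCoeff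
  have hM : 0 ≤ evalSeries A M := H.nonnegCoeff.evalSeries_nonneg
    ((hz 0 ⟨le_rfl, hT⟩).2.1.trans (hz 0 ⟨le_rfl, hT⟩).2.2)
  -- The remainder is majorized by A(z) times the derivative of the K-th iterate at z. The
  -- derivative is replaced by the iterate itself at z + ε at the cost of 1/ε, and A(z) by A(M).
  have hRb : ∀ t ∈ Set.Icc 0 T, ∀ K, |R K t| ≤ κ * evalSeries A M / ε *
      (t ^ K / K.factorial * evalSeries (lieIterate A K) (z t + ε)) := by
    intro t ht K
    obtain ⟨h1, h2, h3⟩ := hz t ht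
    have h4 := (H.lieSeries_majorant K t).norm_sum_le (isEntire_lieIterate H.entire _) h2 h1
    rw [abs_of_nonneg ht.1, evalSeries_lieIterate_succ H.entire] at h4
    have h5 := (hC K).deriv_mul_le (isEntire_lieIterate H.entire K) h2 hε.le
    have h6 := H.nonnegCoeff.evalSeries_mono H.entire h2 h3
    have h7 : evalSeries (PowerSeries.derivative ℝ (lieIterate A K)) (z t) ≤
        evalSeries (lieIterate A K) (z t + ε) / ε := by
      rwa [le_div_iff₀ hε]
    have h8 := mul_le_mul h6 h7 ((hC K).deriv.evalSeries_nonneg h2) hM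
    refine h4.trans ((mul_le_mul_of_nonneg_left h8
      (mul_nonneg (by have := ht.1; positivity) H.nonneg)).trans (le_of_eq ?_))
    ring
  have hsum : ∀ t ∈ Set.Icc 0 T, Summable fun k : ℕ =>
      t ^ k / k.factorial * evalSeries (lieIterate A k) (z t + ε) := fun t ht =>
    H.summable_texpSeries_sum ht.1 (by linarith [(hz t ht).2.1]) (hB t ht)
  have hlim : Filter.Tendsto (fun K => ∫ t in (0 : ℝ)..T, (-1 : ℝ) ^ K * R K t) Filter.atTop
      (nhds 0) := by
    suffices h : Filter.Tendsto (fun K => ∫ t in (0 : ℝ)..T, (-1 : ℝ) ^ K * R K t) Filter.atTop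
        (nhds (∫ t in (0 : ℝ)..T, (0 : ℝ))) by simpa using h
    refine intervalIntegral.tendsto_integral_filter_of_dominated_convergence
      (fun _ => κ * evalSeries A M / ε * B) (Filter.Eventually.of_forall fun K => ?_)
      (Filter.Eventually.of_forall fun K => Filter.Eventually.of_forall fun t ht => ?_)
      (by simp) (Filter.Eventually.of_forall fun t ht => ?_)
    · exact ((hRc K).mono Set.uIoc_subset_uIcc).aestronglyMeasurable measurableSet_uIoc
    · rw [Set.uIoc_of_le hT] at ht
      have ht' := Set.Ioc_subset_Icc_self ht
      rw [norm_mul, norm_pow, norm_neg, norm_one, one_pow, one_mul]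
      refine (hRb t ht' K).trans (mul_le_mul_of_nonneg_left ?_
        (div_nonneg (mul_nonneg H.nonneg hM) hε.le))
      refine le_trans ?_ (hB t ht' K)
      exact Finset.single_le_sum (f := fun k : ℕ =>
        t ^ k / k.factorial * evalSeries (lieIterate A k) (z t + ε)) (fun k _ =>
          mul_nonneg (by have := ht'.1; positivity)
            ((hC k).evalSeries_nonneg (by linarith [(hz t ht').2.1]))) (by simp)
    · rw [Set.uIoc_of_le hT] at ht
      have ht' := Set.Ioc_subset_Icc_self ht
      refine squeeze_zero_norm (fun K => ?_) (by
        simpa using (hsum t ht').tendsto_atTop_zero.const_mul (κ * evalSeries A M / ε))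
      rw [norm_mul, norm_pow, norm_neg, norm_one, one_pow, one_mul]
      exact hRb t ht' K
  have hftc : ∀ K, texpPartial g f Ψ K T = f.sum (Ψ 0) +
      ∫ t in (0 : ℝ)..T, (-1 : ℝ) ^ K * R K t := fun K => by
    rw [intervalIntegral.integral_eq_sub_of_hasDerivAt (f := texpPartial g f Ψ K) (fun t ht => ?_)
      (hRc K).intervalIntegrable]
    · have h0 : texpPartial g f Ψ K 0 = f.sum (Ψ 0) := by
        rw [texpPartial, Finset.sum_range_succ']
        simp only [H.texpSeries_succ_sum]
        simp [texpSeries]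
      rw [h0]
      ring
    · rw [Set.uIcc_of_le hT] at ht
      exact H.hasDerivAt_texpPartial (hΨ t ht) K
  have hs : Summable fun k => (-1) ^ k * (texpSeries g f k T).sum (Ψ T) := by
    have hT' : T ∈ Set.Icc 0 T := ⟨hT, le_rfl⟩
    refine Summable.of_norm_bounded ((hsum T hT').mul_left κ) fun k => ?_
    obtain ⟨h1, h2, h3⟩ := hz T hT'
    rw [norm_mul, norm_pow, norm_neg, norm_one, one_pow, one_mul]
    refine ((H.texpSeries_majorant k T).norm_sum_le (isEntire_lieIterate H.entire k)
      (z := z T + ε) (by linarith) (h1.trans (mul_le_mul_of_nonneg_left (by linarith)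
        H.pos.le))).trans (le_of_eq ?_)
    rw [abs_of_nonneg hT]
    ring
  have ht1 := (Filter.tendsto_add_atTop_iff_nat 1).2 hs.hasSum.tendsto_sum_nat
  have ht2 : Filter.Tendsto (fun K => texpPartial g f Ψ K T) Filter.atTop
      (nhds (f.sum (Ψ 0) + 0)) := by
    simp only [hftc]
    exact hlim.const_add _
  rw [add_zero] at ht2
  exact tendsto_nhds_unique ht1 ht2

/-! ### The series of the time ordered exponential -/

/-- The series of the time ordered exponential. -/
def totalSeries (g : ℝ → FormalMultilinearSeries ℝ E E) (f : FormalMultilinearSeries ℝ E ℝ)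
    (t : ℝ) : FormalMultilinearSeries ℝ E ℝ :=
  fun p => ∑' k : ℕ, (-1 : ℝ) ^ k • texpSeries g f k t p

/-- Neither z nor A has a constant term, so no iterate (A d/dz)^k z has one, and the majorant kills
the part of degree zero. -/
theorem IsAdmissible.texpSeries_apply_zero (H : IsAdmissible g f b κ A)
    (hA : PowerSeries.coeff 0 A = 0) (k : ℕ) (t : ℝ) : texpSeries g f k t 0 = 0 := by
  have h := H.texpSeries_majorant k t 0
  have hc : PowerSeries.coeff 0 (lieIterate A k) = 0 := by
    cases k with
    | zero => simp [lieIterate]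
    | succ k =>
      rw [PowerSeries.coeff_zero_eq_constantCoeff_apply] at hA ⊢
      rw [lieIterate, map_mul, hA, zero_mul]
  rw [hc, mul_zero, pow_zero, mul_one] at h
  exact norm_le_zero_iff.1 h

theorem IsAdmissible.totalSeries_apply_zero (H : IsAdmissible g f b κ A)
    (hA : PowerSeries.coeff 0 A = 0) (t : ℝ) : totalSeries g f t 0 = 0 := by
  simp [totalSeries, H.texpSeries_apply_zero hA]

/-- Absolute summability in the order k and the degree p jointly. It makes the coefficients of
`totalSeries` convergent sums over k, and it permits summing over k or over p first. -/
theorem IsAdmissible.summable_terms (H : IsAdmissible g f b κ A) {t ζ : ℝ}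
    (ht : 0 ≤ t) (hζ : 0 ≤ ζ)
    (hB : Summable fun k => t ^ k / k.factorial * evalSeries (lieIterate A k) ζ) :
    Summable fun x : ℕ × ℕ => ‖texpSeries g f x.1 t x.2‖ * (b * ζ) ^ x.2 := by
  have hb := H.pos
  have hle : ∀ k p, ‖texpSeries g f k t p‖ * (b * ζ) ^ p ≤ t ^ k / k.factorial * κ *
      (PowerSeries.coeff p (lieIterate A k) * ζ ^ p) := fun k p => by
    have := (H.texpSeries_majorant k t).norm_mul_pow_le hζ p
    rwa [abs_of_nonneg ht] at this
  have hs : ∀ k, Summable fun p => ‖texpSeries g f k t p‖ * (b * ζ) ^ p := fun k =>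
    Summable.of_nonneg_of_le (fun p => by positivity) (hle k)
      (((isEntire_lieIterate H.entire k).summable ζ).mul_left _)
  refine (summable_prod_of_nonneg fun x => by positivity).2 ⟨hs, ?_⟩
  refine Summable.of_nonneg_of_le (fun k => tsum_nonneg fun p => by positivity) (fun k => ?_)
    (hB.mul_left κ)
  refine ((hs k).tsum_le_tsum (hle k)
    (((isEntire_lieIterate H.entire k).summable ζ).mul_left _)).trans (le_of_eq ?_)
  rw [tsum_mul_left, evalSeries]
  ring

theorem IsAdmissible.summable_totalSeries (H : IsAdmissible g f b κ A) {t ζ : ℝ}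
    (ht : 0 ≤ t) (hζ : 0 < ζ)
    (hB : Summable fun k => t ^ k / k.factorial * evalSeries (lieIterate A k) ζ) :
    Summable fun p => ‖totalSeries g f t p‖ * (b * ζ) ^ p := by
  have hb := H.pos
  have h1 := (H.summable_terms ht hζ.le hB).prod_symm
  have h2 : Summable fun p => ∑' k, ‖texpSeries g f k t p‖ * (b * ζ) ^ p := h1.prod
  refine Summable.of_nonneg_of_le (fun p => by positivity) (fun p => ?_) h2
  have h3 := h1.prod_factor p
  simp only [Prod.swap_prod_mk] at h3
  have h4 : Summable fun k => ‖texpSeries g f k t p‖ :=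
    (summable_mul_right_iff (pow_pos (mul_pos hb hζ) p).ne').1 h3
  rw [tsum_mul_right]
  refine mul_le_mul_of_nonneg_right ?_ (by positivity)
  refine tsum_of_norm_bounded h4.hasSum fun k => ?_
  rw [norm_smul, norm_pow, norm_neg, norm_one, one_pow, one_mul]

theorem IsAdmissible.hasSum_totalSeries (H : IsAdmissible g f b κ A) {t ζ : ℝ}
    (ht : 0 ≤ t) (hζ : 0 < ζ)
    (hB : Summable fun k => t ^ k / k.factorial * evalSeries (lieIterate A k) ζ) {φ : E}
    (hφ : ‖φ‖ ≤ b * ζ) :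
    HasSum (fun p => totalSeries g f t p fun _ => φ)
      (∑' k, (-1) ^ k * (texpSeries g f k t).sum φ) := by
  have hb := H.pos
  have h0 := H.summable_terms ht hζ.le hB
  have h1 : Summable fun x : ℕ × ℕ => (-1 : ℝ) ^ x.1 * texpSeries g f x.1 t x.2 fun _ => φ := by
    refine Summable.of_norm_bounded h0 fun x => ?_
    rw [norm_mul, norm_pow, norm_neg, norm_one, one_pow, one_mul]
    exact (norm_diag_le _ _ _).trans (mul_le_mul_of_nonneg_left
      (pow_le_pow_left₀ (norm_nonneg _) hφ _) (norm_nonneg _))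
  have h2 : ∀ p, totalSeries g f t p (fun _ => φ) =
      ∑' k, (-1 : ℝ) ^ k * texpSeries g f k t p fun _ => φ := fun p => by
    have h3 := h0.prod_symm.prod_factor p
    simp only [Prod.swap_prod_mk] at h3
    have h4 : Summable fun k => ‖texpSeries g f k t p‖ :=
      (summable_mul_right_iff (pow_pos (mul_pos hb hζ) p).ne').1 h3
    have h5 : Summable fun k => (-1 : ℝ) ^ k • texpSeries g f k t p := by
      refine Summable.of_norm_bounded h4 fun k => ?_
      rw [norm_smul, norm_pow, norm_neg, norm_one, one_pow, one_mul]
    exact (ContinuousMultilinearMap.apply ℝ (fun _ : Fin p => E) ℝ fun _ => φ).map_tsum h5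
  have h6 : ∑' k, (-1) ^ k * (texpSeries g f k t).sum φ =
      ∑' p, totalSeries g f t p fun _ => φ := by
    simp only [h2]
    rw [h1.tsum_comm' h1.prod_factor fun p => h1.prod_symm.prod_factor p]
    exact tsum_congr fun k => tsum_mul_left.symm
  rw [h6]
  refine Summable.hasSum ?_
  simp only [h2]
  exact h1.prod_symm.prod

end TimeOrderedSum


/-! ### The Fourier side of Sobolev spaces -/

section FourierSide

variable {n : ℕ} {m : ℝ}

/-- Square integrable functions of the frequency. -/
abbrev L2 (n : ℕ) : Type := Lp ℂ 2 (volume : Measure (Space n))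

/-- The real symbol `ε(ξ)^s`. -/
def epsReal (n : ℕ) (m s : ℝ) (ξ : Space n) : ℝ :=
  (m ^ 2 + (2 * Real.pi * ‖ξ‖) ^ 2) ^ (s / 2)

theorem epsPow_apply (s : ℝ) (ξ : Space n) : epsPow n m s ξ = (epsReal n m s ξ : ℂ) := rfl

theorem epsReal_neg (s : ℝ) (ξ : Space n) : epsReal n m s (-ξ) = epsReal n m s ξ := by
  simp [epsReal]

/-- A bounded continuous symbol which preserves the Hermitian symmetry. -/
structure IsSymbol (q : Space n → ℂ) (C : ℝ) : Prop where
  continuous : Continuous q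
  bound : ∀ ξ, ‖q ξ‖ ≤ C
  symm : ∀ ξ, q (-ξ) = starRingEnd ℂ (q ξ)

theorem IsSymbol.memLp {q : Space n → ℂ} {C : ℝ} (hq : IsSymbol q C) :
    MemLp q ⊤ (volume : Measure (Space n)) :=
  memLp_top_of_bound hq.continuous.aestronglyMeasurable C (Filter.Eventually.of_forall hq.bound)

theorem coeFn_toLp_smul {q : Space n → ℂ} (h : MemLp q ⊤ (volume : Measure (Space n)))
    (g : L2 n) : ∀ᵐ ξ, (h.toLp q • g : L2 n) ξ = q ξ * g ξ := by
  filter_upwards [Lp.coeFn_lpSMul (r := 2) (h.toLp q) g, h.coeFn_toLp] with ξ h1 h2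
  rw [h1, Pi.smul_apply', h2, smul_eq_mul]

/-- Multiplication by a bounded function. -/
def mulL2 (q : Space n → ℂ) : L2 n →L[ℂ] L2 n :=
  open Classical in
  if h : MemLp q ⊤ (volume : Measure (Space n)) then
    LinearMap.mkContinuous
      { toFun := fun g => h.toLp q • g
        map_add' := fun g g' => by
          refine Lp.ext ?_
          filter_upwards [coeFn_toLp_smul h (g + g'), coeFn_toLp_smul h g, coeFn_toLp_smul h g',
            Lp.coeFn_add g g', Lp.coeFn_add (h.toLp q • g : L2 n) (h.toLp q • g' : L2 n)]
            with ξ h1 h2 h3 h4 h5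
          rw [h1, h5, h4, Pi.add_apply, Pi.add_apply, h2, h3, mul_add]
        map_smul' := fun c g => by
          refine Lp.ext ?_
          filter_upwards [coeFn_toLp_smul h (c • g), coeFn_toLp_smul h g,
            Lp.coeFn_smul c g, Lp.coeFn_smul c (h.toLp q • g : L2 n)] with ξ h1 h2 h3 h4
          rw [h1, RingHom.id_apply, h4, h3, Pi.smul_apply, Pi.smul_apply, h2, smul_eq_mul,
            smul_eq_mul, mul_left_comm] } ‖h.toLp q‖
      fun g => Lp.norm_smul_le _ g
  else 0

theorem IsSymbol.mulL2_eq {q : Space n → ℂ} {C : ℝ} (hq : IsSymbol q C) (g : L2 n) :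
    mulL2 q g = hq.memLp.toLp q • g := by
  rw [mulL2, dif_pos hq.memLp]
  rfl

theorem IsSymbol.coeFn_mulL2 {q : Space n → ℂ} {C : ℝ} (hq : IsSymbol q C) (g : L2 n) :
    ∀ᵐ ξ, mulL2 q g ξ = q ξ * g ξ := by
  rw [hq.mulL2_eq]
  exact coeFn_toLp_smul hq.memLp g

theorem IsSymbol.norm_mulL2_le {q : Space n → ℂ} {C : ℝ} (hq : IsSymbol q C) (g : L2 n) :
    ‖mulL2 q g‖ ≤ C * ‖g‖ := by
  refine Lp.norm_le_mul_norm_of_ae_le_mul ?_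
  filter_upwards [hq.coeFn_mulL2 g] with ξ h
  rw [h, norm_mul]
  exact mul_le_mul_of_nonneg_right (hq.bound ξ) (norm_nonneg _)

theorem IsSymbol.mul {q r : Space n → ℂ} {C D : ℝ} (hq : IsSymbol q C) (hr : IsSymbol r D) :
    IsSymbol (fun ξ => q ξ * r ξ) (C * D) :=
  ⟨hq.continuous.mul hr.continuous, fun ξ => by
    rw [norm_mul]
    exact mul_le_mul (hq.bound ξ) (hr.bound ξ) (norm_nonneg _)
      ((norm_nonneg _).trans (hq.bound ξ)), fun ξ => by
    rw [hq.symm, hr.symm, map_mul]⟩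

theorem mulL2_mulL2 {q r p : Space n → ℂ} {C D B : ℝ} (hq : IsSymbol q C) (hr : IsSymbol r D)
    (hp : IsSymbol p B) (h : ∀ ξ, q ξ * r ξ = p ξ) (g : L2 n) :
    mulL2 q (mulL2 r g) = mulL2 p g := by
  refine Lp.ext ?_
  filter_upwards [hq.coeFn_mulL2 (mulL2 r g), hr.coeFn_mulL2 g, hp.coeFn_mulL2 g] with ξ h1 h2 h3
  rw [h1, h2, h3, ← h, mul_assoc]

theorem mulL2_comm {q r : Space n → ℂ} {C D : ℝ} (hq : IsSymbol q C) (hr : IsSymbol r D)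
    (g : L2 n) : mulL2 q (mulL2 r g) = mulL2 r (mulL2 q g) := by
  rw [mulL2_mulL2 hq hr (hq.mul hr) (fun _ => rfl),
    mulL2_mulL2 hr hq (hq.mul hr) (fun _ => mul_comm _ _)]

/-- The Hermitian symmetry of the Fourier transforms of real distributions. -/
def IsHermitian (g : L2 n) : Prop := ∀ᵐ ξ, g (-ξ) = starRingEnd ℂ (g ξ)

theorem IsHermitian.mulL2 {q : Space n → ℂ} {C : ℝ} (hq : IsSymbol q C) {g : L2 n}
    (hg : IsHermitian g) : IsHermitian (mulL2 q g) := by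
  have h := hq.coeFn_mulL2 g
  have h' := (Measure.measurePreserving_neg (volume : Measure (Space n))).quasiMeasurePreserving.ae h
  filter_upwards [h, h', hg] with ξ h1 h2 h3
  rw [h1, h2, h3, hq.symm, map_mul]

/-- The function `ε^{-s} 𝓕⁻ψ`, through which a test function acts on the Fourier side. -/
def testFun (m s : ℝ) (ψ : 𝓢(Space n, ℂ)) : 𝓢(Space n, ℂ) :=
  SchwartzMap.smulLeftCLM ℂ (epsPow n m (-s)) (𝓕⁻ ψ)

theorem testFun_apply [Fact (0 < m)] (s : ℝ) (ψ : 𝓢(Space n, ℂ)) (ξ : Space n) :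
    testFun m s ψ ξ = (epsReal n m (-s) ξ : ℂ) * 𝓕⁻ ψ ξ := by
  rw [testFun, SchwartzMap.smulLeftCLM_apply_apply (epsPow_temperate _)]
  rfl

/-- The weight and the Fourier transform are invertible on Schwartz functions. Identities between
elements of L² can therefore be checked against test functions in physical space. -/
theorem exists_testFun_eq [Fact (0 < m)] (s : ℝ) (θ : 𝓢(Space n, ℂ)) :
    ∃ ψ, testFun m s ψ = θ := by
  refine ⟨𝓕 (SchwartzMap.smulLeftCLM ℂ (epsPow n m s) θ), ?_⟩
  rw [testFun, FourierTransform.fourierInv_fourier_eq,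
    SchwartzMap.smulLeftCLM_smulLeftCLM_apply (epsPow_temperate _) (epsPow_temperate _), epsPow_mul,
    neg_add_cancel, epsPow_zero, SchwartzMap.smulLeftCLM_const, one_smul]
  rfl

theorem toDist_apply (g : L2 n) (θ : 𝓢(Space n, ℂ)) :
    (g : 𝓢'(Space n, ℂ)) θ = ∫ ξ, θ ξ * g ξ := by
  rw [Lp.toTemperedDistribution_apply]
  rfl

/-- The distribution with given Fourier transform `ε^{-s} g`. -/
def ofL2 (m s : ℝ) (g : L2 n) : 𝓢'(Space n, ℂ) :=
  𝓕⁻ (TemperedDistribution.smulLeftCLM ℂ (epsPow n m (-s)) (g : 𝓢'(Space n, ℂ)))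

theorem ofL2_apply (s : ℝ) (g : L2 n) (ψ : 𝓢(Space n, ℂ)) :
    ofL2 m s g ψ = (g : 𝓢'(Space n, ℂ)) (testFun m s ψ) := by
  rw [ofL2, TemperedDistribution.fourierInv_apply, TemperedDistribution.smulLeftCLM_apply_apply]
  rfl

theorem weighted_ofL2 [Fact (0 < m)] (s : ℝ) (g : L2 n) :
    weighted m s (ofL2 m s g) = (g : 𝓢'(Space n, ℂ)) := by
  rw [weighted, ofL2, FourierTransform.fourier_fourierInv_eq,
    TemperedDistribution.smulLeftCLM_smulLeftCLM_apply (epsPow_temperate _) (epsPow_temperate _),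
    epsPow_mul, neg_add_cancel, epsPow_zero, TemperedDistribution.smulLeftCLM_const, one_smul]

theorem Sobolev.dist_eq_ofL2 [Fact (0 < m)] {s : ℝ} (T : Sobolev n m s) :
    T.dist = ofL2 m s T.toL2 := by
  rw [ofL2, ← T.toL2_spec, weighted_weighted, add_neg_cancel, weighted_zero,
    FourierTransform.fourierInv_fourier_eq]

theorem Sobolev.dist_apply [Fact (0 < m)] {s : ℝ} (T : Sobolev n m s) (ψ : 𝓢(Space n, ℂ)) :
    T.dist ψ = (T.toL2 : 𝓢'(Space n, ℂ)) (testFun m s ψ) := by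
  rw [T.dist_eq_ofL2, ofL2_apply]

theorem exists_toL2_eq [Fact (0 < m)] {s : ℝ} {g : L2 n} (hg : IsRealDistribution (ofL2 m s g)) :
    ∃ T : Sobolev n m s, T.toL2 = g := by
  let T : Sobolev n m s := ⟨ofL2 m s g, hg, g, weighted_ofL2 s g⟩
  refine ⟨T, toDist_injective ?_⟩
  rw [← T.toL2_spec]
  exact weighted_ofL2 s g

theorem fourierInv_conj {ψ : 𝓢(Space n, ℂ)} (hψ : ∀ x, (ψ x).im = 0) (ξ : Space n) :
    starRingEnd ℂ (𝓕⁻ ψ ξ) = 𝓕⁻ ψ (-ξ) := by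
  simp only [SchwartzMap.fourierInv_coe, Real.fourierInv_eq']
  rw [← integral_conj]
  congr 1
  funext x
  have h : starRingEnd ℂ (ψ x) = ψ x := Complex.conj_eq_iff_im.2 (hψ x)
  simp only [smul_eq_mul, map_mul, h, ← Complex.exp_conj, Complex.conj_ofReal, Complex.conj_I,
    inner_neg_right]
  congr 2
  push_cast
  ring

theorem testFun_conj [Fact (0 < m)] (s : ℝ) {ψ : 𝓢(Space n, ℂ)} (hψ : ∀ x, (ψ x).im = 0)
    (ξ : Space n) : starRingEnd ℂ (testFun m s ψ ξ) = testFun m s ψ (-ξ) := by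
  rw [testFun_apply, testFun_apply, map_mul, fourierInv_conj hψ, Complex.conj_ofReal, epsReal_neg]

/-- The function `ξ ↦ conj (g (-ξ))`. -/
def reflect (g : L2 n) : L2 n :=
  star (Lp.compMeasurePreserving Neg.neg (Measure.measurePreserving_neg _) g)

theorem coeFn_reflect (g : L2 n) : ∀ᵐ ξ, reflect g ξ = starRingEnd ℂ (g (-ξ)) := by
  filter_upwards [Lp.coeFn_star (Lp.compMeasurePreserving Neg.neg
    (Measure.measurePreserving_neg (volume : Measure (Space n))) g),
    Lp.coeFn_compMeasurePreserving g (Measure.measurePreserving_neg volume)] with ξ h1 h2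
  refine h1.trans ?_
  rw [Pi.star_apply, h2, Function.comp_apply, starRingEnd_apply]

theorem isHermitian_iff (g : L2 n) : IsHermitian g ↔ reflect g = g := by
  constructor
  · intro h
    refine Lp.ext ?_
    filter_upwards [h, coeFn_reflect g] with ξ h1 h2
    rw [h2, h1, Complex.conj_conj]
  · intro h
    have h' := coeFn_reflect g
    rw [h] at h'
    filter_upwards [h'] with ξ h1
    rw [h1, Complex.conj_conj]

theorem ofL2_reflect [Fact (0 < m)] (s : ℝ) (g : L2 n) {ψ : 𝓢(Space n, ℂ)}
    (hψ : ∀ x, (ψ x).im = 0) :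
    ofL2 m s (reflect g) ψ = starRingEnd ℂ (ofL2 m s g ψ) := by
  rw [ofL2_apply, ofL2_apply, toDist_apply, toDist_apply, ← integral_conj,
    ← integral_neg_eq_self (fun ξ => starRingEnd ℂ (testFun m s ψ ξ * g ξ))]
  refine integral_congr_ae ?_
  filter_upwards [coeFn_reflect g] with ξ h
  rw [h, map_mul, testFun_conj s hψ, neg_neg]

theorem exists_real_parts (ψ : 𝓢(Space n, ℂ)) : ∃ ψ₁ ψ₂ : 𝓢(Space n, ℂ),
    (∀ x, (ψ₁ x).im = 0) ∧ (∀ x, (ψ₂ x).im = 0) ∧ ψ = ψ₁ + Complex.I • ψ₂ := by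
  refine ⟨ψ.postcompCLM (Complex.ofRealCLM ∘L Complex.reCLM),
    ψ.postcompCLM (Complex.ofRealCLM ∘L Complex.imCLM), fun x => ?_, fun x => ?_, ?_⟩
  · simp
  · simp
  · ext x
    simp only [add_apply, smul_apply, SchwartzMap.postcompCLM_apply,
      ContinuousLinearMap.comp_apply, Complex.reCLM_apply, Complex.imCLM_apply,
      Complex.ofRealCLM_apply, smul_eq_mul]
    rw [mul_comm, Complex.re_add_im]

/-- Reflection of g conjugates the values on real test functions (`ofL2_reflect`), and a complex
test function is a combination of two real ones. So reality of the distribution means that g is its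
own reflection. -/
theorem isRealDistribution_ofL2_iff [Fact (0 < m)] (s : ℝ) (g : L2 n) :
    IsRealDistribution (ofL2 m s g) ↔ IsHermitian g := by
  rw [isHermitian_iff]
  constructor
  · intro h
    refine toDist_injective ?_
    ext θ
    obtain ⟨ψ, rfl⟩ := exists_testFun_eq (m := m) s θ
    rw [← ofL2_apply, ← ofL2_apply]
    have hr : ∀ ψ : 𝓢(Space n, ℂ), (∀ x, (ψ x).im = 0) →
        ofL2 m s (reflect g) ψ = ofL2 m s g ψ := fun ψ hψ => by
      rw [ofL2_reflect s g hψ]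
      exact Complex.conj_eq_iff_im.2 (h ψ hψ)
    obtain ⟨ψ₁, ψ₂, h1, h2, rfl⟩ := exists_real_parts ψ
    rw [map_add, map_add, map_smul, map_smul, hr _ h1, hr _ h2]
  · intro h ψ hψ
    have h1 := ofL2_reflect (m := m) s g hψ
    rw [h] at h1
    exact Complex.conj_eq_iff_im.1 h1.symm

variable [Fact (0 < m)] {s σ τ : ℝ}

theorem Sobolev.isHermitian (T : Sobolev n m s) : IsHermitian T.toL2 := by
  refine (isRealDistribution_ofL2_iff (m := m) s T.toL2).1 ?_
  rw [← T.dist_eq_ofL2]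
  exact T.2.1

theorem exists_sobolev (m s : ℝ) [Fact (0 < m)] {g : L2 n} (hg : IsHermitian g) :
    ∃ T : Sobolev n m s, T.toL2 = g :=
  exists_toL2_eq ((isRealDistribution_ofL2_iff s g).2 hg)

/-- `toL2` as an isometry. -/
def Sobolev.toL2I : Sobolev n m s →ₗᵢ[ℝ] L2 n where
  toLinearMap := Sobolev.toL2
  norm_map' _ := rfl

theorem Sobolev.toL2I_apply (T : Sobolev n m s) : Sobolev.toL2I T = T.toL2 := rfl

theorem isClosed_isHermitian : IsClosed {g : L2 n | IsHermitian g} := by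
  simp only [isHermitian_iff]
  refine isClosed_eq ?_ continuous_id
  refine Continuous.comp (LipschitzWith.continuous (K := 1) (f := fun g : L2 n => star g)
    (LipschitzWith.of_dist_le_mul fun f g => ?_)) (Lp.isometry_compMeasurePreserving
    (Measure.measurePreserving_neg (volume : Measure (Space n)))).continuous
  rw [NNReal.coe_one, one_mul, dist_eq_norm, dist_eq_norm]
  refine Lp.norm_le_norm_of_ae_le ?_
  filter_upwards [Lp.coeFn_sub (star f) (star g), Lp.coeFn_star f, Lp.coeFn_star g,
    Lp.coeFn_sub f g] with ξ h1 h2 h3 h4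
  rw [h1, h4, Pi.sub_apply, Pi.sub_apply, h2, h3, Pi.star_apply, Pi.star_apply, ← star_sub,
    norm_star]

/-- `toL2` identifies H^s isometrically with the Hermitian elements of L², which form a closed set.
Completeness lets the Taylor series of the nonlinearity be summed in H^s. -/
instance : CompleteSpace (Sobolev n m s) := by
  have h : Set.range (Sobolev.toL2I (n := n) (m := m) (s := s)) = {g | IsHermitian g} := by
    ext g
    constructor
    · rintro ⟨T, rfl⟩
      exact T.isHermitian
    · intro hg
      obtain ⟨T, hT⟩ := exists_sobolev m s hg
      exact ⟨T, hT⟩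
  refine (completeSpace_iff_isComplete_range
    (Sobolev.toL2I (n := n) (m := m) (s := s)).isometry.isUniformInducing).2 ?_
  rw [h]
  exact isClosed_isHermitian.isComplete

/-- The action of a Fourier multiplier, see `Sobolev.mult`. -/
def Sobolev.multFun (τ : ℝ) {q : Space n → ℂ} {C : ℝ} (hq : IsSymbol q C) (T : Sobolev n m σ) :
    Sobolev n m τ :=
  (exists_sobolev m τ (IsHermitian.mulL2 hq T.isHermitian)).choose

theorem Sobolev.toL2_multFun {q : Space n → ℂ} {C : ℝ} (hq : IsSymbol q C) (T : Sobolev n m σ) :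
    (Sobolev.multFun τ hq T).toL2 = mulL2 q T.toL2 :=
  (exists_sobolev m τ (IsHermitian.mulL2 hq T.isHermitian)).choose_spec

/-- The Fourier multiplier with symbol `ε^{σ-τ} q`, from `H^σ` to `H^τ`. -/
def Sobolev.mult {q : Space n → ℂ} {C : ℝ} (hq : IsSymbol q C) :
    Sobolev n m σ →L[ℝ] Sobolev n m τ :=
  LinearMap.mkContinuous
    { toFun := Sobolev.multFun τ hq
      map_add' := fun S T => by
        apply Sobolev.toL2_injective
        rw [Sobolev.toL2_multFun, map_add, map_add, map_add, Sobolev.toL2_multFun,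
          Sobolev.toL2_multFun]
      map_smul' := fun c T => by
        apply Sobolev.toL2_injective
        rw [Sobolev.toL2_multFun, LinearMap.map_smul, LinearMap.map_smul, RingHom.id_apply,
          Sobolev.toL2_multFun]
        exact (mulL2 q).map_smul (c : ℂ) _ } C fun T => by
    rw [Sobolev.norm_def, Sobolev.norm_def]
    refine le_trans (le_of_eq ?_) (hq.norm_mulL2_le T.toL2)
    rw [← Sobolev.toL2_multFun (τ := τ) hq]
    rfl

theorem Sobolev.mult_apply {q : Space n → ℂ} {C : ℝ} (hq : IsSymbol q C) (T : Sobolev n m σ) :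
    (Sobolev.mult hq T : Sobolev n m τ) = Sobolev.multFun τ hq T := rfl

theorem Sobolev.toL2_mult {q : Space n → ℂ} {C : ℝ} (hq : IsSymbol q C) (T : Sobolev n m σ) :
    (Sobolev.mult hq T : Sobolev n m τ).toL2 = mulL2 q T.toL2 := by
  rw [Sobolev.mult_apply, Sobolev.toL2_multFun]

/-! ### Powers of ε as symbols, and the inclusions between Sobolev spaces. -/

theorem epsReal_pos (s : ℝ) (ξ : Space n) : 0 < epsReal n m s ξ := by
  have hm0 : 0 < m := Fact.out
  rw [epsReal]
  positivity

theorem epsReal_mul (s r : ℝ) (ξ : Space n) :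
    epsReal n m s ξ * epsReal n m r ξ = epsReal n m (s + r) ξ := by
  have h := congrFun (epsPow_mul (n := n) (m := m) s r) ξ
  rw [Pi.mul_apply, epsPow_apply, epsPow_apply, epsPow_apply] at h
  exact_mod_cast h

theorem continuous_epsReal (s : ℝ) : Continuous (epsReal n m s) := by
  have h := (epsPow_temperate (n := n) (m := m) s).1.continuous
  simpa [Function.comp_def, epsPow_apply] using Complex.continuous_re.comp h

theorem isSymbol_epsReal {r : ℝ} (hr : r ≤ 0) :
    IsSymbol (fun ξ : Space n => (epsReal n m r ξ : ℂ)) ((m ^ 2) ^ (r / 2)) := by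
  have hm0 : 0 < m := Fact.out
  refine ⟨Complex.continuous_ofReal.comp (continuous_epsReal r), fun ξ => ?_, fun ξ => ?_⟩
  · rw [Complex.norm_real, Real.norm_of_nonneg (epsReal_pos r ξ).le]
    apply Real.rpow_le_rpow_of_nonpos (by positivity)
    · nlinarith [sq_nonneg (2 * Real.pi * ‖ξ‖)]
    · linarith
  · rw [epsReal_neg, Complex.conj_ofReal]

theorem subtype_inclusion {R M : Type*} [Semiring R] [AddCommMonoid M] [Module R M]
    {p q : Submodule R M} (h : p ≤ q) (x : p) :
    q.subtype (Submodule.inclusion h x) = p.subtype x := rfl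

theorem Sobolev.dist_incl (h : τ ≤ σ) (T : Sobolev n m σ) : (Sobolev.incl h T).dist = T.dist :=
  subtype_inclusion (sobolevSubmodule_mono (n := n) (m := m) h) T

theorem Sobolev.toL2_incl (h : τ ≤ σ) (T : Sobolev n m σ) :
    (Sobolev.incl h T).toL2 = mulL2 (fun ξ => (epsReal n m (τ - σ) ξ : ℂ)) T.toL2 := by
  have hs := isSymbol_epsReal (n := n) (m := m) (sub_nonpos.2 h)
  apply toDist_injective
  ext θ
  have h1 : weighted m τ T.dist = TemperedDistribution.smulLeftCLM ℂ (epsPow n m (τ - σ))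
      (T.toL2 : 𝓢'(Space n, ℂ)) := by
    rw [← T.toL2_spec, weighted_weighted, add_sub_cancel]
  rw [← Sobolev.toL2_spec, Sobolev.dist_incl, h1, TemperedDistribution.smulLeftCLM_apply_apply,
    toDist_apply, toDist_apply]
  refine integral_congr_ae ?_
  filter_upwards [hs.coeFn_mulL2 T.toL2] with ξ h2
  rw [h2, SchwartzMap.smulLeftCLM_apply_apply (epsPow_temperate _), smul_eq_mul, epsPow_apply]
  ring

end FourierSide

/-! ### Pointwise values -/

section PointValues

variable {n : ℕ} {m : ℝ} [Fact (0 < m)] {s : ℝ}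

/-- Up to the factor min(m², 1)^{-s} the function is bounded by (1 + |ξ|²)^{-s}, which is integrable
since 2s > n. -/
theorem integrable_epsReal (hs : (n : ℝ) / 2 < s) : Integrable (epsReal n m (-(2 * s))) := by
  have hm0 : 0 < m := Fact.out
  have hs0 : 0 ≤ s := le_trans (by positivity) hs.le
  have h := integrable_rpow_neg_one_add_norm_sq (E := Space n) (μ := volume) (r := 2 * s)
    (by rw [finrank_euclideanSpace_fin]; linarith)
  have hc : 0 < min (m ^ 2) 1 := by positivity
  refine (h.const_mul ((min (m ^ 2) 1) ^ (-s))).mono'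
    (continuous_epsReal _).aestronglyMeasurable (Filter.Eventually.of_forall fun ξ => ?_)
  rw [Real.norm_of_nonneg (epsReal_pos _ ξ).le, epsReal, show -(2 * s) / 2 = -s by ring,
    ← Real.mul_rpow hc.le (by positivity)]
  refine Real.rpow_le_rpow_of_nonpos (by positivity) ?_ (by linarith)
  have h1 : min (m ^ 2) 1 ≤ m ^ 2 := min_le_left _ _
  have h2 : min (m ^ 2) 1 ≤ 1 := min_le_right _ _
  have h3 : 1 ≤ (2 * Real.pi) ^ 2 := by nlinarith [Real.pi_gt_three]
  have h4 : min (m ^ 2) 1 * ‖ξ‖ ^ 2 ≤ (2 * Real.pi) ^ 2 * ‖ξ‖ ^ 2 :=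
    mul_le_mul_of_nonneg_right (h2.trans h3) (by positivity)
  calc min (m ^ 2) 1 * (1 + ‖ξ‖ ^ 2) = min (m ^ 2) 1 + min (m ^ 2) 1 * ‖ξ‖ ^ 2 := by ring
    _ ≤ m ^ 2 + (2 * Real.pi) ^ 2 * ‖ξ‖ ^ 2 := add_le_add h1 h4
    _ = _ := by ring

theorem memLp_epsReal (hs : (n : ℝ) / 2 < s) :
    MemLp (fun ξ : Space n => (epsReal n m (-s) ξ : ℂ)) 2 volume := by
  have hc : Continuous fun ξ : Space n => (epsReal n m (-s) ξ : ℂ) :=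
    Complex.continuous_ofReal.comp (continuous_epsReal _)
  rw [memLp_two_iff_integrable_sq_norm hc.aestronglyMeasurable]
  refine (integrable_epsReal (m := m) hs).congr (Filter.Eventually.of_forall fun ξ => ?_)
  simp only
  rw [Complex.norm_real, Real.norm_eq_abs, sq_abs, sq, epsReal_mul]
  congr 1
  ring

theorem integrable_mul_L2 {a : Space n → ℂ} (ha : MemLp a 2 volume) (g : L2 n) :
    Integrable (fun ξ => a ξ * g ξ) :=
  memLp_one_iff_integrable.1 ((Lp.memLp g).smul ha)

theorem integral_norm_mul_L2_le {a : Space n → ℂ} (ha : MemLp a 2 volume) (g : L2 n) :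
    ∫ ξ, ‖a ξ * g ξ‖ ≤ (eLpNorm a 2 volume).toReal * ‖g‖ := by
  have h2 := eLpNorm_smul_le_mul_eLpNorm (p := 2) (q := 2) (r := 1)
    (Lp.aestronglyMeasurable g) ha.1
  rw [integral_norm_eq_lintegral_enorm (integrable_mul_L2 ha g).1,
    Lp.norm_def, ← ENNReal.toReal_mul]
  refine ENNReal.toReal_mono (ENNReal.mul_ne_top ha.2.ne (Lp.memLp g).2.ne) ?_
  rw [eLpNorm_one_eq_lintegral_enorm] at h2
  exact h2

/-- The Fourier transform of an element of `H^s`, `s ≥ 0`. -/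
def Sobolev.density (v : Sobolev n m s) (ξ : Space n) : ℂ :=
  (epsReal n m (-s) ξ : ℂ) * v.toL2 ξ

theorem Sobolev.integrable_density (hs : (n : ℝ) / 2 < s) (v : Sobolev n m s) :
    Integrable v.density :=
  integrable_mul_L2 (memLp_epsReal hs) _

/-- The constant in the embedding of `H^s` into the bounded continuous functions. -/
def embeddingConst (n : ℕ) (m s : ℝ) : ℝ :=
  (eLpNorm (fun ξ : Space n => (epsReal n m (-s) ξ : ℂ)) 2 volume).toReal

/-- The value at a point of an element of `H^s`, `s > n/2`. -/
def Sobolev.value (v : Sobolev n m s) (x : Space n) : ℝ := (𝓕⁻ v.density x).re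

/-- The Hermitian symmetry makes the inverse Fourier integral real, so nothing is lost by taking the
real part in `Sobolev.value`. -/
theorem Sobolev.value_eq (v : Sobolev n m s) (x : Space n) :
    (v.value x : ℂ) = 𝓕⁻ v.density x := by
  refine Complex.conj_eq_iff_re.1 ?_
  rw [Real.fourierInv_eq', ← integral_conj, ← integral_neg_eq_self]
  refine integral_congr_ae ?_
  filter_upwards [v.isHermitian] with ξ h
  simp only [Sobolev.density, smul_eq_mul, map_mul, h, ← Complex.exp_conj, Complex.conj_ofReal,
    Complex.conj_I, inner_neg_left, epsReal_neg, Complex.conj_conj]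
  congr 2
  push_cast
  ring

theorem continuous_fourierInv {f : Space n → ℂ} (hf : Integrable f) : Continuous (𝓕⁻ f) :=
  VectorFourier.fourierIntegral_continuous Real.continuous_fourierChar
    (continuous_inner (𝕜 := ℝ) (E := Space n)).neg hf

theorem norm_fourierInv_le (f : Space n → ℂ) (x : Space n) : ‖𝓕⁻ f x‖ ≤ ∫ ξ, ‖f ξ‖ :=
  VectorFourier.norm_fourierIntegral_le_integral_norm _ _ _ f x

theorem integral_fourierInv_mul {f g : Space n → ℂ} (hf : Integrable f) (hg : Integrable g) :
    ∫ ξ, 𝓕⁻ f ξ * g ξ = ∫ x, f x * 𝓕⁻ g x := by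
  have h := VectorFourier.integral_fourierIntegral_smul_eq_flip (μ := volume) (ν := volume)
    (L := -innerₗ (Space n)) Real.continuous_fourierChar
    (continuous_inner (𝕜 := ℝ) (E := Space n)).neg hf hg
  have e : (-innerₗ (Space n)).flip = -innerₗ (Space n) := by
    ext x y
    simp [real_inner_comm]
  rw [e] at h
  exact h

theorem Sobolev.abs_value_le (hs : (n : ℝ) / 2 < s) (v : Sobolev n m s) (x : Space n) :
    |v.value x| ≤ embeddingConst n m s * ‖v‖ :=
  (Complex.abs_re_le_norm _).trans ((norm_fourierInv_le _ x).trans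
    (integral_norm_mul_L2_le (memLp_epsReal hs) _))

theorem Sobolev.continuous_value (hs : (n : ℝ) / 2 < s) (v : Sobolev n m s) :
    Continuous v.value :=
  Complex.continuous_re.comp (continuous_fourierInv (v.integrable_density hs))

theorem Sobolev.dist_apply_eq_integral (v : Sobolev n m s) (ψ : 𝓢(Space n, ℂ)) :
    v.dist ψ = ∫ ξ, 𝓕⁻ ψ ξ * v.density ξ := by
  rw [Sobolev.dist_apply, toDist_apply]
  congr 1
  funext ξ
  rw [testFun_apply, Sobolev.density]
  ring

/-- For s > n/2 the function ε^{-s} is square integrable, so the Fourier transform of v is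
integrable. Its inverse Fourier integral is then bounded and continuous, and the duality
`integral_fourierInv_mul` shows that it represents v. -/
theorem Sobolev.isContinuousRep_value (hs : (n : ℝ) / 2 < s) (v : Sobolev n m s) :
    IsContinuousRep v.dist v.value := by
  refine ⟨v.continuous_value hs, fun ψ => ⟨?_, ?_⟩⟩
  · refine ψ.integrable.mul_bdd (c := embeddingConst n m s * ‖v‖)
      (Complex.continuous_ofReal.comp (v.continuous_value hs)).aestronglyMeasurable
      (Filter.Eventually.of_forall fun x => ?_)
    rw [Complex.norm_real]
    exact v.abs_value_le hs x
  · rw [v.dist_apply_eq_integral, SchwartzMap.fourierInv_coe,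
      integral_fourierInv_mul ψ.integrable (v.integrable_density hs)]
    simp only [Sobolev.value_eq]

/-- The fundamental lemma of the calculus of variations; it makes the choice in `pointValue`
harmless. -/
theorem IsContinuousRep.unique {T : 𝓢'(Space n, ℂ)} {f g : Space n → ℝ}
    (hf : IsContinuousRep T f) (hg : IsContinuousRep T g) : f = g := by
  refine (Continuous.ae_eq_iff_eq (μ := volume) hf.1 hg.1).1 ?_
  refine ae_eq_of_integral_contDiff_smul_eq hf.1.locallyIntegrable hg.1.locallyIntegrable
    fun θ hθ hc => ?_
  have hc' : HasCompactSupport fun x => (θ x : ℂ) := hc.comp_left (g := Complex.ofReal) rfl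
  have hθ' : ContDiff ℝ ∞ fun x => (θ x : ℂ) := Complex.ofRealCLM.contDiff.comp hθ
  have h := (hf.2 (hc'.toSchwartzMap hθ')).2.symm.trans (hg.2 (hc'.toSchwartzMap hθ')).2
  simp only [HasCompactSupport.toSchwartzMap_toFun, ← Complex.ofReal_mul] at h
  have h' : ((∫ x, θ x * f x : ℝ) : ℂ) = ((∫ x, θ x * g x : ℝ) : ℂ) := by
    rw [← integral_complex_ofReal, ← integral_complex_ofReal]
    exact h
  exact_mod_cast h'

theorem IsContinuousRep.add {S T : 𝓢'(Space n, ℂ)} {f g : Space n → ℝ}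
    (hf : IsContinuousRep S f) (hg : IsContinuousRep T g) :
    IsContinuousRep (S + T) (fun x => f x + g x) := by
  refine ⟨hf.1.add hg.1, fun ψ => ?_⟩
  have e : (fun x => ψ x * ((f x + g x : ℝ) : ℂ)) = fun x => ψ x * (f x : ℂ) + ψ x * (g x : ℂ) := by
    funext x
    push_cast
    ring
  rw [e]
  refine ⟨(hf.2 ψ).1.add (hg.2 ψ).1, ?_⟩
  rw [integral_add (hf.2 ψ).1 (hg.2 ψ).1, ← (hf.2 ψ).2, ← (hg.2 ψ).2]
  rfl

theorem IsContinuousRep.smul {T : 𝓢'(Space n, ℂ)} {f : Space n → ℝ} (c : ℝ)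
    (hf : IsContinuousRep T f) : IsContinuousRep (c • T) (fun x => c * f x) := by
  refine ⟨continuous_const.mul hf.1, fun ψ => ?_⟩
  have e : (fun x => ψ x * ((c * f x : ℝ) : ℂ)) = fun x => (c : ℂ) * (ψ x * (f x : ℂ)) := by
    funext x
    push_cast
    ring
  rw [e]
  refine ⟨(hf.2 ψ).1.const_mul _, ?_⟩
  rw [integral_const_mul, ← (hf.2 ψ).2]
  exact Complex.real_smul

theorem IsContinuousRep.pointValue_eq {T : 𝓢'(Space n, ℂ)} {f : Space n → ℝ}
    (hf : IsContinuousRep T f) : pointValue T = f := by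
  have h : ∃ f, IsContinuousRep T f := ⟨f, hf⟩
  rw [pointValue, dif_pos h]
  exact h.choose_spec.unique hf

/-- Evaluation at a point as a continuous linear form. -/
def Sobolev.valueL (hs : (n : ℝ) / 2 < s) (x : Space n) : Sobolev n m s →L[ℝ] ℝ :=
  LinearMap.mkContinuous
    { toFun := fun v => v.value x
      map_add' := fun u v => by
        have h := (u.isContinuousRep_value hs).add (v.isContinuousRep_value hs)
        rw [← map_add] at h
        exact congrFun (((u + v).isContinuousRep_value hs).unique h) x
      map_smul' := fun c v => by
        have h := (v.isContinuousRep_value hs).smul c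
        rw [← map_smul] at h
        exact congrFun (((c • v).isContinuousRep_value hs).unique h) x } (embeddingConst n m s)
    fun v => v.abs_value_le hs x

theorem Sobolev.valueL_apply (hs : (n : ℝ) / 2 < s) (x : Space n) (v : Sobolev n m s) :
    Sobolev.valueL hs x v = v.value x := rfl

theorem Sobolev.ext_value (hs : (n : ℝ) / 2 < s) {u v : Sobolev n m s}
    (h : ∀ x, u.value x = v.value x) : u = v := by
  apply Sobolev.dist_injective
  ext ψ
  rw [((u.isContinuousRep_value hs).2 ψ).2, ((v.isContinuousRep_value hs).2 ψ).2]
  simp only [h]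

end PointValues

/-! ### Products -/

section Products

variable {n : ℕ} {m : ℝ} [Fact (0 < m)] {s : ℝ}

/-- The norm of ξ + η is at most twice the larger of the two norms; the 4 is the square of this
factor. -/
theorem epsReal_add_le (hs : 0 ≤ s) (ξ η : Space n) :
    epsReal n m (2 * s) (ξ + η) ≤ 4 ^ s * (epsReal n m (2 * s) ξ + epsReal n m (2 * s) η) := by
  have key : ∀ ξ η : Space n, ‖η‖ ≤ ‖ξ‖ →
      epsReal n m (2 * s) (ξ + η) ≤ 4 ^ s * epsReal n m (2 * s) ξ := by
    intro ξ η h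
    rw [epsReal, epsReal, show 2 * s / 2 = s by ring, ← Real.mul_rpow (by norm_num) (by positivity)]
    refine Real.rpow_le_rpow (by positivity) ?_ hs
    have h1 : 2 * Real.pi * ‖ξ + η‖ ≤ 2 * (2 * Real.pi * ‖ξ‖) := by
      have h2 : ‖ξ + η‖ ≤ 2 * ‖ξ‖ := (norm_add_le _ _).trans (by linarith)
      calc 2 * Real.pi * ‖ξ + η‖ ≤ 2 * Real.pi * (2 * ‖ξ‖) := by gcongr
        _ = _ := by ring
    have h3 : (2 * Real.pi * ‖ξ + η‖) ^ 2 ≤ (2 * (2 * Real.pi * ‖ξ‖)) ^ 2 := by gcongr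
    nlinarith [sq_nonneg m]
  have hp := fun ξ : Space n => (epsReal_pos (m := m) (2 * s) ξ).le
  have h4 : (0 : ℝ) ≤ 4 ^ s := by positivity
  rcases le_total ‖η‖ ‖ξ‖ with h | h
  · refine (key ξ η h).trans (mul_le_mul_of_nonneg_left ?_ h4)
    linarith [hp η]
  · rw [add_comm ξ η]
    refine (key η ξ h).trans (mul_le_mul_of_nonneg_left ?_ h4)
    linarith [hp ξ]

theorem epsReal_kernel_le (hs : 0 ≤ s) (ξ η : Space n) :
    (epsReal n m s ξ * (epsReal n m (-s) η * epsReal n m (-s) (ξ - η))) ^ 2 ≤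
      4 ^ s * (epsReal n m (-(2 * s)) η + epsReal n m (-(2 * s)) (ξ - η)) := by
  have e : ∀ (r : ℝ) (ξ : Space n), epsReal n m r ξ ^ 2 = epsReal n m (2 * r) ξ := fun r ξ => by
    rw [sq, epsReal_mul, two_mul]
  have e2 : ∀ ξ : Space n, epsReal n m (2 * s) ξ * epsReal n m (-(2 * s)) ξ = 1 := fun ξ => by
    rw [epsReal_mul, add_neg_cancel]
    simp [epsReal]
  rw [mul_pow, mul_pow, e, e, e, mul_neg]
  have h := epsReal_add_le (m := m) hs η (ξ - η)
  rw [add_sub_cancel] at h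
  have h1 := epsReal_pos (m := m) (-(2 * s)) η
  have h2 := epsReal_pos (m := m) (-(2 * s)) (ξ - η)
  refine (mul_le_mul_of_nonneg_right h (mul_pos h1 h2).le).trans (le_of_eq ?_)
  calc _ = 4 ^ s * ((epsReal n m (2 * s) η * epsReal n m (-(2 * s)) η) *
          epsReal n m (-(2 * s)) (ξ - η) +
        (epsReal n m (2 * s) (ξ - η) * epsReal n m (-(2 * s)) (ξ - η)) *
          epsReal n m (-(2 * s)) η) := by ring
    _ = _ := by rw [e2, e2]; ring

theorem lintegral_mul_sq_le {α : Type*} [MeasurableSpace α] {μ : Measure α} {f g : α → ℝ≥0∞}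
    (hf : AEMeasurable f μ) (hg : AEMeasurable g μ) :
    (∫⁻ x, f x * g x ∂μ) ^ 2 ≤ (∫⁻ x, f x ^ 2 ∂μ) * ∫⁻ x, g x ^ 2 ∂μ := by
  have h := ENNReal.lintegral_mul_le_Lp_mul_Lq μ Real.HolderConjugate.two_two hf hg
  have h2 := pow_le_pow_left₀ (zero_le) h 2
  refine (le_of_eq rfl).trans (h2.trans (le_of_eq ?_))
  have e : ∀ a : ℝ≥0∞, (a ^ ((1 : ℝ) / 2)) ^ 2 = a := fun a => by
    rw [← ENNReal.rpow_natCast, ← ENNReal.rpow_mul]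
    norm_num
  rw [mul_pow, e, e]
  simp only [ENNReal.rpow_ofNat]

theorem eLpNorm_two_sq {f : Space n → ℂ} : eLpNorm f 2 volume ^ 2 = ∫⁻ ξ, ‖f ξ‖ₑ ^ 2 := by
  have h := eLpNorm_nnreal_pow_eq_lintegral (μ := (volume : Measure (Space n))) (f := f) (p := 2)
    (by norm_num)
  simpa using h

/-- The weighted convolution `ε^s ((ε^{-s} a) * (ε^{-s} b))`. -/
def weightedConv (m s : ℝ) (a b : L2 n) (ξ : Space n) : ℂ :=
  (epsReal n m s ξ : ℂ) * ∫ η, (epsReal n m (-s) η : ℂ) * a η *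
    ((epsReal n m (-s) (ξ - η) : ℂ) * b (ξ - η))

/-- Cauchy–Schwarz in η, with the three weights in one factor and a, b in the other. The square of
the weights is controlled by ε^{-2s}(η) + ε^{-2s}(ξ - η) (`epsReal_kernel_le`); the two summands
have the same integral, hence the factor 2. -/
theorem enorm_weightedConv_sq_le (hs : (n : ℝ) / 2 < s) (a b : L2 n) (ξ : Space n) :
    ‖weightedConv m s a b ξ‖ₑ ^ 2 ≤
      (ENNReal.ofReal (4 ^ s) * (2 * ∫⁻ η, ENNReal.ofReal (epsReal n m (-(2 * s)) η))) *
        ∫⁻ η, ‖a η‖ₑ ^ 2 * ‖b (ξ - η)‖ₑ ^ 2 := by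
  have hs0 : 0 ≤ s := le_trans (by positivity) hs.le
  have hp := fun (r : ℝ) (ξ : Space n) => (epsReal_pos (m := m) r ξ).le
  have hm := fun r => (continuous_epsReal (n := n) (m := m) r).measurable
  have ha : Measurable fun η => ‖a η‖ₑ := (Lp.stronglyMeasurable a).measurable.enorm
  have hb : Measurable fun η => ‖b (ξ - η)‖ₑ :=
    ((Lp.stronglyMeasurable b).measurable.comp (measurable_const.sub measurable_id)).enorm
  have hm' : Measurable fun η => epsReal n m (-s) (ξ - η) :=
    (hm _).comp (measurable_const.sub measurable_id)
  have hm2 : Measurable fun η => epsReal n m (-(2 * s)) (ξ - η) :=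
    (hm _).comp (measurable_const.sub measurable_id)
  have h1 : ‖weightedConv m s a b ξ‖ₑ ≤ ∫⁻ η,
      ENNReal.ofReal (epsReal n m s ξ * (epsReal n m (-s) η * epsReal n m (-s) (ξ - η))) *
        (‖a η‖ₑ * ‖b (ξ - η)‖ₑ) := by
    rw [weightedConv, ← integral_const_mul]
    refine (enorm_integral_le_lintegral_enorm _).trans (le_of_eq ?_)
    congr 1
    funext η
    have e : ∀ (r : ℝ) (ξ : Space n), ‖(epsReal n m r ξ : ℂ)‖ₑ = ENNReal.ofReal (epsReal n m r ξ) :=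
      fun r ξ => by
        rw [← ofReal_norm, Complex.norm_real, Real.norm_of_nonneg (hp r ξ)]
    rw [enorm_mul, enorm_mul, enorm_mul, enorm_mul, e, e, e, ENNReal.ofReal_mul (hp _ _),
      ENNReal.ofReal_mul (hp _ _)]
    ring
  refine (pow_le_pow_left₀ (zero_le) h1 2).trans ?_
  refine (lintegral_mul_sq_le ?_ (ha.mul hb).aemeasurable).trans ?_
  · exact (((hm _).mul hm').const_mul _).ennreal_ofReal.aemeasurable
  refine mul_le_mul' ?_ (le_of_eq (by simp only [Pi.mul_apply, mul_pow]))
  calc _ ≤ ∫⁻ η, ENNReal.ofReal (4 ^ s) * (ENNReal.ofReal (epsReal n m (-(2 * s)) η) +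
          ENNReal.ofReal (epsReal n m (-(2 * s)) (ξ - η))) := by
          refine lintegral_mono fun η => ?_
          simp only
          rw [← ENNReal.ofReal_pow (mul_nonneg (hp _ _) (mul_nonneg (hp _ _) (hp _ _))),
            ← ENNReal.ofReal_add (hp _ _) (hp _ _), ← ENNReal.ofReal_mul (by positivity)]
          exact ENNReal.ofReal_le_ofReal (epsReal_kernel_le hs0 ξ η)
      _ = _ := by
          have hm3 : Measurable fun η : Space n => ENNReal.ofReal (epsReal n m (-(2 * s)) η) +
            ENNReal.ofReal (epsReal n m (-(2 * s)) (ξ - η)) :=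
            (hm _).ennreal_ofReal.add hm2.ennreal_ofReal
          rw [lintegral_const_mul _ hm3,
            lintegral_add_left (hm _).ennreal_ofReal,
            lintegral_sub_left_eq_self (fun η => ENNReal.ofReal (epsReal n m (-(2 * s)) η)),
            ← two_mul]

/-- The constant in the estimate of a product in `H^s`. -/
def productConst (n : ℕ) (m s : ℝ) : ℝ :=
  Real.sqrt (ENNReal.ofReal (4 ^ s) *
    (2 * ∫⁻ η : Space n, ENNReal.ofReal (epsReal n m (-(2 * s)) η))).toReal

theorem lintegral_weightedConv_le (hs : (n : ℝ) / 2 < s) (a b : L2 n) :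
    ∫⁻ ξ, ‖weightedConv m s a b ξ‖ₑ ^ 2 ≤
      (ENNReal.ofReal (4 ^ s) * (2 * ∫⁻ η, ENNReal.ofReal (epsReal n m (-(2 * s)) η))) *
        ((∫⁻ η, ‖a η‖ₑ ^ 2) * ∫⁻ η, ‖b η‖ₑ ^ 2) := by
  have ha : Measurable fun η => ‖a η‖ₑ := (Lp.stronglyMeasurable a).measurable.enorm
  have hb : Measurable fun η => ‖b η‖ₑ := (Lp.stronglyMeasurable b).measurable.enorm
  have hab : Measurable fun x : Space n × Space n => ‖a x.2‖ₑ ^ 2 * ‖b (x.1 - x.2)‖ₑ ^ 2 :=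
    ((ha.comp measurable_snd).pow_const 2).mul
      ((hb.comp (measurable_fst.sub measurable_snd)).pow_const 2)
  refine (lintegral_mono (enorm_weightedConv_sq_le hs a b)).trans ?_
  rw [lintegral_const_mul _ hab.lintegral_prod_right', lintegral_lintegral_swap hab.aemeasurable]
  refine le_of_eq ?_
  congr 1
  rw [← lintegral_mul_const _ (ha.pow_const 2)]
  congr 1
  funext η
  have hb' : Measurable fun ξ => ‖b (ξ - η)‖ₑ ^ 2 :=
    (hb.comp (measurable_id.sub measurable_const)).pow_const 2
  simp only
  rw [lintegral_const_mul _ hb',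
    lintegral_sub_right_eq_self (fun ξ => ‖b ξ‖ₑ ^ 2)]

theorem weightedConv_norm (hs : (n : ℝ) / 2 < s) (a b : L2 n)
    (hm : AEStronglyMeasurable (weightedConv m s a b) volume) :
    ∃ g : L2 n, (∀ᵐ ξ, g ξ = weightedConv m s a b ξ) ∧
      ‖g‖ ≤ productConst n m s * (‖a‖ * ‖b‖) := by
  have h := lintegral_weightedConv_le (m := m) hs a b
  rw [← eLpNorm_two_sq, ← eLpNorm_two_sq, ← eLpNorm_two_sq] at h
  set K : ℝ≥0∞ := ENNReal.ofReal (4 ^ s) *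
    (2 * ∫⁻ η : Space n, ENNReal.ofReal (epsReal n m (-(2 * s)) η)) with hK
  have hKt : K ≠ ⊤ := ENNReal.mul_ne_top ENNReal.ofReal_ne_top (ENNReal.mul_ne_top (by simp)
    (integrable_epsReal hs).lintegral_lt_top.ne)
  have ha := (Lp.memLp a).2.ne
  have hb := (Lp.memLp b).2.ne
  have hT : K * (eLpNorm a 2 volume ^ 2 * eLpNorm b 2 volume ^ 2) ≠ ⊤ :=
    ENNReal.mul_ne_top hKt (ENNReal.mul_ne_top (ENNReal.pow_ne_top ha) (ENNReal.pow_ne_top hb))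
  have hL : MemLp (weightedConv m s a b) 2 volume := by
    refine ⟨hm, lt_top_iff_ne_top.2 fun h' => ?_⟩
    rw [h'] at h
    exact hT (top_le_iff.1 (by simpa using h))
  refine ⟨hL.toLp _, hL.coeFn_toLp, ?_⟩
  have h3 := ENNReal.toReal_mono hT h
  clear_value K
  rw [ENNReal.toReal_mul, ENNReal.toReal_mul, ENNReal.toReal_pow, ENNReal.toReal_pow,
    ENNReal.toReal_pow] at h3
  rw [Lp.norm_toLp, Lp.norm_def, Lp.norm_def]
  refine (pow_le_pow_iff_left₀ ENNReal.toReal_nonneg ?_ two_ne_zero).1 ?_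
  · exact mul_nonneg (Real.sqrt_nonneg _) (mul_nonneg ENNReal.toReal_nonneg ENNReal.toReal_nonneg)
  · refine h3.trans (le_of_eq ?_)
    rw [mul_pow, productConst, ← hK, Real.sq_sqrt ENNReal.toReal_nonneg]
    ring

/-- The algebra property of H^s. The Fourier transform of the product is the convolution k of the
two densities, and ε^s k is the weighted convolution just estimated. Since k inherits the Hermitian
symmetry, it comes from a real distribution. -/
theorem Sobolev.exists_mul (hs : (n : ℝ) / 2 < s) (u v : Sobolev n m s) :
    ∃ w : Sobolev n m s, (∀ x, w.value x = u.value x * v.value x) ∧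
      ‖w‖ ≤ productConst n m s * (‖u‖ * ‖v‖) := by
  have hu := u.integrable_density hs
  have hv := v.integrable_density hs
  have hk := hu.integrable_convolution (ContinuousLinearMap.mul ℂ ℂ) hv
  set k : Space n → ℂ := convolution u.density v.density (ContinuousLinearMap.mul ℂ ℂ) volume
    with hkdef
  have hkap : ∀ ξ, k ξ = ∫ η, u.density η * v.density (ξ - η) := fun ξ => rfl
  have hwc : ∀ ξ, weightedConv m s u.toL2 v.toL2 ξ = (epsReal n m s ξ : ℂ) * k ξ := fun ξ => rfl
  have hmeas : AEStronglyMeasurable (weightedConv m s u.toL2 v.toL2) volume :=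
    (Complex.continuous_ofReal.comp (continuous_epsReal s)).aestronglyMeasurable.mul hk.1
  obtain ⟨g, hg, hgn⟩ := weightedConv_norm hs u.toL2 v.toL2 hmeas
  have hdn : ∀ w : Sobolev n m s, ∀ᵐ ξ, w.density (-ξ) = starRingEnd ℂ (w.density ξ) := by
    intro w
    filter_upwards [w.isHermitian] with ξ h
    rw [Sobolev.density, Sobolev.density, h, map_mul, Complex.conj_ofReal, epsReal_neg]
  have hkh : ∀ ξ, k (-ξ) = starRingEnd ℂ (k ξ) := by
    intro ξ
    rw [hkap, hkap, ← integral_conj, ← integral_neg_eq_self]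
    refine integral_congr_ae ?_
    have h2 := (Measure.measurePreserving_sub_left (volume : Measure (Space n))
      ξ).quasiMeasurePreserving.ae (hdn v)
    filter_upwards [hdn u, h2] with η h3 h4
    rw [h3, map_mul, ← h4]
    congr 2
    abel
  have hgh : IsHermitian g := by
    have h' := (Measure.measurePreserving_neg
      (volume : Measure (Space n))).quasiMeasurePreserving.ae hg
    filter_upwards [hg, h'] with ξ h1 h2
    rw [h1, h2, hwc, hwc, hkh, map_mul, Complex.conj_ofReal, epsReal_neg]
  obtain ⟨w, hw⟩ := exists_sobolev m s hgh
  have hwk : w.density =ᵐ[volume] k := by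
    filter_upwards [hg] with ξ h1
    rw [Sobolev.density, hw, h1, hwc, ← mul_assoc, ← Complex.ofReal_mul, epsReal_mul,
      neg_add_cancel]
    simp [epsReal]
  refine ⟨w, fun x => ?_, ?_⟩
  · have h : (w.value x : ℂ) = u.value x * v.value x := by
      rw [w.value_eq, u.value_eq, v.value_eq, Real.fourierInv_congr_ae hwk,
        Real.fourierInv_eq_fourier_neg, Real.fourierInv_eq_fourier_neg,
        Real.fourierInv_eq_fourier_neg, hkdef, Real.fourier_mul_convolution_eq hu hv]
    exact_mod_cast h
  · rw [Sobolev.norm_def, hw]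
    exact hgn

end Products

/-! ### The nonlinearity as a power series -/

section Nonlinearity

variable {n : ℕ} {m : ℝ} [Fact (0 < m)] {s : ℝ}

theorem Sobolev.norm_incl_le {σ τ : ℝ} (h : τ ≤ σ) (T : Sobolev n m σ) :
    ‖Sobolev.incl h T‖ ≤ (m ^ 2) ^ ((τ - σ) / 2) * ‖T‖ := by
  rw [Sobolev.norm_def, Sobolev.toL2_incl]
  exact (isSymbol_epsReal (sub_nonpos.2 h)).norm_mulL2_le _

/-- The inclusion of `H^σ` in `H^τ` as a continuous linear map. -/
def Sobolev.inclL {σ τ : ℝ} (h : τ ≤ σ) : Sobolev n m σ →L[ℝ] Sobolev n m τ :=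
  LinearMap.mkContinuous (Sobolev.incl h) _ (Sobolev.norm_incl_le h)

theorem Sobolev.inclL_apply {σ τ : ℝ} (h : τ ≤ σ) (T : Sobolev n m σ) :
    Sobolev.inclL h T = Sobolev.incl h T := rfl

/-- The symbol of `∂_j` divided by `ε`. -/
def gradSymbol (m : ℝ) (j : Fin n) (ξ : Space n) : ℂ :=
  ((2 * Real.pi * ξ j * epsReal n m (-1) ξ : ℝ) : ℂ) * Complex.I

theorem epsReal_sq (r : ℝ) (ξ : Space n) : epsReal n m r ξ ^ 2 = epsReal n m (2 * r) ξ := by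
  rw [sq, epsReal_mul, two_mul]

theorem epsReal_zero (ξ : Space n) : epsReal n m 0 ξ = 1 := by
  simp [epsReal]

theorem epsReal_two (ξ : Space n) : epsReal n m 2 ξ = m ^ 2 + (2 * Real.pi * ‖ξ‖) ^ 2 := by
  simp [epsReal]

/-- |2πξ_j| ≤ ε, so a derivative costs one power of ε, which the factor ε^{-1} in the symbol pays
for. -/
theorem isSymbol_gradSymbol (j : Fin n) : IsSymbol (gradSymbol m j) 1 := by
  refine ⟨?_, fun ξ => ?_, fun ξ => ?_⟩
  · have h1 : Continuous fun ξ : Space n => ξ j := by fun_prop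
    have h2 := continuous_epsReal (n := n) (m := m) (-1)
    unfold gradSymbol
    fun_prop
  · rw [gradSymbol, norm_mul, Complex.norm_I, mul_one, Complex.norm_real, Real.norm_eq_abs]
    refine abs_le_one_iff_mul_self_le_one.2 ?_
    rw [← sq, mul_pow, epsReal_sq]
    have h1 : |ξ j| ≤ ‖ξ‖ := PiLp.norm_apply_le ξ j
    have h2 : (2 * Real.pi * ξ j) ^ 2 ≤ epsReal n m 2 ξ := by
      rw [epsReal_two, mul_pow, mul_pow _ ‖ξ‖, ← sq_abs (ξ j)]
      have h3 : |ξ j| ^ 2 ≤ ‖ξ‖ ^ 2 := by gcongr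
      have h4 := mul_le_mul_of_nonneg_left h3 (sq_nonneg (2 * Real.pi))
      nlinarith [sq_nonneg m]
    refine (mul_le_mul_of_nonneg_right h2 (epsReal_pos _ ξ).le).trans (le_of_eq ?_)
    rw [epsReal_mul, mul_neg, mul_one, add_neg_cancel, epsReal_zero]
  · simp only [gradSymbol, map_mul, Complex.conj_ofReal, Complex.conj_I, epsReal_neg,
      PiLp.neg_apply]
    push_cast
    ring

/-- The partial derivative `∂_j : H^{s+1} → H^s`. -/
def Sobolev.partialL (j : Fin n) : Sobolev n m (s + 1) →L[ℝ] Sobolev n m s :=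
  Sobolev.mult (isSymbol_gradSymbol (m := m) j)

theorem Sobolev.dist_partialL (j : Fin n) (v : Sobolev n m (s + 1)) :
    (Sobolev.partialL j v : Sobolev n m s).dist =
      ∂_{EuclideanSpace.single j (1 : ℝ)} v.dist := by
  ext ψ
  rw [TemperedDistribution.lineDerivOp_apply_apply, Sobolev.dist_apply_eq_integral,
    Sobolev.dist_apply_eq_integral]
  refine integral_congr_ae ?_
  filter_upwards [(isSymbol_gradSymbol (m := m) j).coeFn_mulL2 v.toL2] with ξ h
  have hg : (fun x : Space n => inner ℝ x (EuclideanSpace.single j (1 : ℝ))).HasTemperateGrowth :=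
    ((innerSL ℝ).flip (EuclideanSpace.single j (1 : ℝ))).hasTemperateGrowth
  have h1 : 𝓕⁻ (-(∂_{EuclideanSpace.single j (1 : ℝ)} ψ)) ξ =
      2 * Real.pi * Complex.I * (ξ j : ℂ) * 𝓕⁻ ψ ξ := by
    rw [FourierTransform.fourierInv_neg, SchwartzMap.fourierInv_lineDerivOp_eq, neg_apply,
      smul_apply, SchwartzMap.smulLeftCLM_apply_apply hg]
    have hi : inner ℝ ξ (EuclideanSpace.single j (1 : ℝ)) = ξ j := by
      simp [EuclideanSpace.inner_single_right]
    rw [hi]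
    simp
    ring
  rw [h1, Sobolev.density, Sobolev.density, Sobolev.partialL, Sobolev.toL2_mult, h, gradSymbol,
    neg_add, ← epsReal_mul]
  push_cast
  ring

/-- The components of the map `d ↦ (φ₀, φ₁, ∂₁φ₀, …, ∂ₙφ₀)`. -/
def jetComponent (n : ℕ) (m s : ℝ) [Fact (0 < m)] :
    Option (Fin (n + 1)) → (Data n m s →L[ℝ] Sobolev n m s)
  | none => Sobolev.inclL (le_add_one' s) ∘L ContinuousLinearMap.fst ℝ _ _
  | some j => Fin.cons (α := fun _ => Data n m s →L[ℝ] Sobolev n m s)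
      (ContinuousLinearMap.snd ℝ _ _)
      (fun j => Sobolev.partialL j ∘L ContinuousLinearMap.fst ℝ _ _) j

/-- The standard basis of `ℝ × ℝ^{n+1}`. -/
def jetBasis (n : ℕ) : Option (Fin (n + 1)) → ℝ × (Fin (n + 1) → ℝ)
  | none => (1, 0)
  | some j => (0, Pi.single j 1)

theorem norm_jetBasis_le (i : Option (Fin (n + 1))) : ‖jetBasis n i‖ ≤ 1 := by
  cases i with
  | none => simp [jetBasis, Prod.norm_def]
  | some j => simp [jetBasis, Prod.norm_def, Pi.norm_single]

/-- The map `d ↦ (φ₀, φ₁, ∂₁φ₀, …, ∂ₙφ₀)(x)`. -/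
def jet (hs : (n : ℝ) / 2 < s) (x : Space n) : Data n m s →L[ℝ] ℝ × (Fin (n + 1) → ℝ) :=
  ∑ i, (Sobolev.valueL hs x ∘L jetComponent n m s i).smulRight (jetBasis n i)

theorem jet_apply (hs : (n : ℝ) / 2 < s) (x : Space n) (d : Data n m s) :
    jet hs x d = ∑ i, (jetComponent n m s i d).value x • jetBasis n i := by
  simp [jet, Sobolev.valueL_apply]

theorem jet_eq (hs : (n : ℝ) / 2 < s) (x : Space n) (d : Data n m s) :
    jet hs x d = (pointValue d.1.dist x, Fin.cons (pointValue d.2.dist x)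
      (fun j : Fin n => pointValue (∂_{EuclideanSpace.single j (1 : ℝ)} d.1.dist) x)) := by
  have h0 := ((Sobolev.incl (le_add_one' s) d.1).isContinuousRep_value hs)
  rw [Sobolev.dist_incl] at h0
  have h2 : ∀ j, IsContinuousRep (∂_{EuclideanSpace.single j (1 : ℝ)} d.1.dist)
      (Sobolev.partialL j d.1 : Sobolev n m s).value := fun j => by
    rw [← Sobolev.dist_partialL]
    exact Sobolev.isContinuousRep_value hs _
  rw [jet_apply, Fintype.sum_option, h0.pointValue_eq,
    (d.2.isContinuousRep_value hs).pointValue_eq]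
  simp only [fun j => (h2 j).pointValue_eq]
  refine Prod.ext ?_ ?_
  · simp [jetBasis, jetComponent, Prod.fst_sum, Sobolev.inclL_apply]
  · funext j
    simp only [jetBasis, jetComponent, Prod.snd_add, Prod.snd_sum, Prod.smul_snd, smul_zero,
      zero_add, Finset.sum_apply, Pi.smul_apply, Pi.single_apply, smul_eq_mul, mul_ite, mul_one,
      mul_zero, Finset.sum_ite_eq, Finset.mem_univ, if_true]
    refine Fin.cases ?_ (fun i => ?_) j
    · simp
    · simp

theorem localFun_eq (hs : (n : ℝ) / 2 < s) (W : ℝ × (Fin (n + 1) → ℝ) → ℝ) (d : Data n m s) :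
    localFun W d = fun x => W (jet hs x d) := by
  funext x
  rw [localFun, jet_eq]

theorem productConst_nonneg : 0 ≤ productConst n m s := Real.sqrt_nonneg _

theorem Sobolev.exists_prod (hs : (n : ℝ) / 2 < s) :
    ∀ (k : ℕ) (v : Fin (k + 1) → Sobolev n m s), ∃ w : Sobolev n m s,
      (∀ x, w.value x = ∏ i, (v i).value x) ∧ ‖w‖ ≤ productConst n m s ^ k * ∏ i, ‖v i‖
  | 0, v => ⟨v 0, fun x => by simp, by simp⟩
  | k + 1, v => by
    obtain ⟨w, hw, hwn⟩ := Sobolev.exists_prod hs k fun i => v i.succ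
    obtain ⟨w', hw', hwn'⟩ := Sobolev.exists_mul hs (v 0) w
    refine ⟨w', fun x => by
      rw [hw', hw, Fin.prod_univ_succ fun i => (v i).value x], hwn'.trans ?_⟩
    rw [Fin.prod_univ_succ (fun i => ‖v i‖)]
    calc productConst n m s * (‖v 0‖ * ‖w‖)
        ≤ productConst n m s * (‖v 0‖ * (productConst n m s ^ k * ∏ i : Fin (k + 1), ‖v i.succ‖)) :=
          by gcongr; exact productConst_nonneg
      _ = _ := by ring

/-- The constant in the estimate of the Taylor coefficients of the nonlinearity. -/
def nonlinConst (n : ℕ) (m s : ℝ) [Fact (0 < m)] : ℝ :=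
  (productConst n m s + 1) * ∑ i, ‖jetComponent n m s i‖

theorem nonlinConst_nonneg : 0 ≤ nonlinConst n m s :=
  mul_nonneg (add_nonneg productConst_nonneg zero_le_one)
    (Finset.sum_nonneg fun _ _ => norm_nonneg _)

/-- Expanding each argument in the basis of ℝ × ℝ^{n+1} turns p into a sum, over the maps r from
slots to basis vectors, of constants times products of components of the jets. Each such product
lies in H^s by the algebra property. -/
theorem exists_jet_term (hs : (n : ℝ) / 2 < s) {k : ℕ}
    (p : (ℝ × (Fin (n + 1) → ℝ)) [×(k + 1)]→L[ℝ] ℝ) (d : Fin (k + 1) → Data n m s) :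
    ∃ w : Sobolev n m s, (∀ x, w.value x = p fun j => jet hs x (d j)) ∧
      ‖w‖ ≤ ‖p‖ * nonlinConst n m s ^ (k + 1) * ∏ j, ‖d j‖ := by
  choose w hw hwn using fun r : Fin (k + 1) → Option (Fin (n + 1)) =>
    Sobolev.exists_prod hs k fun j => jetComponent n m s (r j) (d j)
  have hA := productConst_nonneg (n := n) (m := m) (s := s)
  refine ⟨∑ r, p (fun j => jetBasis n (r j)) • w r, fun x => ?_, ?_⟩
  · have h1 : (p fun j => jet hs x (d j)) = ∑ r : Fin (k + 1) → Option (Fin (n + 1)),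
        p fun j => (jetComponent n m s (r j) (d j)).value x • jetBasis n (r j) := by
      simp only [jet_apply]
      exact p.toMultilinearMap.map_sum _
    rw [h1, ← Sobolev.valueL_apply hs, map_sum]
    refine Finset.sum_congr rfl fun r _ => ?_
    rw [map_smul, Sobolev.valueL_apply, hw, smul_eq_mul, mul_comm]
    exact (p.toMultilinearMap.map_smul_univ _ _).symm
  · calc ‖∑ r, p (fun j => jetBasis n (r j)) • w r‖
        ≤ ∑ r : Fin (k + 1) → Option (Fin (n + 1)), ‖p‖ * ((productConst n m s ^ k *
          ∏ j, ‖d j‖) * ∏ j, ‖jetComponent n m s (r j)‖) := by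
          refine (norm_sum_le _ _).trans (Finset.sum_le_sum fun r _ => ?_)
          rw [norm_smul]
          refine mul_le_mul ?_ ((hwn r).trans ?_) (norm_nonneg _) (norm_nonneg _)
          · refine (p.le_opNorm _).trans (mul_le_of_le_one_right (norm_nonneg _) ?_)
            exact Finset.prod_le_one (fun _ _ => norm_nonneg _) fun _ _ => norm_jetBasis_le _
          · rw [mul_assoc, ← Finset.prod_mul_distrib]
            refine mul_le_mul_of_nonneg_left ?_ (by positivity)
            refine Finset.prod_le_prod (fun _ _ => norm_nonneg _) fun j _ => ?_
            rw [mul_comm]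
            exact ContinuousLinearMap.le_opNorm _ _
      _ = ‖p‖ * (productConst n m s ^ k * (∑ i, ‖jetComponent n m s i‖) ^ (k + 1)) *
          ∏ j, ‖d j‖ := by
          rw [Fintype.sum_pow, ← Finset.mul_sum, ← Finset.mul_sum]
          ring
      _ ≤ _ := by
          refine mul_le_mul_of_nonneg_right (mul_le_mul_of_nonneg_left ?_ (norm_nonneg _))
            (Finset.prod_nonneg fun _ _ => norm_nonneg _)
          rw [nonlinConst, mul_pow]
          refine mul_le_mul_of_nonneg_right ?_ (pow_nonneg
            (Finset.sum_nonneg fun _ _ => norm_nonneg _) _)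
          -- The summand 1 in `nonlinConst` makes the base at least 1, so that the exponent k of a
          -- product of k + 1 factors can be raised to k + 1.
          calc productConst n m s ^ k ≤ (productConst n m s + 1) ^ k := by gcongr; linarith
            _ ≤ (productConst n m s + 1) ^ (k + 1) :=
              pow_le_pow_right₀ (by linarith) (Nat.le_succ k)

/-- The `k`-linear map `(d_1, …, d_k) ↦ p(j d_1, …, j d_k)`, `j d = (φ₀, φ₁, ∂₁φ₀, …, ∂ₙφ₀)`. -/
def jetTerm (hs : (n : ℝ) / 2 < s) {k : ℕ} (p : (ℝ × (Fin (n + 1) → ℝ)) [×(k + 1)]→L[ℝ] ℝ) :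
    (Data n m s) [×(k + 1)]→L[ℝ] Sobolev n m s :=
  MultilinearMap.mkContinuous
    { toFun := fun d => (exists_jet_term hs p d).choose
      map_update_add' := fun d i x y => by
        apply Sobolev.ext_value hs
        intro z
        have h := fun d => (exists_jet_term (m := m) hs p d).choose_spec.1 z
        rw [h, ← Sobolev.valueL_apply hs, map_add, Sobolev.valueL_apply, Sobolev.valueL_apply,
          h, h]
        exact (p.toMultilinearMap.compLinearMap
          (fun _ => (jet hs z).toLinearMap)).map_update_add d i x y
      map_update_smul' := fun d i c x => by
        apply Sobolev.ext_value hs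
        intro z
        have h := fun d => (exists_jet_term (m := m) hs p d).choose_spec.1 z
        rw [h, ← Sobolev.valueL_apply hs, map_smul, Sobolev.valueL_apply, h]
        exact (p.toMultilinearMap.compLinearMap
          (fun _ => (jet hs z).toLinearMap)).map_update_smul d i c x }
    (‖p‖ * nonlinConst n m s ^ (k + 1)) fun d => (exists_jet_term hs p d).choose_spec.2

theorem jetTerm_value (hs : (n : ℝ) / 2 < s) {k : ℕ}
    (p : (ℝ × (Fin (n + 1) → ℝ)) [×(k + 1)]→L[ℝ] ℝ) (d : Fin (k + 1) → Data n m s)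
    (x : Space n) : (jetTerm hs p d).value x = p fun j => jet hs x (d j) :=
  (exists_jet_term hs p d).choose_spec.1 x

theorem norm_jetTerm_le (hs : (n : ℝ) / 2 < s) {k : ℕ}
    (p : (ℝ × (Fin (n + 1) → ℝ)) [×(k + 1)]→L[ℝ] ℝ) :
    ‖(jetTerm hs p : (Data n m s) [×(k + 1)]→L[ℝ] Sobolev n m s)‖ ≤
      ‖p‖ * nonlinConst n m s ^ (k + 1) :=
  MultilinearMap.mkContinuous_norm_le _
    (mul_nonneg (norm_nonneg _) (pow_nonneg nonlinConst_nonneg _)) _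

/-- The Taylor series of the nonlinearity `𝓥`, without its constant term. -/
def nonlinSeries (hs : (n : ℝ) / 2 < s)
    (p : FormalMultilinearSeries ℝ (ℝ × (Fin (n + 1) → ℝ)) ℝ) :
    FormalMultilinearSeries ℝ (Data n m s) (Sobolev n m s)
  | 0 => 0
  | k + 1 => jetTerm hs (p (k + 1))

theorem norm_nonlinSeries_le (hs : (n : ℝ) / 2 < s)
    (p : FormalMultilinearSeries ℝ (ℝ × (Fin (n + 1) → ℝ)) ℝ) (k : ℕ) :
    ‖(nonlinSeries hs p k : (Data n m s) [×k]→L[ℝ] Sobolev n m s)‖ ≤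
      ‖p k‖ * nonlinConst n m s ^ k := by
  cases k with
  | zero =>
    rw [nonlinSeries, norm_zero]
    positivity
  | succ k => exact norm_jetTerm_le hs _

variable {W : ℝ × (Fin (n + 1) → ℝ) → ℝ}
  {p : FormalMultilinearSeries ℝ (ℝ × (Fin (n + 1) → ℝ)) ℝ}

theorem summable_norm_coeff (hW : HasFPowerSeriesOnBall W p 0 ⊤) {r : ℝ} (hr : 0 ≤ r) :
    Summable fun k => ‖p k‖ * r ^ k :=
  p.summable_norm_mul_pow (r := ⟨r, hr⟩)
    (lt_of_lt_of_le ENNReal.coe_lt_top hW.r_le)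

/-- The bounds on the terms make the series converge in H^s, and evaluation at a point is continuous
there, so the sum is the pointwise Taylor series of W at the jet. `nonlinSeries` omits the constant
term of W, which is legitimate as W(0) = 0. -/
theorem isNonlin_tsum (hs : (n : ℝ) / 2 < s) (hW : HasFPowerSeriesOnBall W p 0 ⊤) (hW0 : W 0 = 0)
    (d : Data n m s) :
    IsNonlin W d (∑' k, nonlinSeries hs p k fun _ => d) ∧
      Summable fun k => (nonlinSeries hs p k fun _ => d : Sobolev n m s) := by
  have hsum : Summable fun k => (nonlinSeries hs p k fun _ => d : Sobolev n m s) := by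
    refine Summable.of_norm_bounded (summable_norm_coeff hW
      (mul_nonneg (nonlinConst_nonneg (n := n) (m := m) (s := s)) (norm_nonneg d))) fun k => ?_
    refine (ContinuousMultilinearMap.le_opNorm _ _).trans ?_
    rw [Finset.prod_const, Finset.card_univ, Fintype.card_fin, mul_pow, ← mul_assoc]
    exact mul_le_mul_of_nonneg_right (norm_nonlinSeries_le hs p k) (by positivity)
  refine ⟨?_, hsum⟩
  have hv : (∑' k, nonlinSeries hs p k fun _ => d : Sobolev n m s).value = localFun W d := by
    funext x
    rw [localFun_eq hs, ← Sobolev.valueL_apply hs]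
    have h1 := hW.hasSum (y := jet hs x d) (by simp)
    rw [zero_add] at h1
    refine ((Sobolev.valueL hs x).hasSum hsum.hasSum).unique (h1.congr_fun ?_)
    intro k
    cases k with
    | zero =>
      have h2 : p 0 (fun _ => jet hs x d) = 0 := by
        rw [← hW0, ← hW.coeff_zero fun _ => jet hs x d]
      rw [h2]
      exact map_zero _
    | succ k =>
      rw [Sobolev.valueL_apply]
      exact (jetTerm_value hs _ _ x)
  have h := (∑' k, nonlinSeries hs p k fun _ => d : Sobolev n m s).isContinuousRep_value hs
  rw [hv] at h
  exact h

theorem IsNonlin.unique {d : Data n m s} {v w : Sobolev n m s}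
    (hv : IsNonlin W d v) (hw : IsNonlin W d w) : v = w := by
  apply Sobolev.dist_injective
  ext ψ
  rw [(hv.2 ψ).2, (hw.2 ψ).2]

theorem isNonlin_nonlin {d : Data n m s} (h : ∃ v : Sobolev n m s, IsNonlin W d v) :
    IsNonlin W d (nonlin W d) := by
  rw [nonlin, dif_pos h]
  exact h.choose_spec

theorem hasSum_nonlin (hs : (n : ℝ) / 2 < s) (hW : HasFPowerSeriesOnBall W p 0 ⊤) (hW0 : W 0 = 0)
    (d : Data n m s) : HasSum (fun k => nonlinSeries hs p k fun _ => d) (nonlin W d) := by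
  obtain ⟨h1, h2⟩ := isNonlin_tsum (m := m) hs hW hW0 d
  rw [(isNonlin_nonlin ⟨_, h1⟩).unique h1]
  exact h2.hasSum

end Nonlinearity

/-! ### The free evolution -/

section Evolution

variable {n : ℕ} {m : ℝ}

/-- Dominated convergence with the bound (2C)²|g|². For bounded symbols pointwise convergence in ξ
thus suffices, which gives the strong continuity and differentiability of the free evolution. -/
theorem tendsto_mulL2 {ι : Type*} {l : Filter ι} [l.IsCountablyGenerated] {q : ι → Space n → ℂ}
    {q₀ : Space n → ℂ} {C : ℝ} (hq : ∀ i, IsSymbol (q i) C) (h₀ : IsSymbol q₀ C)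
    (h : ∀ ξ, Filter.Tendsto (fun i => q i ξ) l (nhds (q₀ ξ))) (g : L2 n) :
    Filter.Tendsto (fun i => mulL2 (q i) g) l (nhds (mulL2 q₀ g)) := by
  rw [Lp.tendsto_Lp_iff_tendsto_eLpNorm']
  have hg : Measurable fun ξ => g ξ := (Lp.stronglyMeasurable g).measurable
  have e : ∀ i, eLpNorm (⇑(mulL2 (q i) g) - ⇑(mulL2 q₀ g)) 2 volume =
      (∫⁻ ξ, ‖(q i ξ - q₀ ξ) * g ξ‖ₑ ^ 2) ^ ((1 : ℝ) / 2) := by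
    intro i
    rw [← eLpNorm_two_sq, ← ENNReal.rpow_natCast, ← ENNReal.rpow_mul]
    norm_num
    refine eLpNorm_congr_ae ?_
    filter_upwards [(hq i).coeFn_mulL2 g, h₀.coeFn_mulL2 g] with ξ h1 h2
    rw [Pi.sub_apply, h1, h2, sub_mul]
  simp only [e]
  have hz : (0 : ℝ≥0∞) = (∫⁻ _ : Space n, 0) ^ ((1 : ℝ) / 2) := by
    rw [lintegral_zero, ENNReal.zero_rpow_of_pos (by norm_num)]
  rw [hz]
  refine (ENNReal.continuous_rpow_const.tendsto _).comp ?_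
  refine tendsto_lintegral_filter_of_dominated_convergence
    (fun ξ => ENNReal.ofReal (2 * C) ^ 2 * ‖g ξ‖ₑ ^ 2) ?_ ?_ ?_ ?_
  · exact Filter.Eventually.of_forall fun i =>
      (((((hq i).continuous.sub h₀.continuous).measurable).mul hg).enorm).pow_const 2
  · refine Filter.Eventually.of_forall fun i => Filter.Eventually.of_forall fun ξ => ?_
    rw [enorm_mul, mul_pow]
    refine mul_le_mul_left (pow_le_pow_left₀ (zero_le) ?_ 2) _
    rw [← ofReal_norm]
    refine ENNReal.ofReal_le_ofReal ((norm_sub_le _ _).trans ?_)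
    linarith [(hq i).bound ξ, h₀.bound ξ]
  · rw [lintegral_const_mul _ (hg.enorm.pow_const 2), ← eLpNorm_two_sq]
    exact ENNReal.mul_ne_top (ENNReal.pow_ne_top ENNReal.ofReal_ne_top)
      (ENNReal.pow_ne_top (Lp.memLp g).2.ne)
  · refine Filter.Eventually.of_forall fun ξ => ?_
    have h1 : Filter.Tendsto (fun i => ‖(q i ξ - q₀ ξ) * g ξ‖ₑ) l (nhds 0) := by
      have h2 := (((h ξ).sub_const (q₀ ξ)).mul_const (g ξ)).enorm
      simpa using h2
    have h3 := ((ENNReal.continuous_pow 2).tendsto 0).comp h1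
    simpa [Function.comp_def] using h3

theorem mulL2_add {q r p : Space n → ℂ} {C D B : ℝ} (hq : IsSymbol q C) (hr : IsSymbol r D)
    (hp : IsSymbol p B) (h : ∀ ξ, q ξ + r ξ = p ξ) (g : L2 n) :
    mulL2 q g + mulL2 r g = mulL2 p g := by
  refine Lp.ext ?_
  filter_upwards [hq.coeFn_mulL2 g, hr.coeFn_mulL2 g, hp.coeFn_mulL2 g,
    Lp.coeFn_add (mulL2 q g) (mulL2 r g)] with ξ h1 h2 h3 h4
  rw [h4, Pi.add_apply, h1, h2, h3, ← h, add_mul]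

theorem mulL2_smul {q p : Space n → ℂ} {C B : ℝ} (hq : IsSymbol q C)
    (hp : IsSymbol p B) (c : ℝ) (h : ∀ ξ, (c : ℂ) * q ξ = p ξ) (g : L2 n) :
    c • mulL2 q g = mulL2 p g := by
  refine Lp.ext ?_
  filter_upwards [hq.coeFn_mulL2 g, hp.coeFn_mulL2 g, Lp.coeFn_smul c (mulL2 q g)] with ξ h1 h2 h3
  rw [h3, Pi.smul_apply, h1, h2, ← h, Complex.real_smul, mul_assoc]

variable [Fact (0 < m)]

/-- The symbol `cos (tε)`. -/
def cosSym (n : ℕ) (m t : ℝ) (ξ : Space n) : ℂ := (Real.cos (t * epsReal n m 1 ξ) : ℂ)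

/-- The symbol `sin (tε)`. -/
def sinSym (n : ℕ) (m t : ℝ) (ξ : Space n) : ℂ := (Real.sin (t * epsReal n m 1 ξ) : ℂ)

/-- The symbol `ε⁻¹`. -/
def invSym (n : ℕ) (m : ℝ) (ξ : Space n) : ℂ := (epsReal n m (-1) ξ : ℂ)

theorem isSymbol_cosSym (t : ℝ) : IsSymbol (cosSym n m t) 1 := by
  refine ⟨?_, fun ξ => ?_, fun ξ => ?_⟩
  · exact Complex.continuous_ofReal.comp (Real.continuous_cos.comp
      (continuous_const.mul (continuous_epsReal 1)))
  · rw [cosSym, Complex.norm_real]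
    exact Real.abs_cos_le_one _
  · rw [cosSym, cosSym, epsReal_neg, Complex.conj_ofReal]

theorem isSymbol_sinSym (t : ℝ) : IsSymbol (sinSym n m t) 1 := by
  refine ⟨?_, fun ξ => ?_, fun ξ => ?_⟩
  · exact Complex.continuous_ofReal.comp (Real.continuous_sin.comp
      (continuous_const.mul (continuous_epsReal 1)))
  · rw [sinSym, Complex.norm_real]
    exact Real.abs_sin_le_one _
  · rw [sinSym, sinSym, epsReal_neg, Complex.conj_ofReal]

theorem isSymbol_invSym : IsSymbol (invSym n m) ((m ^ 2) ^ ((-1 : ℝ) / 2)) :=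
  isSymbol_epsReal (by norm_num)

theorem IsSymbol.neg {q : Space n → ℂ} {C : ℝ} (hq : IsSymbol q C) :
    IsSymbol (fun ξ => -q ξ) C :=
  ⟨hq.continuous.neg, fun ξ => by rw [norm_neg]; exact hq.bound ξ, fun ξ => by
    rw [hq.symm, map_neg]⟩

theorem IsSymbol.add {q r : Space n → ℂ} {C D : ℝ} (hq : IsSymbol q C) (hr : IsSymbol r D) :
    IsSymbol (fun ξ => q ξ + r ξ) (C + D) :=
  ⟨hq.continuous.add hr.continuous, fun ξ => (norm_add_le _ _).trans
    (add_le_add (hq.bound ξ) (hr.bound ξ)), fun ξ => by rw [hq.symm, hr.symm, map_add]⟩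

theorem mulL2_neg {q : Space n → ℂ} {C : ℝ} (hq : IsSymbol q C) (g : L2 n) :
    mulL2 (fun ξ => -q ξ) g = -mulL2 q g := by
  rw [← neg_one_smul ℝ (mulL2 q g), mulL2_smul hq hq.neg (-1) (fun ξ => by simp)]

variable (m)

theorem cosL2_add (t r : ℝ) (g : L2 n) : mulL2 (cosSym n m (t + r)) g =
    mulL2 (cosSym n m t) (mulL2 (cosSym n m r) g) -
      mulL2 (sinSym n m t) (mulL2 (sinSym n m r) g) := by
  have hc := isSymbol_cosSym (n := n) (m := m)
  have hs := isSymbol_sinSym (n := n) (m := m)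
  rw [mulL2_mulL2 (hc t) (hc r) ((hc t).mul (hc r)) fun _ => rfl,
    mulL2_mulL2 (hs t) (hs r) ((hs t).mul (hs r)) fun _ => rfl, sub_eq_add_neg,
    ← mulL2_neg ((hs t).mul (hs r)),
    mulL2_add ((hc t).mul (hc r)) ((hs t).mul (hs r)).neg (hc (t + r))]
  intro ξ
  simp only [cosSym, sinSym, add_mul, Real.cos_add]
  push_cast
  ring

theorem sinL2_add (t r : ℝ) (g : L2 n) : mulL2 (sinSym n m (t + r)) g =
    mulL2 (sinSym n m t) (mulL2 (cosSym n m r) g) +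
      mulL2 (cosSym n m t) (mulL2 (sinSym n m r) g) := by
  have hc := isSymbol_cosSym (n := n) (m := m)
  have hs := isSymbol_sinSym (n := n) (m := m)
  rw [mulL2_mulL2 (hs t) (hc r) ((hs t).mul (hc r)) fun _ => rfl,
    mulL2_mulL2 (hc t) (hs r) ((hc t).mul (hs r)) fun _ => rfl,
    mulL2_add ((hs t).mul (hc r)) ((hc t).mul (hs r)) (hs (t + r))]
  intro ξ
  simp only [cosSym, sinSym, add_mul, Real.sin_add]
  push_cast
  ring

theorem cosL2_zero (g : L2 n) : mulL2 (cosSym n m 0) g = g := by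
  refine Lp.ext ?_
  filter_upwards [(isSymbol_cosSym (m := m) 0).coeFn_mulL2 g] with ξ h
  rw [h, cosSym]
  simp

theorem sinL2_zero (g : L2 n) : mulL2 (sinSym n m 0) g = 0 := by
  refine Lp.ext ?_
  filter_upwards [(isSymbol_sinSym (m := m) 0).coeFn_mulL2 g, Lp.coeFn_zero ℂ 2
    (volume : Measure (Space n))] with ξ h h0
  rw [h, sinSym, h0]
  simp

theorem cosL2_neg (t : ℝ) (g : L2 n) : mulL2 (cosSym n m (-t)) g = mulL2 (cosSym n m t) g := by
  have e : cosSym n m (-t) = cosSym n m t := by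
    funext ξ
    simp [cosSym]
  rw [e]

theorem sinL2_neg (t : ℝ) (g : L2 n) : mulL2 (sinSym n m (-t)) g = -mulL2 (sinSym n m t) g := by
  have e : sinSym n m (-t) = fun ξ => -sinSym n m t ξ := by
    funext ξ
    simp [sinSym]
  rw [e, mulL2_neg (isSymbol_sinSym t)]

theorem continuous_cosL2 (g : L2 n) : Continuous fun t => mulL2 (cosSym n m t) g :=
  continuous_iff_continuousAt.2 fun t => tendsto_mulL2 (fun t => isSymbol_cosSym t)
    (isSymbol_cosSym t) (fun ξ => by
      have h : Continuous fun t => cosSym n m t ξ := by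
        unfold cosSym
        fun_prop
      exact h.tendsto t) g

theorem continuous_sinL2 (g : L2 n) : Continuous fun t => mulL2 (sinSym n m t) g :=
  continuous_iff_continuousAt.2 fun t => tendsto_mulL2 (fun t => isSymbol_sinSym t)
    (isSymbol_sinSym t) (fun ξ => by
      have h : Continuous fun t => sinSym n m t ξ := by
        unfold sinSym
        fun_prop
      exact h.tendsto t) g

theorem epsReal_one_mul_inv (ξ : Space n) : epsReal n m 1 ξ * epsReal n m (-1) ξ = 1 := by
  rw [epsReal_mul, add_neg_cancel, epsReal_zero (m := m)]

/-- For a bounded function `F` with Lipschitz constant `1`, the function `F (tε) ε⁻¹` of `t` is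
strongly differentiable. -/
theorem hasDerivAt_inv_mulL2 {F F' : ℝ → ℝ} (hF : ∀ x, HasDerivAt F (F' x) x)
    (hL : ∀ x y, |F x - F y| ≤ |x - y|)
    (hS : ∀ t, IsSymbol (fun ξ : Space n => (F (t * epsReal n m 1 ξ) : ℂ)) 1)
    (hS' : ∀ t, IsSymbol (fun ξ : Space n => (F' (t * epsReal n m 1 ξ) : ℂ)) 1) (g : L2 n)
    (t : ℝ) :
    HasDerivAt (fun t => mulL2 (invSym n m) (mulL2 (fun ξ => (F (t * epsReal n m 1 ξ) : ℂ)) g))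
      (mulL2 (fun ξ => (F' (t * epsReal n m 1 ξ) : ℂ)) g) t := by
  -- The difference quotients are symbols with the common bound 1: the Lipschitz condition yields |r
  -- - t| ε, which the inverse of r - t and ε^{-1} cancel. At r = t the inverse is 0 by convention.
  have hd : ∀ r, IsSymbol (fun ξ : Space n =>
      (((r - t)⁻¹ * (epsReal n m (-1) ξ * (F (r * epsReal n m 1 ξ) - F (t * epsReal n m 1 ξ))) : ℝ)
        : ℂ)) 1 := by
    intro r
    refine ⟨?_, fun ξ => ?_, fun ξ => ?_⟩
    · have h1 := fun r => Complex.continuous_re.comp (hS r).continuous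
      simp only [Function.comp_def, Complex.ofReal_re] at h1
      exact Complex.continuous_ofReal.comp (continuous_const.mul
        ((continuous_epsReal _).mul ((h1 r).sub (h1 t))))
    · rw [Complex.norm_real, Real.norm_eq_abs, abs_mul, abs_mul, abs_of_pos (epsReal_pos (-1) ξ)]
      have h1 := hL (r * epsReal n m 1 ξ) (t * epsReal n m 1 ξ)
      rw [← sub_mul, abs_mul, abs_of_pos (epsReal_pos 1 ξ)] at h1
      calc |(r - t)⁻¹| * (epsReal n m (-1) ξ * |F (r * epsReal n m 1 ξ) - F (t * epsReal n m 1 ξ)|)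
          ≤ |(r - t)⁻¹| * (epsReal n m (-1) ξ * (|r - t| * epsReal n m 1 ξ)) := by
            have := (epsReal_pos (m := m) (-1) ξ).le
            gcongr
        _ = |(r - t)⁻¹| * |r - t| * (epsReal n m 1 ξ * epsReal n m (-1) ξ) := by ring
        _ ≤ 1 := by
            rw [epsReal_one_mul_inv, mul_one, ← abs_mul]
            rcases eq_or_ne (r - t) 0 with h | h
            · simp [h]
            · rw [inv_mul_cancel₀ h, abs_one]
    · have h2 := fun r => (hS r).symm ξ
      simp only [epsReal_neg] at h2 ⊢
      rw [Complex.conj_ofReal]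
  rw [hasDerivAt_iff_tendsto_slope]
  have e : ∀ r, slope (fun t => mulL2 (invSym n m)
      (mulL2 (fun ξ => (F (t * epsReal n m 1 ξ) : ℂ)) g)) t r =
      mulL2 (fun ξ : Space n => (((r - t)⁻¹ * (epsReal n m (-1) ξ *
        (F (r * epsReal n m 1 ξ) - F (t * epsReal n m 1 ξ))) : ℝ) : ℂ)) g := by
    intro r
    have hi := isSymbol_invSym (n := n) (m := m)
    rw [slope_def_module, mulL2_mulL2 hi (hS r) (hi.mul (hS r)) fun _ => rfl,
      mulL2_mulL2 hi (hS t) (hi.mul (hS t)) fun _ => rfl, sub_eq_add_neg (mulL2 _ g),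
      ← mulL2_neg (hi.mul (hS t)), mulL2_add (hi.mul (hS r)) (hi.mul (hS t)).neg
        ((hi.mul (hS r)).add (hi.mul (hS t)).neg) fun _ => rfl,
      mulL2_smul ((hi.mul (hS r)).add (hi.mul (hS t)).neg) (hd r)]
    intro ξ
    simp only [invSym]
    push_cast
    ring
  simp only [funext e]
  refine tendsto_mulL2 hd (hS' t) (fun ξ => ?_) g
  refine (Complex.continuous_ofReal.tendsto _).comp ?_
  have h1 : HasDerivAt (fun r => epsReal n m (-1) ξ * F (r * epsReal n m 1 ξ))
      (F' (t * epsReal n m 1 ξ)) t := by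
    have h2 := ((hF (t * epsReal n m 1 ξ)).comp t
      ((hasDerivAt_id t).mul_const (epsReal n m 1 ξ))).const_mul (epsReal n m (-1) ξ)
    refine h2.congr_deriv ?_
    rw [one_mul, mul_left_comm, mul_comm (epsReal n m (-1) ξ), epsReal_one_mul_inv, mul_one]
  refine (hasDerivAt_iff_tendsto_slope.1 h1).congr fun r => ?_
  rw [slope_def_module, smul_eq_mul]
  ring

theorem hasDerivAt_inv_cosL2 (g : L2 n) (t : ℝ) :
    HasDerivAt (fun t => mulL2 (invSym n m) (mulL2 (cosSym n m t) g))
      (-mulL2 (sinSym n m t) g) t := by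
  have e : -mulL2 (sinSym n m t) g =
      mulL2 (fun ξ : Space n => ((-Real.sin (t * epsReal n m 1 ξ) : ℝ) : ℂ)) g := by
    rw [← mulL2_neg (isSymbol_sinSym t)]
    congr 2
    funext ξ
    simp [sinSym]
  rw [e]
  refine hasDerivAt_inv_mulL2 m (F := Real.cos) (F' := fun x => -Real.sin x) Real.hasDerivAt_cos
    Real.abs_cos_sub_cos_le isSymbol_cosSym (fun t => ?_) g t
  have h := (isSymbol_sinSym (n := n) (m := m) t).neg
  simpa [sinSym] using h

theorem hasDerivAt_inv_sinL2 (g : L2 n) (t : ℝ) :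
    HasDerivAt (fun t => mulL2 (invSym n m) (mulL2 (sinSym n m t) g))
      (mulL2 (cosSym n m t) g) t :=
  hasDerivAt_inv_mulL2 m (F := Real.sin) (F' := Real.cos) Real.hasDerivAt_sin
    Real.abs_sin_sub_sin_le isSymbol_sinSym isSymbol_cosSym g t

variable {m} {s : ℝ}

/-- The free evolution by the time `t`. -/
def evo (t : ℝ) : Data n m s →L[ℝ] Data n m s :=
  (Sobolev.mult (isSymbol_cosSym (m := m) t) ∘L ContinuousLinearMap.fst ℝ _ _ +
    Sobolev.mult (isSymbol_sinSym (m := m) t) ∘L ContinuousLinearMap.snd ℝ _ _).prod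
  (Sobolev.mult (isSymbol_cosSym (m := m) t) ∘L ContinuousLinearMap.snd ℝ _ _ -
    Sobolev.mult (isSymbol_sinSym (m := m) t) ∘L ContinuousLinearMap.fst ℝ _ _)

/-- The weights ε^{s+1} and ε^s absorb the factors ε and ε^{-1} of the Klein–Gordon propagator,
which becomes the rotation by the angle tε on L² × L². The group law is then the addition theorem
for cosine and sine. -/
theorem toL2_evo_fst (t : ℝ) (d : Data n m s) : (evo t d).1.toL2 =
    mulL2 (cosSym n m t) d.1.toL2 + mulL2 (sinSym n m t) d.2.toL2 := by
  rw [← Sobolev.toL2_mult (σ := s + 1) (τ := s + 1) (isSymbol_cosSym t),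
    ← Sobolev.toL2_mult (σ := s) (τ := s + 1) (isSymbol_sinSym t), ← map_add]
  rfl

theorem toL2_evo_snd (t : ℝ) (d : Data n m s) : (evo t d).2.toL2 =
    mulL2 (cosSym n m t) d.2.toL2 - mulL2 (sinSym n m t) d.1.toL2 := by
  rw [← Sobolev.toL2_mult (σ := s) (τ := s) (isSymbol_cosSym t),
    ← Sobolev.toL2_mult (σ := s + 1) (τ := s) (isSymbol_sinSym t), ← map_sub]
  rfl

theorem data_ext {d e : Data n m s} (h1 : d.1.toL2 = e.1.toL2) (h2 : d.2.toL2 = e.2.toL2) :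
    d = e :=
  Prod.ext (Sobolev.toL2_injective h1) (Sobolev.toL2_injective h2)

theorem evo_evo (t r : ℝ) (d : Data n m s) : evo t (evo r d) = evo (t + r) d := by
  refine data_ext ?_ ?_
  · rw [toL2_evo_fst, toL2_evo_fst, toL2_evo_snd, toL2_evo_fst, cosL2_add, sinL2_add, map_add,
      map_sub]
    abel
  · rw [toL2_evo_snd, toL2_evo_snd, toL2_evo_snd, toL2_evo_fst, cosL2_add, sinL2_add, map_add,
      map_sub]
    abel

theorem evo_zero (d : Data n m s) : evo 0 d = d := by
  refine data_ext ?_ ?_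
  · rw [toL2_evo_fst, cosL2_zero, sinL2_zero, add_zero]
  · rw [toL2_evo_snd, cosL2_zero, sinL2_zero, sub_zero]

theorem evo_evo_neg (t : ℝ) (d : Data n m s) : evo t (evo (-t) d) = d := by
  rw [evo_evo, add_neg_cancel, evo_zero]

theorem evo_neg_evo (t : ℝ) (d : Data n m s) : evo (-t) (evo t d) = d := by
  rw [evo_evo, neg_add_cancel, evo_zero]

/-- Data carry the maximum norm, for which the rotation is not isometric; each component of the
result is bounded by the sum of the two norms. This is how `dataNorm` enters as the argument of the
majorants. -/
theorem norm_evo_apply_le (t : ℝ) (d : Data n m s) : ‖evo t d‖ ≤ dataNorm d := by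
  have hc := (isSymbol_cosSym (n := n) (m := m) t)
  have hs := (isSymbol_sinSym (n := n) (m := m) t)
  have h1 := hc.norm_mulL2_le d.1.toL2
  have h2 := hc.norm_mulL2_le d.2.toL2
  have h3 := hs.norm_mulL2_le d.1.toL2
  have h4 := hs.norm_mulL2_le d.2.toL2
  rw [one_mul, ← Sobolev.norm_def] at h1 h2 h3 h4
  refine norm_prod_le_iff.2 ⟨?_, ?_⟩
  · rw [Sobolev.norm_def, toL2_evo_fst]
    exact (norm_add_le _ _).trans (add_le_add h1 h4)
  · rw [Sobolev.norm_def, toL2_evo_snd, dataNorm]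
    exact (norm_sub_le _ _).trans ((add_le_add h2 h3).trans (add_comm _ _).le)

theorem dataNorm_le (d : Data n m s) : dataNorm d ≤ 2 * ‖d‖ := by
  have h1 := norm_fst_le d
  have h2 := norm_snd_le d
  rw [dataNorm]
  linarith

theorem norm_evo_le (t : ℝ) (d : Data n m s) : ‖evo t d‖ ≤ 2 * ‖d‖ :=
  (norm_evo_apply_le t d).trans (dataNorm_le d)

theorem continuous_toSobolev {X : Type*} [TopologicalSpace X] {f : X → Sobolev n m s}
    (h : Continuous fun x => (f x).toL2) : Continuous f :=
  (Sobolev.toL2I (n := n) (m := m) (s := s)).isometry.isEmbedding.continuous_iff.2 h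

theorem continuous_evo_apply (d : Data n m s) : Continuous fun t => evo t d := by
  refine Continuous.prodMk (f := fun t => (evo t d).1) (g := fun t => (evo t d).2)
    (continuous_toSobolev ?_) (continuous_toSobolev ?_)
  · simp only [toL2_evo_fst]
    exact (continuous_cosL2 m _).add (continuous_sinL2 m _)
  · simp only [toL2_evo_snd]
    exact (continuous_cosL2 m _).sub (continuous_sinL2 m _)

/-- A bounded and strongly continuous family of operators is jointly continuous. -/
theorem continuousAt_strong {X E F : Type*} [TopologicalSpace X] [NormedAddCommGroup E]
    [NormedAddCommGroup F] {T : X → E →+ F} {C : ℝ} (hb : ∀ r x, ‖T r x‖ ≤ C * ‖x‖) {x : X → E}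
    {t : X} (hT : ContinuousAt (fun r => T r (x t)) t) (hx : ContinuousAt x t) :
    ContinuousAt (fun r => T r (x r)) t := by
  have h1 : Filter.Tendsto (fun r => T r (x r - x t)) (nhds t) (nhds 0) := by
    refine squeeze_zero_norm (fun r => hb r _) ?_
    have h2 : ContinuousAt (fun r => C * ‖x r - x t‖) t :=
      continuousAt_const.mul ((hx.sub continuousAt_const).norm)
    simpa [ContinuousAt] using h2
  have h3 := Filter.Tendsto.add hT h1
  simpa [ContinuousAt] using h3

theorem continuous_evo : Continuous fun x : ℝ × Data n m s => evo x.1 x.2 := by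
  rw [continuous_iff_continuousAt]
  intro x
  exact continuousAt_strong
    (T := fun y : ℝ × Data n m s => (evo y.1 : Data n m s →L[ℝ] Data n m s).toLinearMap.toAddMonoidHom)
    (fun r d => norm_evo_le r.1 d)
    ((continuous_evo_apply x.2).comp continuous_fst).continuousAt continuous_snd.continuousAt

end Evolution

/-! ### Weak equations in time -/

section WeakTime

variable {I : Set ℝ}

/-- The smooth functions with compact support in `I`. -/
structure IsTest (I : Set ℝ) (χ : ℝ → ℝ) : Prop where
  smooth : ContDiff ℝ ∞ χ
  compact : HasCompactSupport χ
  subset : tsupport χ ⊆ I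

theorem IsTest.deriv {χ : ℝ → ℝ} (h : IsTest I χ) : IsTest I (deriv χ) :=
  ⟨(contDiff_infty_iff_deriv.1 h.smooth).2, h.compact.deriv,
    tsupport_deriv_subset.trans h.subset⟩

theorem IsTest.hasDerivAt {χ : ℝ → ℝ} (h : IsTest I χ) (t : ℝ) : HasDerivAt χ (_root_.deriv χ t) t :=
  ((contDiff_infty_iff_deriv.1 h.smooth).1 t).hasDerivAt

theorem tsupport_ofReal_mul_subset (χ : ℝ → ℝ) (k : ℝ → ℂ) :
    tsupport (fun t => (χ t : ℂ) * k t) ⊆ tsupport χ := by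
  refine closure_mono fun t ht => ?_
  rw [Function.mem_support] at ht ⊢
  intro h
  rw [h] at ht
  simp at ht

theorem IsTest.integrable {χ : ℝ → ℝ} (h : IsTest I χ) (hI : IsOpen I) {k : ℝ → ℂ}
    (hk : ContinuousOn k I) : Integrable fun t => (χ t : ℂ) * k t := by
  have hs := tsupport_ofReal_mul_subset χ k
  refine Continuous.integrable_of_hasCompactSupport ?_ ?_
  · refine ContinuousOn.continuous_of_tsupport_subset ?_ hI (hs.trans h.subset)
    exact (Complex.continuous_ofReal.comp h.smooth.continuous).continuousOn.mul hk
  · exact h.compact.of_isClosed_subset (isClosed_tsupport _) hs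

theorem IsTest.integral_deriv_mul {χ : ℝ → ℝ} (h : IsTest I χ) (hI : IsOpen I) {k k' : ℝ → ℂ}
    (hk : ∀ t ∈ I, HasDerivAt k (k' t) t) (hk' : ContinuousOn k' I) :
    ∫ t, ((_root_.deriv χ t : ℝ) : ℂ) * k t = -∫ t, (χ t : ℂ) * k' t := by
  have hkc : ContinuousOn k I := fun t ht => (hk t ht).continuousAt.continuousWithinAt
  have hd : ∀ t, HasDerivAt (fun t => (χ t : ℂ) * k t)
      (((_root_.deriv χ t : ℝ) : ℂ) * k t + (χ t : ℂ) * k' t) t := by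
    intro t
    by_cases ht : t ∈ I
    · exact ((h.hasDerivAt t).ofReal_comp).mul (hk t ht)
    · have ht' : t ∉ tsupport χ := fun h' => ht (h.subset h')
      have h0 : (fun t => (χ t : ℂ) * k t) =ᶠ[nhds t] fun _ => 0 := by
        filter_upwards [notMem_tsupport_iff_eventuallyEq.1 ht'] with r hr
        rw [hr]
        simp
      have h1 : χ t = 0 := image_eq_zero_of_notMem_tsupport ht'
      have h2 : _root_.deriv χ t = 0 :=
        image_eq_zero_of_notMem_tsupport fun h' => ht' (tsupport_deriv_subset h')
      rw [h1, h2]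
      simpa using (hasDerivAt_const t (0 : ℂ)).congr_of_eventuallyEq h0
  have i1 := h.deriv.integrable hI hkc
  have i2 := h.integrable hI hk'
  have h3 := integral_eq_zero_of_hasDerivAt_of_integrable hd (i1.add i2) (h.integrable hI hkc)
  rw [integral_add i1 i2] at h3
  exact eq_neg_of_add_eq_zero_left h3

/-- The du Bois-Reymond lemma. A fixed η of positive integral determines the constant c as the
η-mean of G. Any test function is a multiple of η plus a function of integral zero, and the latter
is the derivative of a test function. -/
theorem eq_of_integral_deriv_mul_eq_zero (hI : IsOpen I) (hc : I.OrdConnected) {G : ℝ → ℂ}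
    (hG : ContinuousOn G I)
    (h : ∀ χ, IsTest I χ → ∫ t, ((deriv χ t : ℝ) : ℂ) * G t = 0) {t t₀ : ℝ} (ht : t ∈ I)
    (ht₀ : t₀ ∈ I) : G t = G t₀ := by
  obtain ⟨η, hη1, hη2, hη3, hη4, hη5⟩ := exists_contDiff_tsupport_subset (n := ⊤) (hI.mem_nhds ht₀)
  have hηI : IsTest I η := ⟨hη3, hη2, hη1⟩
  have hηp : 0 < ∫ r, η r := by
    refine Continuous.integral_pos_of_hasCompactSupport_nonneg_nonzero (x := t₀) hη3.continuous hη2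
      (fun r => (hη4 (Set.mem_range_self r)).1) ?_
    rw [hη5]
    exact one_ne_zero
  set c : ℂ := (∫ r, (η r : ℂ) * G r) / ((∫ r, η r : ℝ) : ℂ) with hcdef
  suffices hs : ∀ r ∈ I, G r - c = 0 by
    rw [sub_eq_zero.1 (hs t ht), sub_eq_zero.1 (hs t₀ ht₀)]
  have hGc : ContinuousOn (fun r => G r - c) I := hG.sub continuousOn_const
  have hae : ∀ᵐ r, r ∈ I → G r - c = 0 := by
    refine hI.ae_eq_zero_of_integral_contDiff_smul_eq_zero
      (hGc.locallyIntegrableOn hI.measurableSet) fun θ h1 h2 h3 => ?_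
    have hθ : IsTest I θ := ⟨h1, h2, h3⟩
    have hK : IsCompact (tsupport θ ∪ tsupport η) := h2.isCompact.union hη2.isCompact
    have hKn : (tsupport θ ∪ tsupport η).Nonempty :=
      ⟨t₀, Or.inr (subset_tsupport _ (by rw [Function.mem_support, hη5]; exact one_ne_zero))⟩
    have hKI : tsupport θ ∪ tsupport η ⊆ I := Set.union_subset h3 hη1
    obtain ⟨a, ha, hal⟩ := hK.exists_isLeast hKn
    obtain ⟨b, hb, hbl⟩ := hK.exists_isGreatest hKn
    set w : ℝ → ℝ := fun r => θ r - (∫ r, θ r) / (∫ r, η r) * η r with hw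
    have hws : ContDiff ℝ ∞ w := h1.sub (contDiff_const.mul hη3)
    have hw0 : ∀ r, r ∉ Set.Icc a b → w r = 0 := by
      intro r hr
      have hr' : r ∉ tsupport θ ∪ tsupport η := fun h' => hr ⟨hal h', hbl h'⟩
      rw [Set.mem_union, not_or] at hr'
      simp only [hw]
      rw [image_eq_zero_of_notMem_tsupport hr'.1, image_eq_zero_of_notMem_tsupport hr'.2]
      ring
    have iθ : Integrable θ := h1.continuous.integrable_of_hasCompactSupport h2
    have iη : Integrable η := hη3.continuous.integrable_of_hasCompactSupport hη2
    have hwi : ∫ r, w r = 0 := by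
      simp only [hw]
      rw [integral_sub iθ (iη.const_mul _), integral_const_mul, div_mul_cancel₀ _ hηp.ne', sub_self]
    have hχd : ∀ t, HasDerivAt (fun t => ∫ r in a..t, w r) (w t) t := fun t =>
      intervalIntegral.integral_hasDerivAt_right (hws.continuous.intervalIntegrable _ _)
        (hws.continuous.stronglyMeasurableAtFilter _ _) hws.continuous.continuousAt
    have hχe : deriv (fun t => ∫ r in a..t, w r) = w := funext fun t => (hχd t).deriv
    -- The primitive of w vanishes to the left of a because w does, and to the right of b because
    -- the total integral of w is zero. Order connectedness keeps [a, b] inside I.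
    have hχ0 : ∀ t, t ∉ Set.Icc a b → ∫ r in a..t, w r = 0 := by
      intro t ht
      rw [Set.mem_Icc, not_and_or, not_le, not_le] at ht
      rcases ht with ht | ht
      · rw [intervalIntegral.integral_symm, intervalIntegral.integral_of_le ht.le,
          ← integral_Icc_eq_integral_Ioc, integral_Icc_eq_integral_Ico, neg_eq_zero]
        exact setIntegral_eq_zero_of_forall_eq_zero fun r hr => hw0 r fun h' =>
          absurd h'.1 (not_le.2 hr.2)
      · have e : ∀ r, r ∉ Set.Icc a t → w r = 0 := fun r hr => hw0 r fun h' =>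
          hr ⟨h'.1, h'.2.trans ht.le⟩
        rw [intervalIntegral.integral_of_le ((hbl ha).trans ht.le),
          ← integral_Icc_eq_integral_Ioc, setIntegral_eq_integral_of_forall_compl_eq_zero e, hwi]
    have hsub : tsupport (fun t => ∫ r in a..t, w r) ⊆ Set.Icc a b := by
      refine closure_minimal (fun r hr => ?_) isClosed_Icc
      by_contra h'
      exact hr (hχ0 r h')
    have hχ : IsTest I (fun t => ∫ r in a..t, w r) := by
      refine ⟨contDiff_infty_iff_deriv.2 ⟨fun t => (hχd t).differentiableAt, ?_⟩,
        isCompact_Icc.of_isClosed_subset (isClosed_tsupport _) hsub,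
        hsub.trans (hc.out (hKI ha) (hKI hb))⟩
      rw [hχe]
      exact hws
    have h4 := h _ hχ
    rw [hχe] at h4
    have j1 := hθ.integrable hI hG
    have j2 := hηI.integrable hI hG
    have e5 : ∀ r, (w r : ℂ) * G r = (θ r : ℂ) * G r -
        (((∫ r, θ r) / (∫ r, η r) : ℝ) : ℂ) * ((η r : ℂ) * G r) := by
      intro r
      simp only [hw]
      push_cast
      ring
    simp only [e5] at h4
    rw [integral_sub j1 (j2.const_mul _), integral_const_mul] at h4
    have e6 : ∀ r, θ r • (G r - c) = (θ r : ℂ) * G r - (θ r : ℂ) * c := by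
      intro r
      rw [Complex.real_smul]
      ring
    simp only [e6]
    have j3 : Integrable fun r => (θ r : ℂ) := iθ.ofReal
    rw [integral_sub j1 (j3.mul_const _), integral_mul_const, integral_complex_ofReal,
      ← h4, hcdef]
    have hne : ((∫ r, η r : ℝ) : ℂ) ≠ 0 := Complex.ofReal_ne_zero.2 hηp.ne'
    push_cast
    field_simp
  have h7 := Measure.eqOn_open_of_ae_eq (f := fun r => G r - c) (g := fun _ => 0)
    ((ae_restrict_iff' hI.measurableSet).2 hae) hI hGc continuousOn_const
  exact fun r hr => h7 hr

variable {F : Type*} [NormedAddCommGroup F] [NormedSpace ℝ F] [CompleteSpace F]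

theorem intervalIntegrable_of_continuousOn (hc : I.OrdConnected) {φ : ℝ → F}
    (hφ : ContinuousOn φ I) {t t₀ : ℝ} (ht : t ∈ I) (ht₀ : t₀ ∈ I) :
    IntervalIntegrable φ volume t₀ t :=
  (hφ.mono (hc.uIcc_subset ht₀ ht)).intervalIntegrable

theorem hasDerivAt_integral_of_continuousOn (hI : IsOpen I) (hc : I.OrdConnected) {φ : ℝ → F}
    (hφ : ContinuousOn φ I) {t t₀ : ℝ} (ht : t ∈ I) (ht₀ : t₀ ∈ I) :
    HasDerivAt (fun t => ∫ r in t₀..t, φ r) (φ t) t :=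
  intervalIntegral.integral_hasDerivAt_right (intervalIntegrable_of_continuousOn hc hφ ht ht₀)
    (hφ.stronglyMeasurableAtFilter hI t ht) (hφ.continuousAt (hI.mem_nhds ht))

theorem hasDerivAt_of_sub_eq_integral (hI : IsOpen I) (hc : I.OrdConnected) {φ G : ℝ → F}
    (hφ : ContinuousOn φ I) {t t₀ : ℝ} (ht : t ∈ I) (ht₀ : t₀ ∈ I)
    (h : ∀ t ∈ I, G t - G t₀ = ∫ r in t₀..t, φ r) : HasDerivAt G (φ t) t := by
  refine ((hasDerivAt_integral_of_continuousOn hI hc hφ ht ht₀).add_const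
    (G t₀)).congr_of_eventuallyEq ?_
  filter_upwards [hI.mem_nhds ht] with r hr
  rw [← h r hr, sub_add_cancel]

theorem sub_eq_integral_of_hasDerivAt (hc : I.OrdConnected) {φ G : ℝ → F}
    (hφ : ContinuousOn φ I) (h : ∀ t ∈ I, HasDerivAt G (φ t) t) {t t₀ : ℝ} (ht : t ∈ I)
    (ht₀ : t₀ ∈ I) : G t - G t₀ = ∫ r in t₀..t, φ r :=
  (intervalIntegral.integral_eq_sub_of_hasDerivAt (fun r hr => h r (hc.uIcc_subset ht₀ ht hr))
    (intervalIntegrable_of_continuousOn hc hφ ht ht₀)).symm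

/-- A function `f` with `f'' + h = 0` in the sense of distributions. -/
theorem deriv_sub_eq_integral_of_weak (hI : IsOpen I) (hc : I.OrdConnected) {f g h : ℝ → ℂ}
    (hf : ∀ t ∈ I, HasDerivAt f (g t) t) (hg : ContinuousOn g I) (hh : ContinuousOn h I)
    (hw : ∀ χ, IsTest I χ → ∫ t, (((deriv (deriv χ) t : ℝ) : ℂ) * f t + (χ t : ℂ) * h t) = 0)
    {t t₀ : ℝ} (ht : t ∈ I) (ht₀ : t₀ ∈ I) : g t - g t₀ = -∫ r in t₀..t, h r := by
  have hfc : ContinuousOn f I := fun t ht => (hf t ht).continuousAt.continuousWithinAt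
  have hH : ∀ t ∈ I, HasDerivAt (fun t => ∫ r in t₀..t, h r) (h t) t := fun t ht =>
    hasDerivAt_integral_of_continuousOn hI hc hh ht ht₀
  have hHc : ContinuousOn (fun t => ∫ r in t₀..t, h r) I := fun t ht =>
    (hH t ht).continuousAt.continuousWithinAt
  -- The weak equation says that g plus the primitive of h has zero distributional derivative.
  have key := eq_of_integral_deriv_mul_eq_zero hI hc (G := fun t => g t + ∫ r in t₀..t, h r)
    (hg.add hHc) (fun χ hχ => ?_) ht ht₀
  · simp only [intervalIntegral.integral_same, add_zero] at key
    rw [← key]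
    ring
  · have h1 := hw χ hχ
    rw [integral_add (hχ.deriv.deriv.integrable hI hfc) (hχ.integrable hI hh),
      hχ.deriv.integral_deriv_mul hI hf hg] at h1
    simp only [mul_add]
    rw [integral_add (hχ.deriv.integrable hI hg) (hχ.deriv.integrable hI hHc),
      hχ.integral_deriv_mul hI hH hh]
    linear_combination -h1

theorem weak_of_hasDerivAt (hI : IsOpen I) {f g h : ℝ → ℂ}
    (hf : ∀ t ∈ I, HasDerivAt f (g t) t) (hg : ∀ t ∈ I, HasDerivAt g (-h t) t)
    (hh : ContinuousOn h I) {χ : ℝ → ℝ} (hχ : IsTest I χ) :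
    ∫ t, (((deriv (deriv χ) t : ℝ) : ℂ) * f t + (χ t : ℂ) * h t) = 0 := by
  have hfc : ContinuousOn f I := fun t ht => (hf t ht).continuousAt.continuousWithinAt
  have hgc : ContinuousOn g I := fun t ht => (hg t ht).continuousAt.continuousWithinAt
  rw [integral_add (hχ.deriv.deriv.integrable hI hfc) (hχ.integrable hI hh),
    hχ.deriv.integral_deriv_mul hI hf hgc, hχ.integral_deriv_mul hI hg hh.neg]
  simp [integral_neg]

/-- The product rule for a strongly differentiable bounded family of operators. -/
theorem hasDerivAt_strong {E E' : Type*} [NormedAddCommGroup E] [NormedSpace ℝ E]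
    [NormedAddCommGroup E'] [NormedSpace ℝ E'] {T : ℝ → E →ₗ[ℝ] E'} {C : ℝ}
    (hb : ∀ r x, ‖T r x‖ ≤ C * ‖x‖) {x : ℝ → E} {x' : E} {y : E'} {t : ℝ}
    (hc : ∀ z, ContinuousAt (fun r => T r z) t) (hT : HasDerivAt (fun r => T r (x t)) y t)
    (hx : HasDerivAt x x' t) : HasDerivAt (fun r => T r (x r)) (y + T t x') t := by
  -- T_r x_r splits as T_r x_t + T_r(x_r - x_t). The slope of the second part is T_r applied to the
  -- slope of x, and it converges because the T_r are uniformly bounded and strongly continuous.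
  have h1 : HasDerivAt (fun r => T r (x r - x t)) (T t x') t := by
    rw [hasDerivAt_iff_tendsto_slope]
    have e : ∀ r, slope (fun r => T r (x r - x t)) t r = T r (slope x t r) := by
      intro r
      rw [slope_def_module, slope_def_module, sub_self, map_zero, sub_zero, map_smul]
    simp only [funext e]
    have h2 := hasDerivAt_iff_tendsto_slope.1 hx
    have h3 : Filter.Tendsto (fun r => T r (slope x t r - x')) (nhdsWithin t {t}ᶜ) (nhds 0) := by
      refine squeeze_zero_norm (fun r => hb r _) ?_
      simpa using ((h2.sub_const x').norm).const_mul C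
    have h4 := h3.add ((hc x').tendsto.mono_left nhdsWithin_le_nhds)
    simpa using h4
  have h5 := hT.add h1
  refine h5.congr_of_eventuallyEq (Filter.Eventually.of_forall fun r => ?_)
  simp

end WeakTime

/-! ### Weak solutions in the interaction picture -/

section WeakStrong

variable {n : ℕ} {m : ℝ}

/-- Integration against a Schwartz function. -/
def pairL2 (θ : 𝓢(Space n, ℂ)) : L2 n →L[ℂ] ℂ :=
  PointwiseConvergenceCLM.evalCLM (RingHom.id ℂ) ℂ θ ∘L
    Lp.toTemperedDistributionCLM ℂ (volume : Measure (Space n)) 2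

theorem pairL2_eq (θ : 𝓢(Space n, ℂ)) (g : L2 n) : pairL2 θ g = (g : 𝓢'(Space n, ℂ)) θ := by
  rw [pairL2, ContinuousLinearMap.comp_apply, Lp.toTemperedDistributionCLM_apply]
  rfl

theorem pairL2_apply (θ : 𝓢(Space n, ℂ)) (g : L2 n) : pairL2 θ g = ∫ ξ, θ ξ * g ξ := by
  rw [pairL2_eq, toDist_apply]

theorem pairL2_ext {g h : L2 n} (H : ∀ θ, pairL2 θ g = pairL2 θ h) : g = h := by
  apply toDist_injective
  ext θ
  rw [← pairL2_eq, ← pairL2_eq, H]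

theorem fourierInv_laplacian (ψ : 𝓢(Space n, ℂ)) (ξ : Space n) :
    𝓕⁻ (Δ ψ) ξ = -((2 * Real.pi * ‖ξ‖) ^ 2 : ℝ) * 𝓕⁻ ψ ξ := by
  have hg : ∀ j : Fin n, (fun x : Space n =>
      inner ℝ x (EuclideanSpace.single j (1 : ℝ))).HasTemperateGrowth := fun j =>
    ((innerSL ℝ).flip (EuclideanSpace.single j (1 : ℝ))).hasTemperateGrowth
  have hi : ∀ j, inner ℝ ξ (EuclideanSpace.single j (1 : ℝ)) = ξ j := fun j => by
    simp [EuclideanSpace.inner_single_right]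
  have h1 : ∀ (j : Fin n) (ψ : 𝓢(Space n, ℂ)), 𝓕⁻ (∂_{EuclideanSpace.single j (1 : ℝ)} ψ) ξ =
      -(2 * Real.pi * Complex.I * (ξ j : ℂ)) * 𝓕⁻ ψ ξ := by
    intro j ψ
    rw [SchwartzMap.fourierInv_lineDerivOp_eq, smul_apply,
      SchwartzMap.smulLeftCLM_apply_apply (hg j), hi]
    simp
    ring
  have h2 : 𝓕⁻ (Δ ψ) = ∑ j : Fin n, 𝓕⁻ (∂_{EuclideanSpace.single j (1 : ℝ)}
      (∂_{EuclideanSpace.single j (1 : ℝ)} ψ)) := by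
    rw [SchwartzMap.laplacian_eq_sum (EuclideanSpace.basisFun (Fin n) ℝ)]
    simp only [EuclideanSpace.basisFun_apply]
    exact map_sum (FourierTransform.fourierInvCLM ℂ 𝓢(Space n, ℂ)) _ _
  rw [h2, sum_apply]
  simp only [h1]
  rw [mul_pow, EuclideanSpace.real_norm_sq_eq]
  push_cast
  rw [Finset.mul_sum, ← Finset.sum_neg_distrib, Finset.sum_mul]
  refine Finset.sum_congr rfl fun j _ => ?_
  linear_combination (2 * (Real.pi : ℂ) * (ξ j : ℂ)) ^ 2 * 𝓕⁻ ψ ξ * Complex.I_sq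

variable [Fact (0 < m)] {s : ℝ}

theorem Sobolev.dist_eq_pairL2 (v : Sobolev n m s) (ψ : 𝓢(Space n, ℂ)) :
    v.dist ψ = pairL2 (testFun m s ψ) v.toL2 := by
  rw [Sobolev.dist_apply, pairL2_eq]

/-- m² - Δ has the symbol ε²; moved onto the test function, it turns the weight ε^{-s} into
ε^{-(s-2)}. -/
theorem Sobolev.kleinGordon_apply (v : Sobolev n m s) (ψ : 𝓢(Space n, ℂ)) :
    -(Δ v.dist) ψ + (m : ℂ) ^ 2 * v.dist ψ = pairL2 (testFun m (s - 2) ψ) v.toL2 := by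
  have e : testFun m s ((m : ℂ) ^ 2 • ψ - Δ ψ) = testFun m (s - 2) ψ := by
    ext ξ
    have h1 : 𝓕⁻ ((m : ℂ) ^ 2 • ψ - Δ ψ) = (m : ℂ) ^ 2 • 𝓕⁻ ψ - 𝓕⁻ (Δ ψ) := by
      rw [sub_eq_add_neg, FourierTransform.fourierInv_add, FourierTransform.fourierInv_smul,
        FourierTransform.fourierInv_neg, ← sub_eq_add_neg]
    rw [testFun_apply, testFun_apply, h1, sub_apply, smul_apply, fourierInv_laplacian,
      show -(s - 2) = -s + 2 by ring, ← epsReal_mul, epsReal_two]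
    push_cast
    rw [smul_eq_mul]
    ring
  rw [← e, ← Sobolev.dist_eq_pairL2, TemperedDistribution.laplacian_apply_apply, map_sub, map_smul,
    smul_eq_mul]
  ring

theorem pairL2_testFun_inv {r : ℝ} (h : s = r + 1) (ψ : 𝓢(Space n, ℂ)) (g : L2 n) :
    pairL2 (testFun m s ψ) g = pairL2 (testFun m r ψ) (mulL2 (invSym n m) g) := by
  rw [pairL2_apply, pairL2_apply]
  refine integral_congr_ae ?_
  filter_upwards [(isSymbol_invSym (n := n) (m := m)).coeFn_mulL2 g] with ξ h1
  rw [h1, testFun_apply, testFun_apply, h, neg_add, ← epsReal_mul, invSym]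
  push_cast
  ring

/-! ### The Klein–Gordon equation in weighted L² coordinates. -/

theorem hasDerivAt_toL2 {u : ℝ → Sobolev n m s} {v : Sobolev n m s} {t : ℝ}
    (h : HasDerivAt u v t) : HasDerivAt (fun r => (u r).toL2) v.toL2 t :=
  (Sobolev.toL2I (n := n) (m := m) (s := s)).toContinuousLinearMap.hasFDerivAt.comp_hasDerivAt t h

theorem hasDerivAt_of_toL2 {u : ℝ → Sobolev n m s} {v : Sobolev n m s} {t : ℝ}
    (h : HasDerivAt (fun r => (u r).toL2) v.toL2 t) : HasDerivAt u v t := by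
  rw [hasDerivAt_iff_tendsto_slope] at h ⊢
  rw [(Sobolev.toL2I (n := n) (m := m) (s := s)).isometry.isEmbedding.isInducing.tendsto_nhds_iff]
  refine h.congr fun r => ?_
  rw [Function.comp_apply, slope_def_module, slope_def_module, Sobolev.toL2I_apply, map_smul,
    map_sub]

theorem toL2_incl_succ (v : Sobolev n m (s + 1)) :
    (Sobolev.incl (le_add_one' s) v).toL2 = mulL2 (invSym n m) v.toL2 := by
  rw [Sobolev.toL2_incl]
  congr 2
  funext ξ
  rw [invSym]
  congr 2
  ring

theorem inv_injective {g h : L2 n} (H : mulL2 (invSym n m) g = mulL2 (invSym n m) h) : g = h := by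
  refine Lp.ext ?_
  have hi := isSymbol_invSym (n := n) (m := m)
  have e := hi.coeFn_mulL2 h
  rw [← H] at e
  filter_upwards [hi.coeFn_mulL2 g, e] with ξ h1 h2
  have h3 : invSym n m ξ ≠ 0 := Complex.ofReal_ne_zero.2 (epsReal_pos _ ξ).ne'
  exact mul_left_cancel₀ h3 (h1.symm.trans h2)

variable {I : Set ℝ} {u : ℝ → Sobolev n m (s + 1)} {u' : ℝ → Sobolev n m s}

theorem IsCurve.hasDerivAt_inv (hu : IsCurve (le_add_one' s) I u u') {t : ℝ} (ht : t ∈ I) :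
    HasDerivAt (fun r => mulL2 (invSym n m) (u r).toL2) (u' t).toL2 t := by
  have h := hasDerivAt_toL2 (hu.hasDerivAt t ht)
  simpa only [toL2_incl_succ] using h

theorem IsCurve.sub_eq_integral (hu : IsCurve (le_add_one' s) I u u') (hI : IsOpen I)
    (hc : I.OrdConnected) {F : ℝ → 𝓢(Space n, ℂ) → ℂ} (ψ : 𝓢(Space n, ℂ))
    (hF : ContinuousOn (fun t => F t ψ) I)
    (hw : IsWeakSolution m I (fun t => (u t).dist) F) {t t₀ : ℝ} (ht : t ∈ I) (ht₀ : t₀ ∈ I) :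
    pairL2 (testFun m s ψ) (u' t).toL2 - pairL2 (testFun m s ψ) (u' t₀).toL2 =
      -∫ r in t₀..t, (pairL2 (testFun m (s - 1) ψ) (u r).toL2 + F r ψ) := by
  have hcu : ContinuousOn (fun t => (u t).toL2) I :=
    Sobolev.continuous_toL2.comp_continuousOn hu.continuousOn
  have hcu' : ContinuousOn (fun t => (u' t).toL2) I :=
    Sobolev.continuous_toL2.comp_continuousOn hu.continuousOn_deriv
  have hkg : ∀ t, -(Δ (u t).dist) ψ + (m : ℂ) ^ 2 * (u t).dist ψ =
      pairL2 (testFun m (s - 1) ψ) (u t).toL2 := fun t => by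
    rw [Sobolev.kleinGordon_apply]
    congr 3
    ring
  refine deriv_sub_eq_integral_of_weak hI hc (f := fun t => (u t).dist ψ)
    (g := fun t => pairL2 (testFun m s ψ) (u' t).toL2) (fun t ht => ?_)
    ((pairL2 _).continuous.comp_continuousOn hcu')
    (((pairL2 _).continuous.comp_continuousOn hcu).add hF) (fun χ hχ => ?_) ht ht₀
  · simp only [Sobolev.dist_eq_pairL2, pairL2_testFun_inv (rfl : s + 1 = s + 1)]
    exact (((pairL2 (testFun m s ψ)).restrictScalars ℝ).hasFDerivAt).comp_hasDerivAt t
      (hu.hasDerivAt_inv ht)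
  · have h := hw χ hχ.smooth hχ.compact hχ.subset ψ
    simp only [hkg] at h
    exact h

/-- The equation ∂ₜ²u = -(ε²u + N) is available in H^{s-1}. With the weight ε^{s-1} the term ε²u
becomes the L² representative of u in H^{s+1}, while N and ∂ₜu acquire a factor ε^{-1}. The
integrated weak equation, tested with all Schwartz functions, holds in L² and can be differentiated.
-/
theorem IsCurve.hasDerivAt_inv_deriv (hu : IsCurve (le_add_one' s) I u u') (hI : IsOpen I)
    (hc : I.OrdConnected) {N : ℝ → Sobolev n m s} (hN : ContinuousOn N I)
    (hw : IsWeakSolution m I (fun t => (u t).dist) fun t ψ => (N t).dist ψ) {t : ℝ} (ht : t ∈ I) :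
    HasDerivAt (fun r => mulL2 (invSym n m) (u' r).toL2)
      (-((u t).toL2 + mulL2 (invSym n m) (N t).toL2)) t := by
  have hcu : ContinuousOn (fun t => (u t).toL2) I :=
    Sobolev.continuous_toL2.comp_continuousOn hu.continuousOn
  have hcN : ContinuousOn (fun t => mulL2 (invSym n m) (N t).toL2) I :=
    (mulL2 _).continuous.comp_continuousOn (Sobolev.continuous_toL2.comp_continuousOn hN)
  have hφ : ContinuousOn (fun t => (u t).toL2 + mulL2 (invSym n m) (N t).toL2) I := hcu.add hcN
  refine hasDerivAt_of_sub_eq_integral hI hc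
    (φ := fun t => -((u t).toL2 + mulL2 (invSym n m) (N t).toL2)) hφ.neg ht ht fun r hr => ?_
  refine pairL2_ext fun θ => ?_
  obtain ⟨ψ, rfl⟩ := exists_testFun_eq (m := m) (s - 1) θ
  have hs : s = s - 1 + 1 := by ring
  have h1 := hu.sub_eq_integral hI hc ψ (by
    simp only [Sobolev.dist_eq_pairL2]
    exact (pairL2 _).continuous.comp_continuousOn
      (Sobolev.continuous_toL2.comp_continuousOn hN)) hw hr ht
  simp only [Sobolev.dist_eq_pairL2, pairL2_testFun_inv (m := m) hs ψ, ← map_add] at h1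
  rw [map_sub, h1, intervalIntegral.integral_neg, map_neg,
    ContinuousLinearMap.intervalIntegral_comp_comm _ (intervalIntegrable_of_continuousOn hc hφ hr ht)]

/-- Derivatives can be computed after an application of ε^{-2}, where no unbounded operator occurs.
If the result is ε^{-2}p with p continuous, integration in time and the injectivity of ε^{-2} give
the derivative of P itself. -/
theorem hasDerivAt_of_inv_inv {P p : ℝ → L2 n} (hI : IsOpen I) (hc : I.OrdConnected)
    (hp : ContinuousOn p I)
    (h : ∀ t ∈ I, HasDerivAt (fun r => mulL2 (invSym n m) (mulL2 (invSym n m) (P r)))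
      (mulL2 (invSym n m) (mulL2 (invSym n m) (p t))) t) {t : ℝ} (ht : t ∈ I) :
    HasDerivAt P (p t) t := by
  refine hasDerivAt_of_sub_eq_integral hI hc hp ht ht fun r hr => ?_
  refine inv_injective (m := m) (inv_injective (m := m) ?_)
  have hp' : ContinuousOn (fun t => mulL2 (invSym n m) (p t)) I :=
    (mulL2 _).continuous.comp_continuousOn hp
  have h1 := sub_eq_integral_of_hasDerivAt hc
    (φ := fun t => mulL2 (invSym n m) (mulL2 (invSym n m) (p t)))
    ((mulL2 _).continuous.comp_continuousOn hp') h hr ht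
  rw [map_sub, map_sub, h1, ← ContinuousLinearMap.intervalIntegral_comp_comm _
    (intervalIntegrable_of_continuousOn hc hp hr ht),
    ← ContinuousLinearMap.intervalIntegral_comp_comm _ (intervalIntegrable_of_continuousOn hc
      hp' hr ht)]

theorem continuousOn_cosL2 (hI : IsOpen I) {f : ℝ → L2 n} (hf : ContinuousOn f I) :
    ContinuousOn (fun t => mulL2 (cosSym n m t) (f t)) I := fun t ht =>
  (continuousAt_strong (T := fun t => (mulL2 (cosSym n m t)).toLinearMap.toAddMonoidHom) (C := 1)
    (fun r x => (isSymbol_cosSym r).norm_mulL2_le x) (continuous_cosL2 m (f t)).continuousAt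
    (hf.continuousAt (hI.mem_nhds ht))).continuousWithinAt

theorem continuousOn_sinL2 (hI : IsOpen I) {f : ℝ → L2 n} (hf : ContinuousOn f I) :
    ContinuousOn (fun t => mulL2 (sinSym n m t) (f t)) I := fun t ht =>
  (continuousAt_strong (T := fun t => (mulL2 (sinSym n m t)).toLinearMap.toAddMonoidHom) (C := 1)
    (fun r x => (isSymbol_sinSym r).norm_mulL2_le x) (continuous_sinL2 m (f t)).continuousAt
    (hf.continuousAt (hI.mem_nhds ht))).continuousWithinAt

theorem hasDerivAt_inv_cosL2_comp {x : ℝ → L2 n} {x' : L2 n} {t : ℝ} (hx : HasDerivAt x x' t) :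
    HasDerivAt (fun r => mulL2 (invSym n m) (mulL2 (cosSym n m r) (x r)))
      (-mulL2 (sinSym n m t) (x t) + mulL2 (invSym n m) (mulL2 (cosSym n m t) x')) t :=
  hasDerivAt_strong (T := fun r => ((mulL2 (invSym n m) ∘L mulL2 (cosSym n m r)).restrictScalars
      ℝ).toLinearMap) (C := (m ^ 2) ^ ((-1 : ℝ) / 2))
    (fun r x => (isSymbol_invSym.norm_mulL2_le _).trans (mul_le_mul_of_nonneg_left
      (((isSymbol_cosSym r).norm_mulL2_le x).trans (one_mul _).le) (by positivity)))
    (fun z => ((mulL2 _).continuous.comp (continuous_cosL2 m z)).continuousAt)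
    (hasDerivAt_inv_cosL2 m (x t) t) hx

theorem hasDerivAt_inv_sinL2_comp {x : ℝ → L2 n} {x' : L2 n} {t : ℝ} (hx : HasDerivAt x x' t) :
    HasDerivAt (fun r => mulL2 (invSym n m) (mulL2 (sinSym n m r) (x r)))
      (mulL2 (cosSym n m t) (x t) + mulL2 (invSym n m) (mulL2 (sinSym n m t) x')) t :=
  hasDerivAt_strong (T := fun r => ((mulL2 (invSym n m) ∘L mulL2 (sinSym n m r)).restrictScalars
      ℝ).toLinearMap) (C := (m ^ 2) ^ ((-1 : ℝ) / 2))
    (fun r x => (isSymbol_invSym.norm_mulL2_le _).trans (mul_le_mul_of_nonneg_left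
      (((isSymbol_sinSym r).norm_mulL2_le x).trans (one_mul _).le) (by positivity)))
    (fun z => ((mulL2 _).continuous.comp (continuous_sinL2 m z)).continuousAt)
    (hasDerivAt_inv_sinL2 m (x t) t) hx

/-- A weak solution of `□u + m²u + N = 0`, transported to time `0` by the free evolution, is
differentiable. -/
theorem IsCurve.hasDerivAt_evo (hu : IsCurve (le_add_one' s) I u u') (hI : IsOpen I)
    (hc : I.OrdConnected) {N : ℝ → Sobolev n m s} (hN : ContinuousOn N I)
    (hw : IsWeakSolution m I (fun t => (u t).dist) fun t ψ => (N t).dist ψ) {t : ℝ} (ht : t ∈ I) :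
    HasDerivAt (fun r => evo (-r) (u r, u' r)) (evo (-t) (0, -N t)) t := by
  have hcN : ContinuousOn (fun t => (N t).toL2) I := Sobolev.continuous_toL2.comp_continuousOn hN
  have hi := isSymbol_invSym (n := n) (m := m)
  have hcs := isSymbol_cosSym (n := n) (m := m)
  have hsn := isSymbol_sinSym (n := n) (m := m)
  have k1 : HasDerivAt (fun r => (evo (-r) (u r, u' r)).1) (evo (-t) (0, -N t)).1 t := by
    refine hasDerivAt_of_toL2 ?_
    simp only [toL2_evo_fst, cosL2_neg, sinL2_neg, map_zero, map_neg, neg_neg, zero_add]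
    -- One factor ε^{-1} is used to differentiate u and ∂ₜu, the other to differentiate the cosine
    -- and the sine. The terms free of N cancel.
    refine hasDerivAt_of_inv_inv (m := m) hI hc (continuousOn_sinL2 (m := m) hI hcN)
      (fun t ht => ?_) ht
    have h1 := hasDerivAt_inv_cosL2_comp (m := m) (hu.hasDerivAt_inv ht)
    have h2 := hasDerivAt_inv_sinL2_comp (m := m) (hu.hasDerivAt_inv_deriv hI hc hN hw ht)
    refine ((h1.sub h2).congr_deriv ?_).congr_of_eventuallyEq
      (Filter.Eventually.of_forall fun r => ?_)
    · rw [map_neg, map_neg, map_add, map_add, mulL2_comm (hsn t) hi, mulL2_comm (hcs t) hi,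
        mulL2_comm (hsn t) hi]
      abel
    · simp only [Pi.sub_apply, map_add, map_neg]
      rw [mulL2_comm (hcs r) hi, mulL2_comm (hsn r) hi]
      abel
  have k2 : HasDerivAt (fun r => (evo (-r) (u r, u' r)).2) (evo (-t) (0, -N t)).2 t := by
    refine hasDerivAt_of_toL2 ?_
    simp only [toL2_evo_snd, cosL2_neg, sinL2_neg, map_zero, map_neg, sub_zero,
      sub_neg_eq_add]
    refine hasDerivAt_of_inv_inv (m := m) (p := fun t => -mulL2 (cosSym n m t) (N t).toL2) hI hc
      (continuousOn_cosL2 (m := m) hI hcN).neg (fun t ht => ?_) ht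
    have h1 := hasDerivAt_inv_sinL2_comp (m := m) (hu.hasDerivAt_inv ht)
    have h2 := hasDerivAt_inv_cosL2_comp (m := m) (hu.hasDerivAt_inv_deriv hI hc hN hw ht)
    refine ((h1.add h2).congr_deriv ?_).congr_of_eventuallyEq
      (Filter.Eventually.of_forall fun r => ?_)
    · rw [map_neg, map_neg, map_add, map_add, mulL2_comm (hsn t) hi, mulL2_comm (hcs t) hi,
        mulL2_comm (hcs t) hi, map_neg, map_neg]
      abel
    · simp only [Pi.add_apply, map_add]
      rw [mulL2_comm (hcs r) hi, mulL2_comm (hsn r) hi]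
      abel
  exact k1.prodMk k2

/-- The free evolution gives free solutions. -/
theorem isFree_evo (d : Data n m s) :
    IsFree (le_add_one' s) (fun t => (evo t d).1) fun t => (evo t d).2 := by
  have hc := continuous_evo_apply d
  have hd : ∀ t, HasDerivAt (fun r => mulL2 (invSym n m) (evo r d).1.toL2) (evo t d).2.toL2 t := by
    intro t
    simp only [toL2_evo_fst, toL2_evo_snd, map_add]
    refine ((hasDerivAt_inv_cosL2 m d.1.toL2 t).add
      (hasDerivAt_inv_sinL2 m d.2.toL2 t)).congr_deriv ?_
    abel
  have hd' : ∀ t, HasDerivAt (fun r => mulL2 (invSym n m) (evo r d).2.toL2)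
      (-(evo t d).1.toL2) t := by
    intro t
    simp only [toL2_evo_fst, toL2_evo_snd, map_sub]
    refine ((hasDerivAt_inv_cosL2 m d.2.toL2 t).sub
      (hasDerivAt_inv_sinL2 m d.1.toL2 t)).congr_deriv ?_
    abel
  have hs : s = s - 1 + 1 := by ring
  refine ⟨⟨(continuous_fst.comp hc).continuousOn, (continuous_snd.comp hc).continuousOn,
    fun t _ => hasDerivAt_of_toL2 ?_⟩, fun χ h1 h2 h3 ψ => ?_⟩
  · simp only [toL2_incl_succ]
    exact hd t
  · have hkg : ∀ t, -(Δ (evo t d).1.dist) ψ + (m : ℂ) ^ 2 * (evo t d).1.dist ψ =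
        pairL2 (testFun m (s - 1) ψ) (evo t d).1.toL2 := fun t => by
      rw [Sobolev.kleinGordon_apply]
      congr 3
      ring
    simp only [add_zero, hkg]
    refine weak_of_hasDerivAt isOpen_univ (I := Set.univ)
      (g := fun t => pairL2 (testFun m s ψ) (evo t d).2.toL2) (fun t _ => ?_) (fun t _ => ?_)
      ?_ ⟨h1, h2, h3⟩
    · simp only [Sobolev.dist_eq_pairL2, pairL2_testFun_inv (rfl : s + 1 = s + 1)]
      exact (((pairL2 (testFun m s ψ)).restrictScalars ℝ).hasFDerivAt).comp_hasDerivAt t (hd t)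
    · simp only [pairL2_testFun_inv (m := m) hs ψ]
      exact ((((pairL2 (testFun m (s - 1) ψ)).restrictScalars ℝ).hasFDerivAt).comp_hasDerivAt t
        (hd' t)).congr_deriv (map_neg _ _)
    · exact ((pairL2 _).continuous.comp (Sobolev.continuous_toL2.comp
        (continuous_fst.comp hc))).continuousOn

/-- With N = 0 the data transported back to time 0 have derivative zero. So the Cauchy problem has
no free solutions besides those given by `evo`. -/
theorem cauchy_eq_evo (t : ℝ) (φ : FreeSol n m s) : cauchy t φ = evo t (cauchy 0 φ) := by
  have hφ : IsFree (le_add_one' s) φ.1.1 φ.1.2 := φ.2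
  have h : ∀ t, HasDerivAt (fun r => evo (-r) (φ.1.1 r, φ.1.2 r)) 0 t := by
    intro t
    have h1 := hφ.1.hasDerivAt_evo isOpen_univ Set.ordConnected_univ (N := fun _ => 0)
      continuousOn_const (by simpa using hφ.2) (Set.mem_univ t)
    rw [neg_zero] at h1
    exact h1.congr_deriv (map_zero (evo (-t)))
  have h2 := is_const_of_deriv_eq_zero (fun t => (h t).differentiableAt)
    (fun t => (h t).deriv) t 0
  simp only [neg_zero, evo_zero] at h2
  have h3 := congrArg (evo t) h2
  rw [evo_evo_neg] at h3
  exact h3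

/-- The free solution with given data at time `0`. -/
def freeSol (d : Data n m s) : FreeSol n m s :=
  ⟨(fun t => (evo t d).1, fun t => (evo t d).2), isFree_evo d⟩

theorem cauchy_freeSol (t : ℝ) (d : Data n m s) : cauchy t (freeSol d) = evo t d := rfl

theorem cauchy_solveAt (t : ℝ) (d : Data n m s) : cauchy t (solveAt t d) = d := by
  have h : ∃ φ : FreeSol n m s, cauchy t φ = d :=
    ⟨freeSol (evo (-t) d), by rw [cauchy_freeSol, evo_evo_neg]⟩
  rw [solveAt, dif_pos h]
  exact h.choose_spec

theorem cauchy_zero_solveAt (t : ℝ) (d : Data n m s) : cauchy 0 (solveAt t d) = evo (-t) d := by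
  have h := cauchy_eq_evo t (solveAt t d)
  rw [cauchy_solveAt] at h
  have h2 := congrArg (evo (-t)) h
  rw [evo_neg_evo] at h2
  exact h2.symm

end WeakStrong

/-! ### The interaction picture -/

section Interaction

variable {n : ℕ} {m : ℝ} [Fact (0 < m)] {s : ℝ}

theorem Sobolev.abs_pairing_le (a : Sobolev n m s) (b : Sobolev n m (-s)) :
    |a.pairing b| ≤ ‖b‖ * ‖a‖ := by
  rw [mul_comm]
  exact (Complex.abs_re_le_norm _).trans (norm_inner_le_norm a.toL2 b.toL2)

/-- The duality product with a fixed element of `H^{-s}`. -/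
def Sobolev.pairingL (b : Sobolev n m (-s)) : Sobolev n m s →L[ℝ] ℝ :=
  LinearMap.mkContinuous
    { toFun := fun a => a.pairing b
      map_add' := fun a a' => by simp [Sobolev.pairing, inner_add_left]
      map_smul' := fun c a => by
        simp only [Sobolev.pairing, map_smul, RingHom.id_apply, smul_eq_mul]
        rw [RCLike.real_smul_eq_coe_smul (K := ℂ) c a.toL2, inner_smul_left]
        simp }
    ‖b‖ fun a => a.abs_pairing_le b

/-- The flux through the initial time as a continuous linear functional. -/
def fluxL (φ : Sobolev n m (-s)) (φ' : Sobolev n m (-(s + 1))) : Data n m s →L[ℝ] ℝ :=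
  Sobolev.pairingL φ' ∘L ContinuousLinearMap.fst ℝ _ _ -
    Sobolev.pairingL φ ∘L ContinuousLinearMap.snd ℝ _ _

/-- The map `v ↦ evo (-τ) (0, -v)`. -/
def kick (τ : ℝ) : Sobolev n m s →L[ℝ] Data n m s :=
  -(evo (-τ) ∘L ContinuousLinearMap.inr ℝ (Sobolev n m (s + 1)) (Sobolev n m s))

theorem kick_apply (τ : ℝ) (v : Sobolev n m s) : kick τ v = evo (-τ) (0, -v) := by
  have h : ((0, -v) : Data n m s) = -(0, v) := by simp
  rw [h, map_neg]
  rfl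

theorem norm_kick_le (τ : ℝ) : ‖(kick τ : Sobolev n m s →L[ℝ] Data n m s)‖ ≤ 2 := by
  refine ContinuousLinearMap.opNorm_le_bound _ zero_le_two fun v => ?_
  rw [kick_apply]
  refine (norm_evo_le _ _).trans (le_of_eq ?_)
  simp [Prod.norm_def]

theorem norm_evo_opNorm_le (τ : ℝ) : ‖(evo τ : Data n m s →L[ℝ] Data n m s)‖ ≤ 2 :=
  ContinuousLinearMap.opNorm_le_bound _ zero_le_two (norm_evo_le τ)

variable {W : ℝ × (Fin (n + 1) → ℝ) → ℝ} {p : FormalMultilinearSeries ℝ (ℝ × (Fin (n + 1) → ℝ)) ℝ}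

/-- The series of the vector field `d ↦ evo (-τ) (0, -𝓥(evo τ d))`. -/
def fieldSeries (hs : (n : ℝ) / 2 < s) (p : FormalMultilinearSeries ℝ (ℝ × (Fin (n + 1) → ℝ)) ℝ)
    (τ : ℝ) : FormalMultilinearSeries ℝ (Data n m s) (Data n m s) := fun q =>
  (kick τ).compContinuousMultilinearMap
    ((nonlinSeries hs p q).compContinuousLinearMap fun _ => evo τ)

theorem fieldSeries_apply (hs : (n : ℝ) / 2 < s) (τ : ℝ) (q : ℕ) (v : Fin q → Data n m s) :
    fieldSeries hs p τ q v = evo (-τ) (0, -nonlinSeries hs p q fun i => evo τ (v i)) :=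
  kick_apply τ _

theorem fieldSeries_sum (hs : (n : ℝ) / 2 < s) (hW : HasFPowerSeriesOnBall W p 0 ⊤)
    (hW0 : W 0 = 0) (τ : ℝ) (d : Data n m s) :
    (fieldSeries hs p τ).sum d = evo (-τ) (0, -nonlin W (evo τ d)) := by
  rw [← kick_apply]
  exact ((kick τ).hasSum (hasSum_nonlin hs hW hW0 (evo τ d))).tsum_eq

theorem continuous_evo_comp {X : Type*} [TopologicalSpace X] {τ : X → ℝ} {d : X → Data n m s}
    (hτ : Continuous τ) (hd : Continuous d) : Continuous fun x => evo (τ x) (d x) := by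
  have h := (continuous_evo (n := n) (m := m) (s := s)).comp (hτ.prodMk hd)
  simpa only [Function.comp_def] using h

theorem jointlyContinuous_fieldSeries (hs : (n : ℝ) / 2 < s) :
    JointlyContinuous (fieldSeries (m := m) hs p) := by
  intro q
  have h1 : Continuous fun x : ℝ × (Fin q → Data n m s) => fun i => evo x.1 (x.2 i) := by
    refine continuous_pi fun i => ?_
    exact continuous_evo_comp continuous_fst ((continuous_apply i).comp continuous_snd)
  have h2 : Continuous fun x : ℝ × (Fin q → Data n m s) =>
      nonlinSeries hs p q fun i => evo x.1 (x.2 i) :=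
    (nonlinSeries (m := m) hs p q).cont.comp h1
  have h3 : Continuous fun x : ℝ × (Fin q → Data n m s) => -x.1 := continuous_fst.neg
  have h4 : Continuous fun x : ℝ × (Fin q → Data n m s) =>
      evo (-x.1) (0, -nonlinSeries hs p q fun i => evo x.1 (x.2 i)) :=
    continuous_evo_comp h3 (continuous_const.prodMk h2.neg)
  exact h4.congr fun x => (fieldSeries_apply hs x.1 q x.2).symm

/-- The power series which majorizes the nonlinearity. -/
def majorant (n : ℕ) (m s : ℝ) [Fact (0 < m)]
    (p : FormalMultilinearSeries ℝ (ℝ × (Fin (n + 1) → ℝ)) ℝ) : PowerSeries ℝ :=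
  PowerSeries.mk fun k => if k = 0 then 0 else ‖p k‖ * (4 * nonlinConst n m s) ^ k

theorem coeff_majorant_zero : PowerSeries.coeff 0 (majorant n m s p) = 0 := by
  simp [majorant]

theorem nonnegCoeff_majorant : NonnegCoeff (majorant n m s p) := fun k => by
  have := nonlinConst_nonneg (n := n) (m := m) (s := s)
  rw [majorant, PowerSeries.coeff_mk]
  split_ifs <;> positivity

theorem isEntire_majorant (hW : HasFPowerSeriesOnBall W p 0 ⊤) :
    IsEntire (majorant n m s p) := fun r hr => by
  have h0 := nonlinConst_nonneg (n := n) (m := m) (s := s)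
  refine Summable.of_nonneg_of_le (fun k => by positivity) (fun k => ?_)
    (summable_norm_coeff hW (mul_nonneg (mul_nonneg zero_le_four h0) hr))
  rw [abs_of_nonneg (nonnegCoeff_majorant k), majorant, PowerSeries.coeff_mk, mul_pow _ r,
    ← mul_assoc]
  refine mul_le_mul_of_nonneg_right ?_ (pow_nonneg hr k)
  split_ifs <;> first | exact le_rfl | positivity

/-- `kick` contributes one factor 2, the free evolution of the arguments 2^q, and the choice b = 2
another 2^q; hence 4 in `majorant` and the constant 2 in front. The degree zero part vanishes since
the constant term was left out. -/
theorem hasMajorant_fieldSeries (hs : (n : ℝ) / 2 < s) (τ : ℝ) :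
    HasMajorant (fieldSeries (m := m) hs p τ) 2 2 (majorant n m s p) := by
  intro q
  have h0 := nonlinConst_nonneg (n := n) (m := m) (s := s)
  cases q with
  | zero =>
    have h : fieldSeries (m := m) hs p τ 0 = 0 := by
      refine ContinuousMultilinearMap.ext fun v => ?_
      rw [fieldSeries_apply]
      change evo (-τ) (0, -(0 : Sobolev n m s)) = 0
      rw [neg_zero]
      exact map_zero _
    rw [h, norm_zero, zero_mul, coeff_majorant_zero, mul_zero]
  | succ q =>
    have h1 : ‖fieldSeries (m := m) hs p τ (q + 1)‖ ≤
        2 * (‖p (q + 1)‖ * nonlinConst n m s ^ (q + 1) * 2 ^ (q + 1)) := by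
      refine (ContinuousLinearMap.norm_compContinuousMultilinearMap_le _ _).trans ?_
      refine mul_le_mul (norm_kick_le τ) ?_ (norm_nonneg _) zero_le_two
      refine (ContinuousMultilinearMap.norm_compContinuousLinearMap_le _ _).trans ?_
      refine mul_le_mul (norm_nonlinSeries_le hs p _) ?_ (by positivity) (by positivity)
      rw [Finset.prod_const, Finset.card_univ, Fintype.card_fin]
      exact pow_le_pow_left₀ (norm_nonneg _) (norm_evo_opNorm_le τ) _
    rw [majorant, PowerSeries.coeff_mk, if_neg (Nat.succ_ne_zero q)]
    calc ‖fieldSeries (m := m) hs p τ (q + 1)‖ * 2 ^ (q + 1) ≤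
        2 * (‖p (q + 1)‖ * nonlinConst n m s ^ (q + 1) * 2 ^ (q + 1)) * 2 ^ (q + 1) := by gcongr
      _ = _ := by
        rw [mul_pow, show (4 : ℝ) = 2 * 2 by norm_num, mul_pow]
        ring

/-- At time 0 the vector field is (0, -𝓥), so 𝓥 inherits the continuity of an entire series. -/
theorem continuous_nonlin (hs : (n : ℝ) / 2 < s) (hW : HasFPowerSeriesOnBall W p 0 ⊤)
    (hW0 : W 0 = 0) : Continuous fun d : Data n m s => nonlin W d := by
  have h := ((hasMajorant_fieldSeries (m := m) (p := p) hs 0).differentiable two_pos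
    (isEntire_majorant hW)).continuous
  have h2 : (fun d : Data n m s => nonlin W d) = fun d => -((fieldSeries hs p 0).sum d).2 := by
    funext d
    rw [fieldSeries_sum hs hW hW0, evo_zero, neg_zero, evo_zero, neg_neg]
  rw [h2]
  exact h.snd.neg

/-- The series of the functional `f_φ`. -/
def fluxSeries (φ : Sobolev n m (-s)) (φ' : Sobolev n m (-(s + 1))) :
    FormalMultilinearSeries ℝ (Data n m s) ℝ :=
  (fluxL φ φ').fpowerSeries 0

theorem fluxSeries_sum (φ : Sobolev n m (-s)) (φ' : Sobolev n m (-(s + 1))) (d : Data n m s) :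
    (fluxSeries φ φ').sum d = flux d φ φ' := by
  have h := ((fluxL φ φ').hasFPowerSeriesOnBall 0).sum (y := d) (by simp)
  rw [zero_add] at h
  exact h.symm

theorem hasMajorant_fluxSeries (φ : Sobolev n m (-s)) (φ' : Sobolev n m (-(s + 1))) :
    HasMajorant (fluxSeries φ φ') 2 (2 * ‖fluxL φ φ'‖) PowerSeries.X := by
  intro q
  match q with
  | 0 =>
    have h : fluxSeries φ φ' 0 = 0 := by
      ext1 v
      exact map_zero (fluxL φ φ')
    simp [h]
  | 1 =>
    have h : ‖fluxSeries φ φ' 1‖ = ‖fluxL φ φ'‖ :=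
      (continuousMultilinearCurryFin1 ℝ (Data n m s) ℝ).symm.norm_map _
    rw [h, PowerSeries.coeff_one_X]
    linarith
  | q + 2 =>
    have h : fluxSeries φ φ' (q + 2) = 0 := rfl
    rw [h, norm_zero, zero_mul, PowerSeries.coeff_X, if_neg (by omega), mul_zero]

theorem isAdmissible_field (hs : (n : ℝ) / 2 < s) (hW : HasFPowerSeriesOnBall W p 0 ⊤)
    (φ : Sobolev n m (-s)) (φ' : Sobolev n m (-(s + 1))) :
    IsAdmissible (fieldSeries hs p) (fluxSeries φ φ') 2 (2 * ‖fluxL φ φ'‖)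
      (majorant n m s p) where
  pos := two_pos
  nonneg := by positivity
  entire := isEntire_majorant hW
  nonnegCoeff := nonnegCoeff_majorant
  continuous := jointlyContinuous_fieldSeries hs
  field := hasMajorant_fieldSeries hs
  init := hasMajorant_fluxSeries φ φ'

theorem creation_vacuum (φ : Sobolev n m (-s)) (φ' : Sobolev n m (-(s + 1)))
    (ψ : FreeSol n m s) :
    creation φ φ' vacuum ψ = (fluxSeries φ φ').sum (cauchy 0 ψ) := by
  rw [fluxSeries_sum, creation, vacuum, mul_one]

theorem lineDeriv_comp_cauchy (F : Data n m s → ℝ) (φ χ : FreeSol n m s) :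
    lineDeriv ℝ (fun ψ => F (cauchy 0 ψ)) φ χ = lineDeriv ℝ F (cauchy 0 φ) (cauchy 0 χ) := by
  simp only [lineDeriv, map_add, map_smul]

/-- All functionals here depend on ψ only through its data at time 0. In these data the direction
used by 𝔻_τ is evo(-τ)(0, -v), and the data at time τ are obtained by `evo τ`, so 𝔻_τ is the
derivative along the field with series `fieldSeries`. -/
theorem prodD_eq (hs : (n : ℝ) / 2 < s) (hW : HasFPowerSeriesOnBall W p 0 ⊤)
    (hW0 : W 0 = 0) (φ : Sobolev n m (-s)) (φ' : Sobolev n m (-(s + 1))) (k : ℕ)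
    (τ : Fin k → ℝ) :
    prodD W k τ (creation φ φ' vacuum) =
      fun ψ => (prodSeries (fieldSeries hs p) (fluxSeries φ φ') k τ).sum (cauchy 0 ψ) := by
  induction k with
  | zero =>
    funext ψ
    exact creation_vacuum φ φ' ψ
  | succ k ih =>
    funext ψ
    rw [prodD, ih, opD, annihilation, lineDeriv_comp_cauchy, sharp, cauchy_zero_solveAt,
      cauchy_eq_evo (τ (Fin.last k)), ← fieldSeries_sum hs hW hW0]
    exact (isAdmissible_field hs hW φ φ').prodSeries_lineDeriv k τ _

theorem texpTerm_eq (hs : (n : ℝ) / 2 < s) (hW : HasFPowerSeriesOnBall W p 0 ⊤)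
    (hW0 : W 0 = 0) (φ : Sobolev n m (-s)) (φ' : Sobolev n m (-(s + 1))) {t : ℝ} (ht : 0 ≤ t)
    (k : ℕ) :
    texpTerm W t (creation φ φ' vacuum) k = fun ψ =>
      (-1) ^ k * (texpSeries (fieldSeries hs p) (fluxSeries φ φ') k t).sum (cauchy 0 ψ) := by
  funext ψ
  simp only [texpTerm, prodD_eq hs hW hW0]
  rw [(isAdmissible_field hs hW φ φ').texpSeries_sum_eq_integral k ht]

theorem texp_eq (hs : (n : ℝ) / 2 < s) (hW : HasFPowerSeriesOnBall W p 0 ⊤)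
    (hW0 : W 0 = 0) (φ : Sobolev n m (-s)) (φ' : Sobolev n m (-(s + 1))) {t : ℝ} (ht : 0 ≤ t)
    (ψ : FreeSol n m s) :
    texp W t (creation φ φ' vacuum) ψ = ∑' k, (-1) ^ k *
      (texpSeries (fieldSeries hs p) (fluxSeries φ φ') k t).sum (cauchy 0 ψ) := by
  simp only [texp, texpTerm_eq hs hW hW0 φ φ' ht]

end Interaction

/-! ### Symmetric expansions -/

section Symmetrize

variable {E : Type*} [NormedAddCommGroup E] [NormedSpace ℝ E]

/-- The series with symmetric coefficients and the same sum. -/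
def symmetrize (f : FormalMultilinearSeries ℝ E ℝ) : FormalMultilinearSeries ℝ E ℝ := fun p =>
  (p.factorial : ℝ)⁻¹ • ∑ σ : Equiv.Perm (Fin p), (f p).domDomCongr σ

theorem symmetrize_apply (f : FormalMultilinearSeries ℝ E ℝ) (p : ℕ) (v : Fin p → E) :
    symmetrize f p v = (p.factorial : ℝ)⁻¹ * ∑ σ : Equiv.Perm (Fin p), f p (v ∘ σ) := by
  simp [symmetrize, Function.comp_def]

theorem symmetrize_comp_perm (f : FormalMultilinearSeries ℝ E ℝ) (p : ℕ)
    (ρ : Equiv.Perm (Fin p)) (v : Fin p → E) : symmetrize f p (v ∘ ρ) = symmetrize f p v := by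
  rw [symmetrize_apply, symmetrize_apply]
  congr 1
  exact Equiv.sum_comp (Equiv.mulLeft ρ) fun σ => f p (v ∘ σ)

theorem symmetrize_diag (f : FormalMultilinearSeries ℝ E ℝ) (p : ℕ) (φ : E) :
    symmetrize f p (fun _ => φ) = f p fun _ => φ := by
  rw [symmetrize_apply]
  simp only [Function.comp_def, Finset.sum_const, Finset.card_univ, Fintype.card_perm,
    Fintype.card_fin, nsmul_eq_mul]
  rw [inv_mul_cancel_left₀ (Nat.cast_ne_zero.2 p.factorial_ne_zero)]

theorem norm_symmetrize_le (f : FormalMultilinearSeries ℝ E ℝ) (p : ℕ) :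
    ‖symmetrize f p‖ ≤ ‖f p‖ := by
  have h : ‖∑ σ : Equiv.Perm (Fin p), (f p).domDomCongr σ‖ ≤ p.factorial * ‖f p‖ := by
    refine (norm_sum_le _ _).trans (le_of_eq ?_)
    simp only [ContinuousMultilinearMap.norm_domDomCongr, Finset.sum_const, Finset.card_univ,
      Fintype.card_perm, Fintype.card_fin, nsmul_eq_mul]
  rw [symmetrize, norm_smul, norm_inv, Real.norm_natCast,
    inv_mul_le_iff₀ (Nat.cast_pos.2 p.factorial_pos)]
  exact h

end Symmetrize

/-! ### Convergence of the time ordered exponential -/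

section Fock

variable {n : ℕ} {m : ℝ} [Fact (0 < m)] {s : ℝ}

theorem norm_cauchy_zero_le (φ : FreeSol n m s) : ‖cauchy 0 φ‖ ≤ ‖φ‖ := by
  have h := FreeSol.norm_sq φ
  rw [Prod.norm_def]
  refine max_le ?_ ?_ <;> refine (sq_le_sq₀ (norm_nonneg _) (norm_nonneg _)).1 ?_ <;> rw [h]
  · exact le_add_of_nonneg_right (sq_nonneg _)
  · exact le_add_of_nonneg_left (sq_nonneg _)

/-- The Cauchy data at time `0` as a continuous linear map. -/
def cauchyL : FreeSol n m s →L[ℝ] Data n m s :=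
  (cauchy 0).mkContinuous 1 fun φ => by
    rw [one_mul]
    exact norm_cauchy_zero_le φ

theorem norm_cauchyL_le : ‖(cauchyL : FreeSol n m s →L[ℝ] Data n m s)‖ ≤ 1 :=
  LinearMap.mkContinuous_norm_le _ zero_le_one _

/-- The Fock norm requires symmetric coefficients. Symmetrization keeps the values on the diagonal
and does not increase norms, and neither does the pullback along `cauchyL`, whose norm is at most 1.
-/
theorem fockNorm_le {S : FormalMultilinearSeries ℝ (Data n m s) ℝ} {F : FreeSol n m s → ℝ}
    {r R : ℝ} (hr : 0 ≤ r) (hR : r ≤ R)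
    (hF : ∀ ψ, ‖ψ‖ < r → HasSum (fun p => S p fun _ => cauchy 0 ψ) (F ψ))
    (hS : Summable fun p => ‖S p‖ * R ^ p) :
    fockNorm r F ≤ ENNReal.ofReal (∑' p, ‖S p‖ * R ^ p) := by
  set f : FormalMultilinearSeries ℝ (FreeSol n m s) ℝ := fun p =>
    (symmetrize S p).compContinuousLinearMap fun _ => cauchyL with hf
  have h : HasFockExpansion F f r := by
    refine ⟨fun p σ φ => symmetrize_comp_perm S p σ fun i => cauchy 0 (φ i), fun φ hφ => ?_⟩
    exact (hF φ hφ).congr_fun fun p => symmetrize_diag S p (cauchy 0 φ)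
  have hn : ∀ p, ‖f p‖ ≤ ‖S p‖ := fun p => by
    refine (ContinuousMultilinearMap.norm_compContinuousLinearMap_le _ _).trans ?_
    rw [Finset.prod_const, Finset.card_univ, Fintype.card_fin]
    exact (mul_le_of_le_one_right (norm_nonneg _)
      (pow_le_one₀ (norm_nonneg _) norm_cauchyL_le)).trans (norm_symmetrize_le S p)
  have hR0 : 0 ≤ R := hr.trans hR
  rw [ENNReal.ofReal_tsum_of_nonneg (fun p => by positivity) hS]
  refine (iInf₂_le f h).trans (ENNReal.tsum_le_tsum fun p => ?_)
  rw [← ofReal_norm, ← ENNReal.ofReal_pow hr, ← ENNReal.ofReal_mul (norm_nonneg _)]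
  exact ENNReal.ofReal_le_ofReal (mul_le_mul (hn p) (pow_le_pow_left₀ hr hR p) (by positivity)
    (norm_nonneg _))

/-- The direction of differentiation is fixed, so the iterates see only the restriction of F to a
line. No differentiability is required, because both sides consist of the same iterated `deriv`. -/
theorem opU_iterate (t : ℝ) (d : Data n m s) (F : FreeSol n m s → ℝ) (k : ℕ)
    (φ : FreeSol n m s) (x : ℝ) : ((opU t d)^[k] F) (φ + x • solveAt t d) =
      iteratedDeriv k (fun h => F (φ + h • solveAt t d)) x := by
  induction k generalizing x with
  | zero => simp
  | succ k ih =>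
    rw [Function.iterate_succ_apply', iteratedDeriv_succ, opU, annihilation, lineDeriv]
    have h : (fun h : ℝ => ((opU t d)^[k] F) (φ + x • solveAt t d + h • solveAt t d)) =
        fun h => iteratedDeriv k (fun h => F (φ + h • solveAt t d)) (x + h) := by
      funext h
      rw [add_assoc, ← add_smul, ih]
    rw [h, deriv_comp_const_add (iteratedDeriv k fun h => F (φ + h • solveAt t d)) x 0, add_zero]

theorem iteratedDeriv_div_factorial {g : ℝ → ℝ} {c : ℕ → ℝ}
    (h : ∀ᶠ z in nhds (0 : ℝ), HasSum (fun p => z ^ p * c p) (g z)) (k : ℕ) :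
    iteratedDeriv k g 0 / k.factorial = c k := by
  have h1 : HasFPowerSeriesAt g (FormalMultilinearSeries.ofScalars ℝ c) 0 := by
    rw [hasFPowerSeriesAt_iff]
    simpa [FormalMultilinearSeries.coeff_ofScalars] using h
  have h2 := h1.eq_formalMultilinearSeries h1.analyticAt.hasFPowerSeriesAt
  have h3 := congrArg (fun S : FormalMultilinearSeries ℝ ℝ ℝ => S.coeff k) h2
  simpa [FormalMultilinearSeries.coeff_ofScalars] using h3.symm

/-- The value of the bra is the Taylor series at 0 of z ↦ F(zψ), with ψ the free solution through d,
summed at z = 1. By uniqueness of expansions its coefficients are the c_k. -/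
theorem hasBraValue_of_hasSum {t : ℝ} {d : Data n m s} {F : FreeSol n m s → ℝ} {c : ℕ → ℝ}
    (h : ∀ z : ℝ, |z| ≤ 1 → HasSum (fun p => z ^ p * c p) (F (z • solveAt t d))) :
    HasBraValue t d F (F (solveAt t d)) := by
  have h1 : ∀ k : ℕ, ((k.factorial : ℝ)⁻¹) * vacuumBra ((opU t d)^[k] F) = 1 ^ k * c k := by
    intro k
    have e := opU_iterate t d F k 0 0
    simp only [zero_smul, zero_add] at e
    rw [vacuumBra, e, one_pow, one_mul, inv_mul_eq_div]
    refine iteratedDeriv_div_factorial ?_ k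
    filter_upwards [Metric.closedBall_mem_nhds (0 : ℝ) one_pos] with z hz
    exact h z (by simpa using hz)
  have h2 := h 1 (by simp)
  rw [one_smul] at h2
  exact h2.congr_fun h1

theorem dataNorm_nonneg (d : Data n m s) : 0 ≤ dataNorm d :=
  add_nonneg (norm_nonneg _) (norm_nonneg _)

theorem continuous_dataNorm : Continuous fun d : Data n m s => dataNorm d :=
  continuous_fst.norm.add continuous_snd.norm

variable {W : ℝ × (Fin (n + 1) → ℝ) → ℝ} {p : FormalMultilinearSeries ℝ (ℝ × (Fin (n + 1) → ℝ)) ℝ}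

/-- The series of the Fock space expression at time `t`, in terms of the Cauchy data at this
time. -/
def fockSeries (hs : (n : ℝ) / 2 < s) (p : FormalMultilinearSeries ℝ (ℝ × (Fin (n + 1) → ℝ)) ℝ)
    (φ : Sobolev n m (-s)) (φ' : Sobolev n m (-(s + 1))) (t : ℝ) :
    FormalMultilinearSeries ℝ (Data n m s) ℝ := fun q =>
  (totalSeries (fieldSeries hs p) (fluxSeries φ φ') t q).compContinuousLinearMap fun _ => evo (-t)

theorem texpConverges (hs : (n : ℝ) / 2 < s) (hW : HasFPowerSeriesOnBall W p 0 ⊤)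
    (hW0 : W 0 = 0) (φ : Sobolev n m (-s)) (φ' : Sobolev n m (-(s + 1))) {t ρ : ℝ} (ht : 0 ≤ t)
    (hρ : 0 ≤ ρ)
    (hB : Summable fun k => t ^ k / k.factorial * evalSeries (lieIterate (majorant n m s p) k) ρ) :
    TexpConverges W t ρ (creation φ φ' vacuum) := by
  have H := isAdmissible_field hs hW φ φ'
  refine ⟨fun d => isNonlin_nonlin ⟨_, (isNonlin_tsum hs hW hW0 d).1⟩,
    fun τ v => cauchy_solveAt _ _, fun k τ _ r hr => ?_, fun k ψ => ?_, ?_⟩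
  · rw [prodD_eq hs hW hW0]
    have hm := H.prodSeries_majorant k τ
    have he := isEntire_lieIterate H.entire k
    refine (fockNorm_le hr.le le_rfl (fun ψ _ =>
      (hm.summable_norm H.pos he (cauchy 0 ψ)).of_norm.hasSum) ?_).trans_lt ENNReal.ofReal_lt_top
    refine Summable.of_nonneg_of_le (fun q => by positivity) (fun q => ?_)
      ((he.summable (r / 2)).mul_left (2 * ‖fluxL φ φ'‖))
    have h := hm.norm_mul_pow_le (z := r / 2) (by positivity) q
    rwa [mul_div_cancel₀ _ two_ne_zero] at h
  · simp only [prodD_eq hs hW hW0]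
    have h := (H.prodSeries_continuous k).continuousOn_sum H.pos
      (isEntire_lieIterate H.entire k) (K := Set.univ) fun τ _ => H.prodSeries_majorant k τ
    rw [Set.univ_prod_univ, continuousOn_univ] at h
    exact integrableOn_orderedTimes (h.comp (Continuous.prodMk_left (cauchy 0 ψ))) t
  · have h0 := H.summable_terms ht hρ hB
    have h1 : ∀ k, fockNorm ρ (texpTerm W t (creation φ φ' vacuum) k) ≤ ENNReal.ofReal
        (∑' q, ‖texpSeries (fieldSeries hs p) (fluxSeries φ φ') k t q‖ * (2 * ρ) ^ q) := by
      intro k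
      rw [texpTerm_eq hs hW hW0 φ φ' ht]
      have hm := H.texpSeries_majorant k t
      have he := isEntire_lieIterate H.entire k
      have h2 := fockNorm_le (r := ρ) (R := 2 * ρ)
        (S := fun q => (-1 : ℝ) ^ k • texpSeries (fieldSeries hs p) (fluxSeries φ φ') k t q)
        hρ (by linarith) (fun ψ _ =>
          ((hm.summable_norm H.pos he (cauchy 0 ψ)).of_norm.hasSum.mul_left ((-1 : ℝ) ^ k)))
        (by simpa [norm_smul] using h0.prod_factor k)
      simp only [norm_smul, norm_pow, norm_neg, norm_one, one_pow, one_mul] at h2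
      exact h2
    refine (ENNReal.tsum_le_tsum h1).trans_lt ?_
    rw [← ENNReal.ofReal_tsum_of_nonneg (fun k => tsum_nonneg fun q => by positivity) h0.prod]
    exact ENNReal.ofReal_lt_top

/-- Everything follows from convergence at one radius ρ > `dataNorm d`. The inequality persists near
d, where the series converges uniformly, whence continuity; and the multiples zd with |z| ≤ 1 stay
in the domain, as the bra requires. -/
theorem fockValue_of_summable (hs : (n : ℝ) / 2 < s) (hW : HasFPowerSeriesOnBall W p 0 ⊤)
    (hW0 : W 0 = 0) (φ : Sobolev n m (-s)) (φ' : Sobolev n m (-(s + 1))) {t ρ : ℝ} (ht : 0 ≤ t)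
    {d : Data n m s} (hd : dataNorm d < ρ)
    (hB : Summable fun k => t ^ k / k.factorial * evalSeries (lieIterate (majorant n m s p) k) ρ) :
    Summable (fun q => |fockSeries hs p φ φ' t q fun _ => d|) ∧
    HasSum (fun q => fockSeries hs p φ φ' t q fun _ => d)
      (texp W t (creation φ φ' vacuum) (solveAt t d)) ∧
    ContinuousAt (fun d => texp W t (creation φ φ' vacuum) (solveAt t d)) d ∧
    HasFockValue W φ φ' t d (texp W t (creation φ φ' vacuum) (solveAt t d)) := by
  have H := isAdmissible_field hs hW φ φ'
  have hρ : 0 < ρ := (dataNorm_nonneg d).trans_lt hd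
  set S := totalSeries (fieldSeries hs p) (fluxSeries φ φ') t with hS
  have hsum : Summable fun q => ‖S q‖ * (2 * ρ) ^ q := H.summable_totalSeries ht hρ hB
  have hv : ∀ ψ : FreeSol n m s, ‖cauchy 0 ψ‖ ≤ 2 * ρ →
      HasSum (fun q => S q fun _ => cauchy 0 ψ) (texp W t (creation φ φ' vacuum) ψ) := by
    intro ψ hψ
    rw [texp_eq hs hW hW0 φ φ' ht]
    exact H.hasSum_totalSeries ht hρ hB hψ
  have hle : ∀ d' : Data n m s, dataNorm d' < ρ → ‖evo (-t) d'‖ ≤ 2 * ρ := fun d' hd' =>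
    (norm_evo_apply_le _ _).trans (by linarith)
  have hv' : ∀ d' : Data n m s, dataNorm d' < ρ → HasSum (fun q => S q fun _ => evo (-t) d')
      (texp W t (creation φ φ' vacuum) (solveAt t d')) := fun d' hd' => by
    rw [← cauchy_zero_solveAt]
    exact hv _ (by rw [cauchy_zero_solveAt]; exact hle d' hd')
  have hbd : ∀ (q : ℕ) (d' : Data n m s), dataNorm d' < ρ →
      ‖S q fun _ => evo (-t) d'‖ ≤ ‖S q‖ * (2 * ρ) ^ q := fun q d' hd' =>
    (norm_diag_le S q _).trans (mul_le_mul_of_nonneg_left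
      (pow_le_pow_left₀ (norm_nonneg _) (hle d' hd') q) (norm_nonneg _))
  refine ⟨Summable.of_nonneg_of_le (fun q => abs_nonneg _) (fun q => hbd q d hd) hsum, hv' d hd,
    ?_, ⟨ρ, hd, texpConverges hs hW hW0 φ φ' ht hρ.le hB⟩, cauchy_solveAt t d, rfl, ?_⟩
  · have ho : IsOpen {d' : Data n m s | dataNorm d' < ρ} :=
      isOpen_lt continuous_dataNorm continuous_const
    have hc : ContinuousOn (fun d' : Data n m s => ∑' q, S q fun _ => evo (-t) d')
        {d' | dataNorm d' < ρ} := by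
      refine continuousOn_tsum (fun q => Continuous.continuousOn ?_) hsum
        fun q d' hd' => hbd q d' hd'
      exact (S q).cont.comp (continuous_pi fun _ => (evo (-t)).continuous)
    refine (hc.continuousAt (ho.mem_nhds hd)).congr ?_
    filter_upwards [ho.mem_nhds hd] with d' hd'
    exact (hv' d' hd').tsum_eq
  · refine hasBraValue_of_hasSum (c := fun q => S q fun _ => evo (-t) d) fun z hz => ?_
    have h1 : cauchy 0 (z • solveAt t d) = z • evo (-t) d := by
      rw [map_smul, cauchy_zero_solveAt]
    have h2 : ‖cauchy 0 (z • solveAt t d)‖ ≤ 2 * ρ := by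
      rw [h1, norm_smul]
      exact (mul_le_of_le_one_left (norm_nonneg _) hz).trans (hle d hd)
    refine (hv _ h2).congr_fun fun q => ?_
    rw [h1]
    have h3 := (S q).map_smul_univ (fun _ => z) fun _ => evo (-t) d
    simpa using h3.symm

theorem fockSeries_zero (hs : (n : ℝ) / 2 < s) (hW : HasFPowerSeriesOnBall W p 0 ⊤)
    (φ : Sobolev n m (-s)) (φ' : Sobolev n m (-(s + 1))) (t : ℝ) :
    fockSeries hs p φ φ' t 0 = 0 := by
  rw [fockSeries, (isAdmissible_field hs hW φ φ').totalSeries_apply_zero coeff_majorant_zero]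
  exact ContinuousMultilinearMap.ext fun _ => rfl

end Fock

/-! ### The constant term of the nonlinearity -/

section ConstantTerm

variable {n : ℕ} {m : ℝ}

/-- A point mass is not a locally integrable function. Test functions supported away from 0 give h =
0 almost everywhere, a point being a null set in positive dimension; a bump function equal to 1 at 0
then gives c = 0. -/
theorem eq_zero_of_integral_eq_apply_zero (hn : 1 ≤ n) {h : Space n → ℂ}
    (hh : LocallyIntegrable h) {c : ℂ}
    (H : ∀ η : Space n → ℝ, ContDiff ℝ ∞ η → HasCompactSupport η →
      ∫ ξ, η ξ • h ξ = c * (η 0 : ℂ)) : c = 0 := by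
  have : Nontrivial (Space n) := Module.nontrivial_of_finrank_pos (R := ℝ) (by
    rw [finrank_euclideanSpace_fin]
    omega)
  have h1 := isOpen_compl_singleton (x := (0 : Space n)).ae_eq_zero_of_integral_contDiff_smul_eq_zero
    (hh.locallyIntegrableOn _) fun η h1 h2 h3 => by
      rw [H η h1 h2, image_eq_zero_of_notMem_tsupport fun h0 => h3 h0 rfl]
      simp
  have h2 : h =ᵐ[volume] 0 := by
    filter_upwards [h1, compl_mem_ae_iff.2 (measure_singleton (0 : Space n))] with ξ h3 h4
    exact h3 h4
  obtain ⟨η, -, hη2, hη3, -, hη5⟩ := exists_contDiff_tsupport_subset (n := ⊤)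
    (Filter.univ_mem (f := nhds (0 : Space n)))
  have h3 := H η hη3 hη2
  rw [integral_congr_ae (g := fun _ => 0) (by
    filter_upwards [h2] with ξ hξ
    rw [hξ]
    simp), integral_zero, hη5] at h3
  simpa using h3.symm

theorem integral_eq_fourierInv_zero (ψ : 𝓢(Space n, ℂ)) : ∫ x, ψ x = 𝓕⁻ ψ 0 := by
  rw [SchwartzMap.fourierInv_coe, Real.fourierInv_eq']
  simp

variable [Fact (0 < m)] {s : ℝ}

theorem locallyIntegrable_epsReal_mul (σ : ℝ) (G : L2 n) :
    LocallyIntegrable fun ξ => (epsReal n m σ ξ : ℂ) * G ξ :=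
  ((Lp.memLp G).locallyIntegrable one_le_two).continuous_mul
    (Complex.continuous_ofReal.comp (continuous_epsReal σ))

/-- A constant is not the sum of a distribution in `H^s` and one in `H^{s-1}`. -/
theorem eq_zero_of_integral_eq_pairL2 (hn : 1 ≤ n) {c : ℂ} {G₁ G₂ : L2 n} (s r : ℝ)
    (H : ∀ ψ : 𝓢(Space n, ℂ),
      c * ∫ x, ψ x = pairL2 (testFun m s ψ) G₁ + pairL2 (testFun m r ψ) G₂) : c = 0 := by
  have l1 := locallyIntegrable_epsReal_mul (m := m) (-s) G₁
  have l2 := locallyIntegrable_epsReal_mul (m := m) (-r) G₂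
  refine eq_zero_of_integral_eq_apply_zero hn (l1.add l2) fun η h1 h2 => ?_
  have hc : HasCompactSupport fun ξ => (η ξ : ℂ) := h2.comp_left (g := Complex.ofReal) rfl
  have hs : ContDiff ℝ ∞ fun ξ => (η ξ : ℂ) := Complex.ofRealCLM.contDiff.comp h1
  set θ : 𝓢(Space n, ℂ) := hc.toSchwartzMap hs with hθ
  have hθa : ∀ ξ, θ ξ = (η ξ : ℂ) := fun ξ => rfl
  -- For the test function 𝓕θ the integral on the left is θ(0), while the right side becomes the
  -- integral of θ against a locally integrable function.
  have h3 := H (𝓕 θ)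
  rw [integral_eq_fourierInv_zero, pairL2_apply, pairL2_apply] at h3
  simp only [testFun_apply, FourierTransform.fourierInv_fourier_eq, hθa] at h3
  rw [h3, ← integral_add]
  · refine integral_congr_ae (Filter.Eventually.of_forall fun ξ => ?_)
    simp only [Pi.add_apply, Complex.real_smul]
    ring
  · refine (l1.integrable_smul_left_of_hasCompactSupport h1.continuous h2).congr
      (Filter.Eventually.of_forall fun ξ => ?_)
    simp only [Complex.real_smul]
    ring
  · refine (l2.integrable_smul_left_of_hasCompactSupport h1.continuous h2).congr
      (Filter.Eventually.of_forall fun ξ => ?_)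
    simp only [Complex.real_smul]
    ring

variable {W : ℝ × (Fin (n + 1) → ℝ) → ℝ} {p : FormalMultilinearSeries ℝ (ℝ × (Fin (n + 1) → ℝ)) ℝ}

theorem _root_.HasFPowerSeriesOnBall.sub_apply_zero (hW : HasFPowerSeriesOnBall W p 0 ⊤) :
    HasFPowerSeriesOnBall (fun y => W y - W 0) (p - constFormalMultilinearSeries ℝ _ (W 0)) 0 ⊤ :=
  hW.sub hasFPowerSeriesOnBall_const

theorem integral_localFun (hs : (n : ℝ) / 2 < s) (hW : HasFPowerSeriesOnBall W p 0 ⊤)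
    (d : Data n m s) (ψ : 𝓢(Space n, ℂ)) :
    ∫ x, ψ x * (localFun W d x : ℂ) =
      (W 0 : ℂ) * (∫ x, ψ x) + (nonlin (fun y => W y - W 0) d).dist ψ := by
  have hW' := hW.sub_apply_zero
  have h := isNonlin_nonlin ⟨_, (isNonlin_tsum (m := m) hs hW' (sub_self _) d).1⟩
  obtain ⟨h1, h2⟩ := h.2 ψ
  rw [h2, ← integral_const_mul, ← integral_add (ψ.integrable.const_mul _) h1]
  refine integral_congr_ae (Filter.Eventually.of_forall fun x => ?_)
  simp only [localFun]
  push_cast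
  ring

/-- Integrated from t₀ to t, the equation expresses the constant (t - t₀)W(0) as an element of H^s,
built from ∂ₜu and the nonlinearity without constant term, minus the integral of (m² - Δ)u, which
lies in H^{s-1}. The Fourier transform of such a sum is a locally integrable function, that of a
nonzero constant is not. -/
theorem constant_eq_zero (hn : 1 ≤ n) (hs : (n : ℝ) / 2 < s) (hW : HasFPowerSeriesOnBall W p 0 ⊤)
    {I : Set ℝ} (hI : IsOpen I) (hc : I.OrdConnected) {u : ℝ → Sobolev n m (s + 1)}
    {u' : ℝ → Sobolev n m s} (hu : IsNonlinearSolution W I u u') {t t₀ : ℝ} (ht : t ∈ I)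
    (ht₀ : t₀ ∈ I) (h : t₀ < t) : W 0 = 0 := by
  have hW' := hW.sub_apply_zero
  set N : ℝ → Sobolev n m s := fun r => nonlin (fun y => W y - W 0) (u r, u' r) with hN
  have hNc : ContinuousOn N I := (continuous_nonlin hs hW' (sub_self _)).comp_continuousOn
    (hu.1.continuousOn.prodMk hu.1.continuousOn_deriv)
  have cN : ContinuousOn (fun r => (N r).toL2) I := Sobolev.continuous_toL2.comp_continuousOn hNc
  have cu : ContinuousOn (fun r => (u r).toL2) I :=
    Sobolev.continuous_toL2.comp_continuousOn hu.1.continuousOn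
  have iN : IntervalIntegrable (fun r => (N r).toL2) volume t₀ t :=
    intervalIntegrable_of_continuousOn hc cN ht ht₀
  have iu : IntervalIntegrable (fun r => (u r).toL2) volume t₀ t :=
    intervalIntegrable_of_continuousOn hc cu ht ht₀
  have key := eq_zero_of_integral_eq_pairL2 (m := m) hn (c := ((t - t₀ : ℝ) : ℂ) * (W 0 : ℂ))
    (G₁ := (u' t₀).toL2 - (u' t).toL2 - ∫ r in t₀..t, (N r).toL2)
    (G₂ := -∫ r in t₀..t, (u r).toL2) s (s - 1) fun ψ => by
      have hF : ∀ r, ∫ x, ψ x * (localFun W (u r, u' r) x : ℂ) =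
          (W 0 : ℂ) * (∫ x, ψ x) + pairL2 (testFun m s ψ) (N r).toL2 := fun r => by
        rw [integral_localFun hs hW, Sobolev.dist_eq_pairL2]
      have e := hu.1.sub_eq_integral hI hc ψ (F := fun r ψ =>
        ∫ x, ψ x * (localFun W (u r, u' r) x : ℂ)) (by
          simp only [hF]
          exact continuousOn_const.add ((pairL2 _).continuous.comp_continuousOn cN)) hu.2 ht ht₀
      simp only [hF] at e
      have i1 : IntervalIntegrable (fun r => pairL2 (testFun m (s - 1) ψ) (u r).toL2)
          volume t₀ t := intervalIntegrable_of_continuousOn hc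
            ((pairL2 _).continuous.comp_continuousOn cu) ht ht₀
      have i2 : IntervalIntegrable (fun r => pairL2 (testFun m s ψ) (N r).toL2)
          volume t₀ t := intervalIntegrable_of_continuousOn hc
            ((pairL2 _).continuous.comp_continuousOn cN) ht ht₀
      rw [intervalIntegral.integral_add i1 (intervalIntegrable_const.add i2),
        intervalIntegral.integral_add intervalIntegrable_const i2, intervalIntegral.integral_const,
        ContinuousLinearMap.intervalIntegral_comp_comm _ iu,
        ContinuousLinearMap.intervalIntegral_comp_comm _ iN, Complex.real_smul] at e
      simp only [map_sub, map_neg]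
      linear_combination e
  rcases mul_eq_zero.1 key with h0 | h0
  · exact absurd (Complex.ofReal_eq_zero.1 h0) (sub_pos.2 h).ne'
  · exact Complex.ofReal_eq_zero.1 h0

end ConstantTerm

/-! ### The main theorem -/

section Main

variable {n : ℕ} {m : ℝ} [Fact (0 < m)] {s : ℝ} {W : ℝ × (Fin (n + 1) → ℝ) → ℝ}
  {p : FormalMultilinearSeries ℝ (ℝ × (Fin (n + 1) → ℝ)) ℝ}

theorem isOpen_timeInterval (a b : EReal) : IsOpen {t : ℝ | a < (t : EReal) ∧ (t : EReal) < b} :=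
  isOpen_Ioo.preimage continuous_coe_real_ereal

theorem ordConnected_timeInterval (a b : EReal) :
    {t : ℝ | a < (t : EReal) ∧ (t : EReal) < b}.OrdConnected :=
  (Set.ordConnected_Ioo (a := a) (b := b)).preimage_mono
    EReal.coe_strictMono.monotone

/-- The existence of the flow up to time t from `dataNorm d` gives summability at a radius larger by
some ε, which is the hypothesis of `fockValue_of_summable`. -/
theorem fockValue_of_flowsTo (hs : (n : ℝ) / 2 < s) (hW : HasFPowerSeriesOnBall W p 0 ⊤)
    (hW0 : W 0 = 0) {X : ℂ → ℂ} (hX : ∀ z : ℂ, HasSum (fun k =>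
      ((PowerSeries.coeff k (majorant n m s p) : ℝ) : ℂ) * z ^ k) (X z))
    (φ : Sobolev n m (-s)) (φ' : Sobolev n m (-(s + 1))) {t : ℝ} (ht : 0 ≤ t)
    {d : Data n m s} {w : ℂ} (hw : FlowsTo X t (dataNorm d : ℂ) w) :
    Summable (fun q => |fockSeries hs p φ φ' t q fun _ => d|) ∧
    HasSum (fun q => fockSeries hs p φ φ' t q fun _ => d)
      (texp W t (creation φ φ' vacuum) (solveAt t d)) ∧
    ContinuousAt (fun d => texp W t (creation φ φ' vacuum) (solveAt t d)) d ∧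
    HasFockValue W φ φ' t d (texp W t (creation φ φ' vacuum) (solveAt t d)) := by
  obtain ⟨ε, hε, h⟩ := sum_lieIterate_le (isEntire_majorant hW) nonnegCoeff_majorant hX t ‖w‖
    (norm_nonneg w)
  have hd := dataNorm_nonneg d
  refine fockValue_of_summable hs hW hW0 φ φ' ht (lt_add_of_pos_right _ hε) ?_
  exact (isAdmissible_field hs hW φ φ').summable_texpSeries_sum ht (by positivity)
    (h t _ w ht le_rfl hd hw le_rfl).2

/-- The conservation law needs one margin ε for all times in [0, T]; this is where the uniform bound
M on the flows is used. -/
theorem texp_eq_flux (hs : (n : ℝ) / 2 < s) (hW : HasFPowerSeriesOnBall W p 0 ⊤)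
    (hW0 : W 0 = 0) {X : ℂ → ℂ} (hX : ∀ z : ℂ, HasSum (fun k =>
      ((PowerSeries.coeff k (majorant n m s p) : ℝ) : ℂ) * z ^ k) (X z))
    {I : Set ℝ} (hI : IsOpen I) (hc : I.OrdConnected) {u : ℝ → Sobolev n m (s + 1)}
    {u' : ℝ → Sobolev n m s} (hu : IsNonlinearSolution W I u u')
    (φ : Sobolev n m (-s)) (φ' : Sobolev n m (-(s + 1))) {T M : ℝ} (hT : 0 ≤ T)
    (hTI : Set.Icc 0 T ⊆ I)
    (hM : ∀ t ∈ Set.Icc 0 T, ∃ w : ℂ, FlowsTo X t (dataNorm (u t, u' t) : ℂ) w ∧ ‖w‖ ≤ M) :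
    texp W T (creation φ φ' vacuum) (solveAt T (u T, u' T)) = flux (u 0, u' 0) φ φ' := by
  have hM0 : 0 ≤ M := by
    obtain ⟨w, -, hw⟩ := hM 0 ⟨le_rfl, hT⟩
    exact (norm_nonneg w).trans hw
  obtain ⟨ε, hε, h⟩ := sum_lieIterate_le (isEntire_majorant hW) nonnegCoeff_majorant hX T M hM0
  have h' : ∀ t ∈ Set.Icc 0 T, dataNorm (u t, u' t) ≤ M ∧
      ∀ K, ∑ k ∈ Finset.range (K + 1), t ^ k / k.factorial *
        evalSeries (lieIterate (majorant n m s p) k) (dataNorm (u t, u' t) + ε) ≤ M + 1 :=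
    fun t ht => by
      obtain ⟨w, hw, hwM⟩ := hM t ht
      exact h t _ w ht.1 ht.2 (dataNorm_nonneg _) hw hwM
  have hNc : ContinuousOn (fun t => nonlin W (u t, u' t)) I :=
    (continuous_nonlin hs hW hW0).comp_continuousOn
      (hu.1.continuousOn.prodMk hu.1.continuousOn_deriv)
  have hw : IsWeakSolution m I (fun t => (u t).dist) fun t ψ =>
      (nonlin W (u t, u' t)).dist ψ := by
    have e : (fun t (ψ : 𝓢(Space n, ℂ)) => (nonlin W (u t, u' t)).dist ψ) =
        fun t ψ => ∫ x, ψ x * (localFun W (u t, u' t) x : ℂ) := by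
      funext t ψ
      exact ((isNonlin_nonlin ⟨_, (isNonlin_tsum hs hW hW0 (u t, u' t)).1⟩).2 ψ).2
    rw [e]
    exact hu.2
  have hcons := (isAdmissible_field hs hW φ φ').conservation
    (Ψ := fun t => evo (-t) (u t, u' t)) (z := fun t => dataNorm (u t, u' t)) (B := M + 1)
    hT hε (fun t ht => by
      rw [fieldSeries_sum hs hW hW0, evo_evo_neg]
      exact hu.1.hasDerivAt_evo hI hc hNc hw (hTI ht))
    (fun t ht => ⟨(norm_evo_apply_le _ _).trans (by linarith [dataNorm_nonneg (u t, u' t)]),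
      dataNorm_nonneg _, (h' t ht).1⟩) fun t ht => (h' t ht).2
  rw [texp_eq hs hW hW0 φ φ' hT, cauchy_zero_solveAt, hcons, fluxSeries_sum, neg_zero, evo_zero]

end Main

end KleinGordon

end

theorem mainTheorem1 (n : ℕ) (hn : 1 ≤ n) (m : ℝ) [Fact (0 < m)] (s : ℝ) (hs : (n : ℝ) / 2 < s)
    (W : ℝ × (Fin (n + 1) → ℝ) → ℝ)
    (hW : ∃ p : FormalMultilinearSeries ℝ (ℝ × (Fin (n + 1) → ℝ)) ℝ,
      HasFPowerSeriesOnBall W p 0 ⊤) :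
    ∃ (X : ℂ → ℂ) (a : ℕ → ℝ),
      (∀ k, 0 ≤ a k) ∧ (∀ z : ℂ, HasSum (fun k => (a k : ℂ) * z ^ k) (X z)) ∧
      ∀ (tmin tmax : EReal), tmin < 0 → 0 < tmax →
      ∀ (u : ℝ → Sobolev n m (s + 1)) (u' : ℝ → Sobolev n m s),
        IsNonlinearSolution W {t : ℝ | tmin < (t : EReal) ∧ (t : EReal) < tmax} u u' →
        (∃ M : ℝ, ∀ t : ℝ, 0 ≤ t → (t : EReal) < tmax →
          ∃ w : ℂ, FlowsTo X t (dataNorm (u t, u' t) : ℂ) w ∧ ‖w‖ ≤ M) →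
        ∀ (φ : ℝ → Sobolev n m (-s)) (φ' : ℝ → Sobolev n m (-(s + 1))),
          IsFree (neg_le_neg (le_add_one' s)) φ φ' →
          ∃ (F : ℝ → Data n m s → ℝ) (P : ℝ → FormalMultilinearSeries ℝ (Data n m s) ℝ),
            ∀ t : ℝ, 0 ≤ t → (t : EReal) < tmax →
              P t 0 = 0 ∧
              (∀ d : Data n m s, (∃ w : ℂ, FlowsTo X t (dataNorm d : ℂ) w) →
                Summable (fun p => |P t p (fun _ => d)|) ∧
                HasSum (fun p => P t p (fun _ => d)) (F t d) ∧
                ContinuousAt (F t) d ∧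
                HasFockValue W (φ 0) (φ' 0) t d (F t d)) ∧
              F t (u t, u' t) = flux (u 0, u' 0) (φ 0) (φ' 0) := by
  obtain ⟨p, hp⟩ := hW
  -- If W(0) = 0, the vector field X is the sum of `majorant`, and the functional is the time
  -- ordered exponential at the free solution with data d at time t.
  by_cases hW0 : W 0 = 0
  · have hX : ∀ z : ℂ, HasSum (fun k =>
        ((PowerSeries.coeff k (majorant n m s p) : ℝ) : ℂ) * z ^ k)
        (∑' k, ((PowerSeries.coeff k (majorant n m s p) : ℝ) : ℂ) * z ^ k) := fun z => by
      refine (Summable.of_norm ?_).hasSum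
      simpa using isEntire_majorant (n := n) (m := m) (s := s) hp ‖z‖ (norm_nonneg z)
    refine ⟨_, _, nonnegCoeff_majorant, hX, ?_⟩
    intro tmin tmax hmin _ u u' hu ⟨M, hM⟩ φ φ' _
    refine ⟨fun t d => texp W t (creation (φ 0) (φ' 0) vacuum) (solveAt t d),
      fockSeries hs p (φ 0) (φ' 0), fun t ht htmax => ⟨fockSeries_zero hs hp _ _ t,
        fun d ⟨w, hw⟩ => fockValue_of_flowsTo hs hp hW0 hX (φ 0) (φ' 0) ht hw, ?_⟩⟩
    have hlt : ∀ r ∈ Set.Icc 0 t, (r : EReal) < tmax := fun r hr =>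
      (EReal.coe_le_coe_iff.2 hr.2).trans_lt htmax
    exact texp_eq_flux hs hp hW0 hX (isOpen_timeInterval tmin tmax)
      (ordConnected_timeInterval tmin tmax) hu (φ 0) (φ' 0) ht
      (fun r hr => ⟨hmin.trans_le (EReal.coe_nonneg.2 hr.1), hlt r hr⟩)
      fun r hr => hM r hr.1 (hlt r hr)
  -- If W(0) ≠ 0, no weak solution exists on any open time interval around 0, so the zero vector
  -- field will do.
  · refine ⟨fun _ => 0, fun _ => 0, fun _ => le_rfl, fun z => by simp, ?_⟩
    intro tmin tmax hmin hmax u u' hu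
    obtain ⟨t, ht0, ht⟩ := EReal.lt_iff_exists_real_btwn.1 hmax
    exact absurd (constant_eq_zero hn hs hp (isOpen_timeInterval tmin tmax)
      (ordConnected_timeInterval tmin tmax) hu ⟨hmin.trans ht0, ht⟩ (t₀ := 0) ⟨hmin, hmax⟩
      (EReal.coe_pos.1 ht0)) hW0
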